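/- Setting. Let $\tilde M$ be an oriented Riemannian surface without boundary and $\Gamma$ a countable group acting freely and properly discontinuously on $\tilde M$ by orientation preserving isometries; put $M=\tilde M/\Gamma$. (For instance $\tilde M$ is the universal cover and $\Gamma=\pi_1(M)$, where $M$ is a closed oriented surface, or the interior of a compact oriented surface with boundary.) Let $\mathbb R^{n,1}$ carry the form $(X,Y)^\sharp=\sum_{i\le n}X_iY_i-X_{n+1}Y_{n+1}$, write $X^\sharp=(\cdot,X)^\sharp$, let $\mathbb H=\{X:(X,X)^\sharp=-1,\ X_{n+1}\ge 1\}$ be hyperbolic $n$-space, and let $\mathfrak g=so(n,1)$ carry the form $(A,B)^\sharp=\mathrm{Tr}\,AB$. Let $\rho:\Gamma\to SO^+(n,1)$ be a homomorphism, $E=\tilde M\times_\rho\mathbb R^{n,1}$ and $ad(E)=\tilde M\times_{Ad\rho}\mathfrak g$ the flat bundles over $M$, and $d$ their flat connections; sections are equivariant maps on $\tilde M$. For $X,Y\in\mathbb R^{n,1}$ put $X\times Y=YX^\sharp-XY^\sharp\in\mathfrak g$. For $u\in\mathbb H$, a subscript $u$ denotes the orthogonal projection $\xi_u=\xi+(\xi,u)^\sharp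 u$ of $\mathbb R^{n,1}$ onto $T_u\mathbb H$, respectively the orthogonal projection $\psi_u=(\psi u)\times u$ of $\mathfrak g$ onto $\mathfrak p_u=\{v\times u: v\in T_u\mathbb H\}$; both forms are positive definite on these subspaces. For a 1-form $W=W_u$ with values in $E$ or $ad(E)$, let $Q(W)^2=(W;W^\sharp)=\sum_\alpha W(e_\alpha)\otimes (W(e_\alpha),\cdot)^\sharp$ ($e_\alpha$ an orthonormal frame of $M$), let $Q(W)^a$ be the real powers of this non-negative endomorphism, and let $|W|_{sv^a}^a=\mathrm{Tr}\,Q(W)^a$ and $\|W\|_{sv^a}^a=\int_M|W|_{sv^a}^a*1$. Write $\langle A,B\rangle=\int_M(A;B)^\sharp*1$. Let $2<p<\infty$ and $1/p+1/q=1$. Let $u$ be a continuous $\rho$-equivariant map $\tilde M\to\mathbb H$ of class $W^{1,p}$ (for instance a lift of a map from $M$ to a closed hyperbolic manifold), with $J_p(u)=\|du\|_{sv^p}^p<\infty$, satisfying the $J_p$-Euler–Lagrange equations $\langle Q(du)^{p-2}du,(d\phi)_u\rangle=0$ for all compactly supported sections $\phi=\phi_u$ of $E$ over $M$ of class $W^{1,p}\cap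 C^0$. Put $S_{p-1}(du)=Q(du)^{p-2}du$, $Z=*S_{p-1}(du)$ and $V=*S_{p-1}(du)\times u$. Let $W^{1,q}_0$ denote the sections $\xi=\xi_u$ (of $E$ or of $ad(E)$) of class $W^{1,q}_{loc}$ that are limits of compactly supported ones $\eta=\eta_u$ of class $W^{1,q}$ in the sense $\int_M|\xi-\eta|^q*1+\|(d\xi-d\eta)_u\|_{sv^q}^q\to0$. If $M$ is closed, these are all the $W^{1,q}$ sections with $\xi=\xi_u$; on the interior of a compact surface they are those vanishing on the boundary. Theorem. (a) The functional $J_q(\xi)=\|Z+(d\xi)_u\|_{sv^q}^q$ is finite at $\xi=0$, and its minimum over all sections $\xi=\xi_u$ of $E$ of class $W^{1,q}_0$ is taken on at $\xi=0$. Furthermore $d*Q(Z)^{q-2}Z=0$ weakly: $(Q(Z)^{q-2}Z;d\eta)^\sharp$ is integrable and $\langle Q(Z)^{q-2}Z,d\eta\rangle=0$ for all compactly supported sections $\eta$ of $E$ over $M$ of class $W^{1,q}$ (tangent or not). (b) The functional $J_q(\psi)=\|V+(d\psi)_u\|_{sv^q}^q$ is finite at $\psi=0$, and its minimum over all sections $\psi=\psi_u$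 of $ad(E)$ of class $W^{1,q}_0$ is taken on at $\psi=0$. Furthermore its Euler–Lagrange equation $(d*Q(V)^{q-2}V)_u=0$ holds weakly: $(Q(V)^{q-2}V;d\psi)^\sharp$ is integrable and $\langle Q(V)^{q-2}V,d\psi\rangle=0$ for all compactly supported sections $\psi=\psi_u$ of $ad(E)$ over $M$ of class $W^{1,q}$. -/

import Mathlib

open MeasureTheory Set Filter Topology
open scoped Manifold ContDiff ENNReal

noncomputable section

namespace DualHarmonic

/-! ### The hyperboloid, its isometry group and Lie algebra -/

/-- The underlying space of `ℝ^{n,1}`; the last coordinate is the time-like one. -/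
abbrev Mink (n : ℕ) : Type := Fin n ⊕ Unit → ℝ

/-- `e^♯ = diag(1, …, 1, -1)`. -/
abbrev eSharp (n : ℕ) : Matrix (Fin n ⊕ Unit) (Fin n ⊕ Unit) ℝ :=
  LieAlgebra.Orthogonal.indefiniteDiagonal (Fin n) Unit ℝ

/-- The indefinite inner product `(X, Y)^♯ = Xᵀ e^♯ Y`. -/
def mform (n : ℕ) : LinearMap.BilinForm ℝ (Mink n) := Matrix.toBilin' (eSharp n)

/-- The upper unit hyperboloid `ℍ = {X : (X, X)^♯ = -1, X_{n+1} ≥ 1}`. -/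
def hyperboloid (n : ℕ) : Set (Mink n) := {X | mform n X X = -1 ∧ 1 ≤ X (Sum.inr ())}

/-- `SO⁺(n,1)`: determinant one, preserving the form and the upper sheet. -/
def SOPlus (n : ℕ) : Subgroup (Matrix.SpecialLinearGroup (Fin n ⊕ Unit) ℝ) where
  carrier := {A | (A.1.transpose * eSharp n * A.1 = eSharp n) ∧
    ∀ X : Mink n, A.1.mulVec X ∈ hyperboloid n ↔ X ∈ hyperboloid n}
  one_mem' := by simp
  mul_mem' := by
    rintro A B ⟨hA, hA'⟩ ⟨hB, hB'⟩
    refine ⟨?_, fun X => ?_⟩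
    · have : (A * B).1 = A.1 * B.1 := rfl
      rw [this, Matrix.transpose_mul]
      calc B.1.transpose * A.1.transpose * eSharp n * (A.1 * B.1)
          = B.1.transpose * (A.1.transpose * eSharp n * A.1) * B.1 := by
            simp only [Matrix.mul_assoc]
        _ = eSharp n := by rw [hA, hB]
    · have : (A * B).1 = A.1 * B.1 := rfl
      rw [this, ← Matrix.mulVec_mulVec, hA', hB']
  inv_mem' := by
    rintro A ⟨hA, hA'⟩
    have h1 : A.1 * (A⁻¹).1 = 1 := congrArg Subtype.val (mul_inv_cancel A)
    refine ⟨?_, fun X => ?_⟩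
    · have h2 : (A⁻¹).1.transpose * A.1.transpose = 1 := by
        rw [← Matrix.transpose_mul, h1, Matrix.transpose_one]
      calc (A⁻¹).1.transpose * eSharp n * (A⁻¹).1
          = (A⁻¹).1.transpose * (A.1.transpose * eSharp n * A.1) * (A⁻¹).1 := by rw [hA]
        _ = ((A⁻¹).1.transpose * A.1.transpose) * eSharp n * (A.1 * (A⁻¹).1) := by
            simp only [Matrix.mul_assoc]
        _ = eSharp n := by rw [h1, h2, Matrix.one_mul, Matrix.mul_one]
    · rw [← hA' ((A⁻¹).1.mulVec X), Matrix.mulVec_mulVec, h1, Matrix.one_mulVec]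

/-- The action of `SO⁺(n,1)` on `ℝ^{n,1}`. -/
def vecAct {n : ℕ} (A : SOPlus n) : Mink n →ₗ[ℝ] Mink n := Matrix.toLin' A.1.1

/-- The Lie algebra `𝔤 = so(n,1)` of matrices with `B^♯ = -B`. -/
abbrev soLie (n : ℕ) : Submodule ℝ (Matrix (Fin n ⊕ Unit) (Fin n ⊕ Unit) ℝ) :=
  skewAdjointMatricesSubmodule (eSharp n)

theorem mem_soLie_iff {n : ℕ} (B : Matrix (Fin n ⊕ Unit) (Fin n ⊕ Unit) ℝ) :
    B ∈ soLie n ↔ B.transpose * eSharp n = eSharp n * -B :=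
  mem_skewAdjointMatricesSubmodule (eSharp n) B

theorem eSharp_transpose (n : ℕ) : (eSharp n).transpose = eSharp n :=
  Matrix.diagonal_transpose _

theorem eSharp_mul_self (n : ℕ) : eSharp n * eSharp n = 1 := by
  simp only [eSharp, LieAlgebra.Orthogonal.indefiniteDiagonal, Matrix.diagonal_mul_diagonal]
  rw [← Matrix.diagonal_one]
  congr 1
  funext i
  rcases i with i | i <;> simp

/-- The adjoint action `B ↦ A B A⁻¹` of `SO⁺(n,1)` on `𝔤`. -/
def adAct {n : ℕ} (A : SOPlus n) : soLie n →ₗ[ℝ] soLie n where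
  toFun B := ⟨A.1.1 * B.1 * (A⁻¹).1.1, by
    have h1 : A.1.1 * (A⁻¹).1.1 = 1 := congrArg (fun C => C.1.1) (mul_inv_cancel A)
    have h1' : (A⁻¹).1.1 * A.1.1 = 1 := congrArg (fun C => C.1.1) (inv_mul_cancel A)
    have hA : A.1.1.transpose * eSharp n * A.1.1 = eSharp n := A.2.1
    have hA' : (A⁻¹).1.1.transpose * eSharp n * (A⁻¹).1.1 = eSharp n := (A⁻¹).2.1
    have hB := (mem_soLie_iff B.1).1 B.2
    have e1 : A.1.1.transpose * eSharp n = eSharp n * (A⁻¹).1.1 := by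
      rw [← hA, Matrix.mul_assoc _ A.1.1, h1, Matrix.mul_one, hA]
    have e2 : (A⁻¹).1.1.transpose * eSharp n = eSharp n * A.1.1 := by
      rw [← hA', Matrix.mul_assoc _ (A⁻¹).1.1, h1', Matrix.mul_one, hA']
    rw [mem_soLie_iff, Matrix.transpose_mul, Matrix.transpose_mul]
    calc (A⁻¹).1.1.transpose * (B.1.transpose * A.1.1.transpose) * eSharp n
        = (A⁻¹).1.1.transpose * (B.1.transpose * (A.1.1.transpose * eSharp n)) := by
          simp only [Matrix.mul_assoc]
      _ = (A⁻¹).1.1.transpose * ((B.1.transpose * eSharp n) * (A⁻¹).1.1) := by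
          rw [e1]; simp only [Matrix.mul_assoc]
      _ = ((A⁻¹).1.1.transpose * eSharp n) * (-B.1 * (A⁻¹).1.1) := by
          rw [hB]; simp only [Matrix.mul_assoc]
      _ = eSharp n * -(A.1.1 * B.1 * (A⁻¹).1.1) := by
          rw [e2]; simp only [Matrix.mul_assoc, Matrix.neg_mul, Matrix.mul_neg]⟩
  map_add' B C := by
    ext1
    simp [Matrix.mul_add, Matrix.add_mul]
  map_smul' c B := by
    ext1
    simp

/-- The form `(A, B)^♯ = Tr (A B)` on `𝔤`. -/
def killing (n : ℕ) : LinearMap.BilinForm ℝ (soLie n) :=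
  LinearMap.mk₂ ℝ (fun A B : soLie n => (A.1 * B.1).trace)
    (fun A A' B => by simp [Matrix.add_mul])
    (fun c A B => by simp)
    (fun A B B' => by simp [Matrix.mul_add])
    (fun c A B => by simp)

/-- The row vector `X^♯ = (e^♯ X)ᵀ`. -/
def rowSharp {n : ℕ} (X : Mink n) : Mink n := (eSharp n).mulVec X

theorem cross_mem {n : ℕ} (X Y : Mink n) :
    Matrix.vecMulVec Y (rowSharp X) - Matrix.vecMulVec X (rowSharp Y) ∈ soLie n := by
  rw [mem_soLie_iff]
  have h : ∀ a b : Mink n, (Matrix.vecMulVec a (rowSharp b)).transpose * eSharp n =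
      Matrix.vecMulVec (rowSharp b) (rowSharp a) := by
    intro a b
    rw [Matrix.transpose_vecMulVec, Matrix.vecMulVec_mul, rowSharp, rowSharp,
      ← Matrix.vecMul_transpose (eSharp n) a, eSharp_transpose]
  have h' : ∀ a b : Mink n, eSharp n * Matrix.vecMulVec a (rowSharp b) =
      Matrix.vecMulVec (rowSharp a) (rowSharp b) := by
    intro a b
    rw [Matrix.mul_vecMulVec, rowSharp, rowSharp]
  rw [Matrix.transpose_sub, Matrix.sub_mul, h, h, Matrix.mul_neg, Matrix.mul_sub, h', h']
  abel

/-- `β_X : ℝ^{n,1} → 𝔤`, `v ↦ v × X`, where `X × Y = Y X^♯ - X Y^♯`. -/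
def beta {n : ℕ} (X : Mink n) : Mink n →ₗ[ℝ] soLie n where
  toFun v := ⟨Matrix.vecMulVec X (rowSharp v) - Matrix.vecMulVec v (rowSharp X), cross_mem v X⟩
  map_add' v w := by
    ext1
    simp only [rowSharp, Matrix.mulVec_add, Matrix.vecMulVec_add, Matrix.add_vecMulVec,
      AddMemClass.coe_add]
    abel
  map_smul' c v := by
    ext1
    simp [rowSharp, Matrix.mulVec_smul, Matrix.vecMulVec_smul, Matrix.smul_vecMulVec, smul_sub]

/-- `α_X : 𝔤 → T_Xℍ`, `A ↦ A X`. -/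
def alpha {n : ℕ} (X : Mink n) : soLie n →ₗ[ℝ] Mink n where
  toFun A := A.1.mulVec X
  map_add' A B := by simp [Matrix.add_mulVec]
  map_smul' c A := by simp [Matrix.smul_mulVec]

/-- `ξ ↦ ξ_X = ξ + (ξ, X)^♯ X`: for `X ∈ ℍ`, the orthogonal projection onto `T_Xℍ = X^⊥`. -/
def projVec {n : ℕ} (X : Mink n) : Mink n →ₗ[ℝ] Mink n :=
  LinearMap.id + ((mform n).flip X).smulRight X

/-- `ψ ↦ ψ_X = (ψ X) × X`: for `X ∈ ℍ`, the projection of `𝔤 = ker α_X ⊕ 𝔭_X`, `𝔭_X = β_X(T_Xℍ)`,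
onto the positive definite part `𝔭_X`, orthogonal for the Killing form. -/
def projAd {n : ℕ} (X : Mink n) : soLie n →ₗ[ℝ] soLie n := beta X ∘ₗ alpha X

/-! ### Oriented Riemannian surfaces -/

/-- The coordinate plane. -/
abbrev Plane : Type := EuclideanSpace ℝ (Fin 2)

/-- The standard basis of the plane. -/
abbrev stdVec (i : Fin 2) : Plane := EuclideanSpace.single i 1

section Surface

variable {M : Type*} [TopologicalSpace M] [ChartedSpace Plane M] [IsManifold (𝓡 2) ∞ M]

/-- Smooth Riemannian metrics on a surface. -/
abbrev Metric (M : Type*) [TopologicalSpace M] [ChartedSpace Plane M] [IsManifold (𝓡 2) ∞ M] :=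
  Bundle.ContMDiffRiemannianMetric (𝓡 2) ∞ Plane (fun x : M => TangentSpace (𝓡 2) x)

/-- An orientation of a Riemannian surface, given as the smooth field of positive rotations
by a right angle. -/
structure SurfaceOrientation (g : Metric M) where
  rot : (x : M) → (TangentSpace (𝓡 2) x →L[ℝ] TangentSpace (𝓡 2) x)
  rot_rot : ∀ x v, rot x (rot x v) = -v
  inner_rot : ∀ x v w, g.inner x (rot x v) (rot x w) = g.inner x v w
  contMDiff : ContMDiff (𝓡 2) ((𝓡 2).prod 𝓘(ℝ, Plane →L[ℝ] Plane)) ∞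
    (fun x => Bundle.TotalSpace.mk' (Plane →L[ℝ] Plane)
      (E := fun x : M => TangentSpace (𝓡 2) x →L[ℝ] TangentSpace (𝓡 2) x) x (rot x))

/-- The coordinate vector field `∂_i` of the chart at `c`, at the point with coordinates `y`. -/
def coordVec (c : M) (y : Plane) (i : Fin 2) : TangentSpace (𝓡 2) ((chartAt Plane c).symm y) :=
  mfderiv 𝓘(ℝ, Plane) (𝓡 2) (chartAt Plane c).symm y (stdVec i)

/-- The Riemannian measure: the measure equal to `√(det g_ij) dy` in every chart, i.e. the
supremum of these measures over all charts. -/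
def riemVol [MeasurableSpace M] (g : Metric M) : Measure M :=
  ⨆ c : M, (((volume.restrict (chartAt Plane c).target).withDensity fun y =>
    ENNReal.ofReal (Real.sqrt (Matrix.det (Matrix.of fun i j : Fin 2 =>
      g.inner ((chartAt Plane c).symm y) (coordVec c y i) (coordVec c y j)))))).map
    (chartAt Plane c).symm

/-- A basis of the tangent space at `x`. -/
def tanVec (x : M) (i : Fin 2) : TangentSpace (𝓡 2) x := stdVec i

/-- The inverse `g^{ij}` of the Gram matrix of the basis `tanVec x`. -/
def gInv (g : Metric M) (x : M) : Matrix (Fin 2) (Fin 2) ℝ :=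
  (Matrix.of fun i j : Fin 2 => g.inner x (tanVec x i) (tanVec x j))⁻¹

/-- (Rough) 1-forms on `M` with values in a vector space. -/
abbrev OneForm (M : Type*) [TopologicalSpace M] [ChartedSpace Plane M]
    (V : Type*) [AddCommGroup V] [Module ℝ V] :=
  (x : M) → (TangentSpace (𝓡 2) x →ₗ[ℝ] V)

section Values

variable {V : Type*} [AddCommGroup V] [Module ℝ V]

/-- The Hodge star on 1-forms: `(*W)(v) = -W(rot v)`, so that `*dx = dy` in positively oriented
orthonormal coordinates. -/
def star {g : Metric M} (o : SurfaceOrientation g) (W : OneForm M V) : OneForm M V :=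
  fun x => -(W x ∘ₗ (o.rot x).toLinearMap)

/-- The pairing `(A; C)^♯ = ∑ g^{ij} B(A_i, C_j)` of `V`-valued covectors, `B` being the
(indefinite) inner product of `V`. -/
def pairing (g : Metric M) (B : LinearMap.BilinForm ℝ V) (x : M)
    (A C : TangentSpace (𝓡 2) x →ₗ[ℝ] V) : ℝ :=
  ∑ i, ∑ j, gInv g x i j * B (A (tanVec x i)) (C (tanVec x j))

/-- `Q(W)² = (W; W^♯) = ∑ g^{ij} W_i ⊗ B(W_j, ·) ∈ End V`. -/
def Qsq (g : Metric M) (B : LinearMap.BilinForm ℝ V) (x : M)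
    (W : TangentSpace (𝓡 2) x →ₗ[ℝ] V) : V →ₗ[ℝ] V :=
  ∑ i, ∑ j, gInv g x i j • (B (W (tanVec x j))).smulRight (W (tanVec x i))

/-- The real power `T^a` of a diagonalizable endomorphism `T` with non-negative eigenvalues:
it acts as `t^a` on the `t`-eigenspace (with `0^a = 0` for `a ≠ 0` and `0^0 = 1`), and is written
as the polynomial in `T` that interpolates `t ↦ t^a` on the eigenvalues. -/
def powEnd [Module.Finite ℝ V] (a : ℝ) (T : V →ₗ[ℝ] V) : V →ₗ[ℝ] V :=
  Polynomial.aeval T (Lagrange.interpolate T.charpoly.roots.toFinset id fun t => t ^ a)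

/-- `Q(W)^a = (Q(W)²)^{a/2}`. -/
def Qpow [Module.Finite ℝ V] (g : Metric M) (B : LinearMap.BilinForm ℝ V) (a : ℝ) (x : M)
    (W : TangentSpace (𝓡 2) x →ₗ[ℝ] V) : V →ₗ[ℝ] V :=
  powEnd (a / 2) (Qsq g B x W)

/-- The `p`-th power `|W|_{sv^p}^p = Tr Q(W)^p` of the Schatten-von Neumann norm. -/
def svPow [Module.Finite ℝ V] (g : Metric M) (B : LinearMap.BilinForm ℝ V) (p : ℝ) (x : M)
    (W : TangentSpace (𝓡 2) x →ₗ[ℝ] V) : ℝ :=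
  LinearMap.trace ℝ V (Qpow g B p x W)

/-- The 1-form `S_{p-1}(W) = Q(W)^{p-2} W`. -/
def Sform [Module.Finite ℝ V] (g : Metric M) (B : LinearMap.BilinForm ℝ V) (p : ℝ)
    (W : OneForm M V) : OneForm M V :=
  fun x => Qpow g B (p - 2) x (W x) ∘ₗ W x

/-- `f ∈ W^{1,p}_loc(M)` with weak differential `df`: in every chart, `f` and the components of `df`
are in `L^p_loc`, and integration by parts against test functions holds. -/
def IsW1locScalar (p : ℝ) (f : M → ℝ) (df : OneForm M ℝ) : Prop :=
  ∀ c : M,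
    (∀ K : Set Plane, IsCompact K → K ⊆ (chartAt Plane c).target →
      MemLp (fun y => f ((chartAt Plane c).symm y)) (ENNReal.ofReal p) (volume.restrict K) ∧
      ∀ i, MemLp (fun y => df ((chartAt Plane c).symm y) (coordVec c y i)) (ENNReal.ofReal p)
        (volume.restrict K)) ∧
    ∀ φ : Plane → ℝ, ContDiff ℝ ∞ φ → HasCompactSupport φ →
      tsupport φ ⊆ (chartAt Plane c).target → ∀ i,
      ∫ y in (chartAt Plane c).target, f ((chartAt Plane c).symm y) * fderiv ℝ φ y (stdVec i) =
        -∫ y in (chartAt Plane c).target,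
          df ((chartAt Plane c).symm y) (coordVec c y i) * φ y

/-- `ξ ∈ W^{1,p}_loc(M, V)` with weak differential `dξ`, for a finite dimensional `V`. -/
def IsW1loc (p : ℝ) (ξ : M → V) (dξ : OneForm M V) : Prop :=
  ∀ l : V →ₗ[ℝ] ℝ, IsW1locScalar p (fun x => l (ξ x)) (fun x => l ∘ₗ dξ x)

/-! ### Flat bundles

`M` is a covering of the surface `M/Γ`, with deck group `Γ`; a representation of `Γ` on `V` gives a
flat bundle over `M/Γ`, whose sections are the equivariant maps `M → V`. -/

/-- `Γ` acts freely by orientation preserving smooth isometries. -/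
structure IsDeckAction (Γ : Type*) [Group Γ] [MulAction Γ M] (g : Metric M)
    (o : SurfaceOrientation g) : Prop where
  free : ∀ (γ : Γ) (x : M), γ • x = x → γ = 1
  contMDiff : ∀ γ : Γ, ContMDiff (𝓡 2) (𝓡 2) ∞ (fun x : M => γ • x)
  isometry : ∀ (γ : Γ) (x : M) (v w : TangentSpace (𝓡 2) x),
    g.inner (γ • x) (mfderiv (𝓡 2) (𝓡 2) (fun x : M => γ • x) x v)
      (mfderiv (𝓡 2) (𝓡 2) (fun x : M => γ • x) x w) = g.inner x v w
  oriented : ∀ (γ : Γ) (x : M) (v : TangentSpace (𝓡 2) x),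
    mfderiv (𝓡 2) (𝓡 2) (fun x : M => γ • x) x (o.rot x v) =
      o.rot (γ • x) (mfderiv (𝓡 2) (𝓡 2) (fun x : M => γ • x) x v)

/-- `ξ` is a section of class `W^{1,p}_loc` of the flat bundle over `M/Γ` defined by the action
`act` of `Γ` on `V`, and `dξ` is its weak differential for the flat connection. -/
structure IsSection {Γ : Type*} [Group Γ] [MulAction Γ M] (act : Γ → V →ₗ[ℝ] V) (p : ℝ)
    (ξ : M → V) (dξ : OneForm M V) : Prop where
  equivariant : ∀ (γ : Γ) (x : M), ξ (γ • x) = act γ (ξ x)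
  isW1loc : IsW1loc p ξ dξ

/-- The equivariant map `ξ` has compact support in `M/Γ`. -/
def CompactSupportMod (Γ : Type*) [Group Γ] [MulAction Γ M] (ξ : M → V) : Prop :=
  ∃ K : Set M, IsCompact K ∧ ∀ x, (∀ γ : Γ, γ • x ∉ K) → ξ x = 0

/-- `ξ` is a compactly supported `W^{1,p}` section of the subbundle onto which the fibrewise
projections `P` project: `ξ = ξ_u`. -/
structure IsTangentTest [MeasurableSpace M] {Γ : Type*} [Group Γ] [MulAction Γ M]
    (act : Γ → V →ₗ[ℝ] V) (g : Metric M) (P : M → V →ₗ[ℝ] V) (p : ℝ)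
    (ξ : M → V) (dξ : OneForm M V) : Prop where
  isSection : IsSection act p ξ dξ
  tangent : ∀ᵐ x ∂(riemVol g), P x (ξ x) = ξ x
  support : CompactSupportMod Γ ξ

/-- `ξ = ξ_u` is a section of class `W^{1,q}_0` of the subbundle onto which `P` projects: it is
the limit of compactly supported ones in the `W^{1,q}` norm
`∫_{M/Γ} |ξ|^q + ∫_{M/Γ} |(dξ)_u|_{sv^q}^q`. The set `D` is a fundamental domain for `Γ`. If `M/Γ`
is closed, all `W^{1,q}` sections with `ξ = ξ_u` are of this kind. -/
structure IsTangentW0 [MeasurableSpace M] [Module.Finite ℝ V] {Γ : Type*} [Group Γ]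
    [MulAction Γ M] (act : Γ → V →ₗ[ℝ] V) (g : Metric M) (B : LinearMap.BilinForm ℝ V)
    (D : Set M) (P : M → V →ₗ[ℝ] V) (q : ℝ) (ξ : M → V) (dξ : OneForm M V) : Prop where
  isSection : IsSection act q ξ dξ
  tangent : ∀ᵐ x ∂(riemVol g), P x (ξ x) = ξ x
  approx : ∃ (η : ℕ → M → V) (dη : ℕ → OneForm M V),
    (∀ k, IsTangentTest act g P q (η k) (dη k)) ∧
    Tendsto (fun k => ∫⁻ x in D,
      (ENNReal.ofReal (B (ξ x - η k x) (ξ x - η k x) ^ (q / 2)) +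
        ENNReal.ofReal (svPow g B q x (P x ∘ₗ (dξ x - dη k x)))) ∂(riemVol g))
      atTop (𝓝 0)

/-- The functional `J_q = ∫_{M/Γ} |Z + (dξ)_u|_{sv^q}^q`, as a function of `dξ`. -/
def dualEnergy [MeasurableSpace M] [Module.Finite ℝ V] (g : Metric M)
    (B : LinearMap.BilinForm ℝ V) (D : Set M) (P : M → V →ₗ[ℝ] V) (q : ℝ)
    (Z dξ : OneForm M V) : ℝ≥0∞ :=
  ∫⁻ x in D, ENNReal.ofReal (svPow g B q x (Z x + P x ∘ₗ dξ x)) ∂(riemVol g)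

/-- `<A, C> = ∫_{M/Γ} (A; C)^♯` exists and is zero. -/
def PairsToZero [MeasurableSpace M] (g : Metric M) (B : LinearMap.BilinForm ℝ V) (D : Set M)
    (A C : OneForm M V) : Prop :=
  IntegrableOn (fun x => pairing g B x (A x) (C x)) D (riemVol g) ∧
    ∫ x in D, pairing g B x (A x) (C x) ∂(riemVol g) = 0

end Values

/-- `u` is a continuous `ρ`-equivariant map `M → ℍ` of class `W^{1,p}` with differential `du`
(so a `W^{1,p}` map from `M/Γ` into `ℍ/ρ(Γ)` when this is a manifold), of finite energy
`J_p(u) = ∫_{M/Γ} |du|_{sv^p}^p`, that satisfies the `J_p`-Euler-Lagrange equations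
`∫_{M/Γ} (Q(du)^{p-2}du; D_u φ)^♯ = 0`, with `D_u φ = (dφ)_u`, for all compactly supported
tangent fields `φ` along `u` of class `W^{1,p} ∩ C^0`. -/
structure IsJpHarmonic [MeasurableSpace M] {Γ : Type*} [Group Γ] [MulAction Γ M] {n : ℕ}
    (g : Metric M) (D : Set M) (ρ : Γ →* SOPlus n) (p : ℝ) (u : M → Mink n)
    (du : OneForm M (Mink n)) : Prop where
  continuous : Continuous u
  mem_hyperboloid : ∀ x, u x ∈ hyperboloid n
  isSection : IsSection (fun γ => vecAct (ρ γ)) p u du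
  finite_energy : ∫⁻ x in D, ENNReal.ofReal (svPow g (mform n) p x (du x)) ∂(riemVol g) < ⊤
  eulerLagrange : ∀ (φ : M → Mink n) (dφ : OneForm M (Mink n)), Continuous φ →
    IsTangentTest (fun γ => vecAct (ρ γ)) g (fun x => projVec (u x)) p φ dφ →
    ∫ x in D, pairing g (mform n) x (Sform g (mform n) p du x) (projVec (u x) ∘ₗ dφ x)
      ∂(riemVol g) = 0

end Surface

end DualHarmonic

end

/-!
The conjugate exponents turn the dual form back into the differential of `u`. Since
`Z = *S_{p-1}(du)`, the singular values of `Z` are those of `du` to the power `p - 1`, and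
`(p - 1)(q - 1) = 1` gives `S_{q-1}(Z) = *du` (`Spow_starAt_Spow`). The map `ξ ↦ ξ × u` multiplies the form on `T_u ℍ` by `2`, so that
`S_{q-1}(V) = 2^{(q-2)/2} (*du) × u` (`Spow_comp`).

*The Euler–Lagrange equations.* In both bundles they come from `d(du) = 0`. For a compactly
supported section `η` of class `W^{1,q}`, the integral of `(*du; dη)^♯` is, up to sign, that of
`du ∧ dη`, an exact form. As `u` is only of class `W^{1,p} ∩ C⁰` and `η` of class `W^{1,q}`, Stokes' theorem is
proved in charts by mollification (`integral_wedge_eq_zero`). It is transferred to the quotient by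
a smooth `χ` with `∑ χ ∘ γ = 1` near the support of `η` (`exists_partition`): replacing `u` by
`χ u` unfolds the integral over a fundamental domain to one over the whole surface
(`integral_fold`). This is `pairsToZero_starAt`.

For a tangent section `ψ` of the Lie algebra bundle, `ξ ↦ ξ × u` is adjoint to `ψ ↦ 2 ψ u`, so the
pairing of `(*du) × u` with `dψ` is twice that of `*du` with `(dψ) u = d(ψ u) - ψ du`. The section
`ψ u` is again of class `W^{1,q}`, because `ψ` lies in `L^{2q/(2-q)}` locally and `p > 2`
(`HasWeakDiffV.bilin`), so the first term integrates to zero. The second vanishes pointwise: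
`ψ` lies in `𝔭_u` and maps `T_u ℍ` to the line of `u`, which is orthogonal to the values of `*du`
(`pairsToZero_beta`).

*Minimality.* The Schatten energy is convex with derivative `q S_{q-1}`, so that
`|Z + X|^q ≥ |Z|^q + q (S_{q-1}(Z); X)` pointwise (`svPow_add_le`), which follows from the Young
inequality for Schatten norms (`pairing_le_svPow`). For compactly supported `η` the last term
integrates to zero. For a limit `ξ` of such `η`, the error `(dξ - dη)_u` is small in energy, and
its pairing with `S_{q-1}(Z)` is controlled by the Young inequality with a parameter
(`dualEnergy_zero_le`).
-/

noncomputable section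

namespace DualHarmonic

/-! ### Mollification in the plane -/

/-- Bump functions at the origin whose supports shrink to a point. -/
def shrinkingBump (k : ℕ) : ContDiffBump (0 : Plane) where
  rIn := 1 / (2 * ((k : ℝ) + 1))
  rOut := 1 / ((k : ℝ) + 1)
  rIn_pos := by positivity
  rIn_lt_rOut := by
    apply one_div_lt_one_div_of_lt <;> linarith [k.cast_nonneg (α := ℝ)]

theorem shrinkingBump_rOut (k : ℕ) : (shrinkingBump k).rOut = 1 / ((k : ℝ) + 1) := rfl

theorem tendsto_shrinkingBump_rOut :
    Tendsto (fun k => (shrinkingBump k).rOut) atTop (𝓝 0) :=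
  tendsto_one_div_add_atTop_nhds_zero_nat

theorem shrinkingBump_rOut_le (k : ℕ) : (shrinkingBump k).rOut ≤ 1 := by
  rw [shrinkingBump_rOut, div_le_one (by positivity)]
  linarith [k.cast_nonneg (α := ℝ)]

/-- The mollification of `f` at scale `1 / (k + 1)`. -/
def moll (k : ℕ) (f : Plane → ℝ) : Plane → ℝ :=
  MeasureTheory.convolution ((shrinkingBump k).normed volume) f
    (ContinuousLinearMap.lsmul ℝ ℝ) volume

theorem moll_apply (k : ℕ) (f : Plane → ℝ) (x : Plane) :
    moll k f x = ∫ t, (shrinkingBump k).normed volume t * f (x - t) := rfl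

theorem moll_apply' (k : ℕ) (f : Plane → ℝ) (x : Plane) :
    moll k f x = ∫ t, (shrinkingBump k).normed volume (x - t) * f t := by
  rw [moll, MeasureTheory.convolution_eq_swap]
  rfl

theorem contDiff_moll (k : ℕ) {f : Plane → ℝ} (hf : LocallyIntegrable f) :
    ContDiff ℝ ∞ (moll k f) := by
  have := (shrinkingBump k).hasCompactSupport_normed (μ := (volume : Measure Plane))
  exact this.contDiff_convolution_left (n := ⊤) _ (shrinkingBump k).contDiff_normed hf

theorem support_moll_subset (k : ℕ) (f : Plane → ℝ) :
    Function.support (moll k f) ⊆ Metric.cthickening 1 (tsupport f) := by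
  intro x hx
  have h := MeasureTheory.support_convolution_subset (L := ContinuousLinearMap.lsmul ℝ ℝ)
    (f := (shrinkingBump k).normed volume) (g := f) (μ := volume) hx
  obtain ⟨a, ha, b, hb, rfl⟩ := h
  rw [ContDiffBump.support_normed_eq, mem_ball_zero_iff] at ha
  refine Metric.mem_cthickening_of_dist_le _ b _ _ (subset_tsupport f hb) ?_
  rw [dist_eq_norm, add_sub_cancel_right]
  exact ha.le.trans (shrinkingBump_rOut_le k)

theorem integrable_normed_mul_comp_sub (k : ℕ) {f : Plane → ℝ} (hf : LocallyIntegrable f)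
    (x : Plane) : Integrable fun t => (shrinkingBump k).normed volume t * f (x - t) :=
  (((shrinkingBump k).hasCompactSupport_normed (μ := (volume : Measure Plane))).convolutionExists_left
    (ContinuousLinearMap.lsmul ℝ ℝ) (shrinkingBump k).continuous_normed hf) x

theorem moll_sub (k : ℕ) {f g : Plane → ℝ} (hf : LocallyIntegrable f) (hg : LocallyIntegrable g) :
    moll k (f - g) = moll k f - moll k g := by
  funext x
  simp only [Pi.sub_apply, moll_apply]
  rw [← integral_sub (integrable_normed_mul_comp_sub k hf x)
    (integrable_normed_mul_comp_sub k hg x)]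
  congr 1
  funext t
  ring

/-- Young's inequality for the convolution with a probability density. -/
theorem eLpNorm_moll_le (k : ℕ) {f : Plane → ℝ} {p : ℝ≥0∞} (hp : 1 ≤ p) (hp' : p ≠ ⊤)
    (hf : AEStronglyMeasurable f) : eLpNorm (moll k f) p volume ≤ eLpNorm f p volume := by
  have hp0 : p ≠ 0 := (zero_lt_one.trans_le hp).ne'
  have hpr : 0 < p.toReal := ENNReal.toReal_pos hp0 hp'
  set ρ : Plane → ℝ≥0∞ := fun t => ENNReal.ofReal ((shrinkingBump k).normed volume t) with hρ
  have hρm : Measurable ρ := (shrinkingBump k).continuous_normed.measurable.ennreal_ofReal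
  have hρ1 : ∫⁻ t, ρ t = 1 := by
    rw [← ofReal_integral_eq_lintegral_ofReal ((shrinkingBump k).integrable_normed)
      (ae_of_all _ (shrinkingBump k).nonneg_normed), (shrinkingBump k).integral_normed]
    simp
  have : IsProbabilityMeasure (volume.withDensity ρ) := ⟨by simp [withDensity_apply, hρ1]⟩
  have hfe : AEMeasurable (fun x => ‖f x‖ₑ) := hf.enorm
  have hqmp : ∀ x : Plane, AEStronglyMeasurable (fun t => f (x - t)) volume := fun x =>
    hf.comp_quasiMeasurePreserving (quasiMeasurePreserving_sub_left_of_right_invariant volume x)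
  have h1 : ∀ x, ‖moll k f x‖ₑ ^ p.toReal ≤ ∫⁻ t, ρ t * ‖f (x - t)‖ₑ ^ p.toReal := by
    intro x
    have hm : AEStronglyMeasurable (fun t => f (x - t)) (volume.withDensity ρ) :=
      (hqmp x).mono_ac (withDensity_absolutelyContinuous _ _)
    have a1 : ‖moll k f x‖ₑ ≤ eLpNorm (fun t => f (x - t)) 1 (volume.withDensity ρ) := by
      rw [moll_apply, eLpNorm_one_eq_lintegral_enorm,
        lintegral_withDensity_eq_lintegral_mul₀ hρm.aemeasurable (hqmp x).enorm]
      refine (enorm_integral_le_lintegral_enorm _).trans (lintegral_mono fun t => ?_)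
      simp only [Pi.mul_apply, hρ]
      rw [enorm_mul, Real.enorm_of_nonneg ((shrinkingBump k).nonneg_normed t)]
    have a2 := a1.trans (eLpNorm_le_eLpNorm_of_exponent_le hp hm)
    rw [eLpNorm_eq_lintegral_rpow_enorm_toReal hp0 hp',
      lintegral_withDensity_eq_lintegral_mul₀ hρm.aemeasurable ((hqmp x).enorm.pow_const _)] at a2
    calc ‖moll k f x‖ₑ ^ p.toReal ≤ _ := ENNReal.rpow_le_rpow a2 hpr.le
      _ = _ := by
        rw [← ENNReal.rpow_mul, one_div, inv_mul_cancel₀ hpr.ne', ENNReal.rpow_one]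
        rfl
  rw [eLpNorm_eq_lintegral_rpow_enorm_toReal hp0 hp', eLpNorm_eq_lintegral_rpow_enorm_toReal hp0 hp']
  refine ENNReal.rpow_le_rpow ?_ (by positivity)
  calc ∫⁻ x, ‖moll k f x‖ₑ ^ p.toReal ≤ ∫⁻ x, ∫⁻ t, ρ t * ‖f (x - t)‖ₑ ^ p.toReal :=
        lintegral_mono h1
    _ = ∫⁻ t, ∫⁻ x, ρ t * ‖f (x - t)‖ₑ ^ p.toReal := by
        apply lintegral_lintegral_swap
        apply AEMeasurable.mul (hρm.comp measurable_snd).aemeasurable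
        apply AEMeasurable.pow_const
        exact hfe.comp_quasiMeasurePreserving (quasiMeasurePreserving_sub_of_right_invariant _ _)
    _ = ∫⁻ t, ρ t * ∫⁻ x, ‖f x‖ₑ ^ p.toReal := by
        refine lintegral_congr fun t => ?_
        rw [lintegral_const_mul'', lintegral_sub_right_eq_self (fun x => ‖f x‖ₑ ^ p.toReal) t]
        exact (hfe.pow_const _).comp_quasiMeasurePreserving
          (measurePreserving_sub_right volume t).quasiMeasurePreserving
    _ = ∫⁻ x, ‖f x‖ₑ ^ p.toReal := by rw [lintegral_mul_const _ hρm, hρ1, one_mul]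

theorem tendstoUniformly_moll {f : Plane → ℝ} (hf : UniformContinuous f) :
    TendstoUniformly (fun k => moll k f) f atTop := by
  rw [Metric.tendstoUniformly_iff]
  intro ε hε
  obtain ⟨δ, hδ, h⟩ := Metric.uniformContinuous_iff.1 hf (ε / 2) (by positivity)
  filter_upwards [tendsto_shrinkingBump_rOut.eventually_lt_const hδ] with k hk x
  rw [dist_comm]
  refine lt_of_le_of_lt (ContDiffBump.dist_normed_convolution_le
    hf.continuous.aestronglyMeasurable (ε := ε / 2) fun y hy => ?_) (by linarith)
  exact (h ((Metric.mem_ball.1 hy).trans hk)).le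

theorem tendsto_eLpNorm_moll_sub {f : Plane → ℝ} {p : ℝ≥0∞} (hp : 1 ≤ p) (hp' : p ≠ ⊤)
    (hf : MemLp f p) : Tendsto (fun k => eLpNorm (moll k f - f) p volume) atTop (𝓝 0) := by
  rw [ENNReal.tendsto_nhds_zero]
  intro ε hε
  have hε3 : ε / 3 ≠ 0 := (ENNReal.div_pos hε.ne' (by norm_num)).ne'
  obtain ⟨g, hgs, hfg, hgc, hgm⟩ := hf.exists_hasCompactSupport_eLpNorm_sub_le hp' hε3
  have hfl : LocallyIntegrable f := hf.locallyIntegrable hp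
  have hgl : LocallyIntegrable g := hgm.locallyIntegrable hp
  have hgu : UniformContinuous g := hgs.uniformContinuous_of_continuous hgc
  -- the approximation of `g` is uniform, and takes place in a fixed compact set
  set K := Metric.cthickening 1 (tsupport g)
  have hK : IsCompact K := hgs.isCompact.cthickening
  have hgK : Tendsto (fun k => eLpNorm (moll k g - g) p volume) atTop (𝓝 0) := by
    have hvol : volume K ^ (1 / p.toReal) ≠ ⊤ :=
      ENNReal.rpow_ne_top_of_nonneg (by positivity) hK.measure_lt_top.ne
    rw [ENNReal.tendsto_nhds_zero]
    intro δ hδ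
    obtain ⟨c, hc, hcδ⟩ : ∃ c : ℝ, 0 < c ∧ volume K ^ (1 / p.toReal) * ENNReal.ofReal c ≤ δ := by
      have : Tendsto (fun c : ℝ => volume K ^ (1 / p.toReal) * ENNReal.ofReal c) (𝓝[>] 0)
          (𝓝 (volume K ^ (1 / p.toReal) * ENNReal.ofReal 0)) :=
        ENNReal.Tendsto.const_mul
          ((ENNReal.continuous_ofReal.tendsto 0).mono_left nhdsWithin_le_nhds) (Or.inr hvol)
      rw [ENNReal.ofReal_zero, mul_zero] at this
      have h2 := (ENNReal.tendsto_nhds_zero.1 this δ hδ).and self_mem_nhdsWithin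
      obtain ⟨c, hc⟩ := h2.exists
      exact ⟨c, hc.2, hc.1⟩
    filter_upwards [Metric.tendstoUniformly_iff.1 (tendstoUniformly_moll hgu) c hc] with k hk
    refine le_trans ?_ hcδ
    have hsupp : Function.support (moll k g - g) ⊆ K := by
      refine (Function.support_sub _ _).trans (union_subset (support_moll_subset k g) ?_)
      exact (subset_tsupport g).trans (Metric.self_subset_cthickening _)
    rw [← eLpNorm_restrict_eq_of_support_subset hsupp]
    have := eLpNorm_le_of_ae_bound (μ := volume.restrict K) (p := p) (f := moll k g - g) (C := c)
      (ae_of_all _ fun x => by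
        rw [Pi.sub_apply, ← dist_eq_norm, dist_comm]
        exact (hk x).le)
    simpa [one_div] using this
  filter_upwards [ENNReal.tendsto_nhds_zero.1 hgK (ε / 3) (pos_iff_ne_zero.2 hε3)] with k hk
  have hdec : moll k f - f = moll k (f - g) + ((moll k g - g) + (g - f)) := by
    rw [moll_sub k hfl hgl]
    abel
  have hm1 : AEStronglyMeasurable (moll k (f - g)) volume :=
    (contDiff_moll k (hfl.sub hgl)).continuous.aestronglyMeasurable
  have hm2 : AEStronglyMeasurable (moll k g - g) volume :=
    (contDiff_moll k hgl).continuous.aestronglyMeasurable.sub hgc.aestronglyMeasurable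
  have hm3 : AEStronglyMeasurable (g - f) volume := hgc.aestronglyMeasurable.sub hf.1
  rw [hdec]
  refine (eLpNorm_add_le hm1 (hm2.add hm3) hp).trans ?_
  refine (add_le_add le_rfl (eLpNorm_add_le hm2 hm3 hp)).trans ?_
  have e1 : eLpNorm (moll k (f - g)) p volume ≤ ε / 3 :=
    (eLpNorm_moll_le k hp hp' (hf.1.sub hgc.aestronglyMeasurable)).trans hfg
  have e3 : eLpNorm (g - f) p volume ≤ ε / 3 := by
    rwa [eLpNorm_sub_comm]
  calc _ ≤ ε / 3 + (ε / 3 + ε / 3) := add_le_add e1 (add_le_add hk e3)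
    _ = ε := by rw [← add_assoc, ENNReal.add_thirds]

theorem ae_tendsto_moll {f : Plane → ℝ} (hf : LocallyIntegrable f) :
    ∀ᵐ x, Tendsto (fun k => moll k f x) atTop (𝓝 (f x)) := by
  refine ContDiffBump.ae_convolution_tendsto_right_of_locallyIntegrable (K := 2)
    tendsto_shrinkingBump_rOut (Eventually.of_forall fun k => ?_) hf
  change 1 / ((k : ℝ) + 1) ≤ 2 * (1 / (2 * ((k : ℝ) + 1)))
  apply le_of_eq
  field_simp

/-- Differentiating a mollification: if `G` is the weak derivative of `f` in the direction `v`, then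
the derivative of the mollification of `f` is the mollification of `G`. -/
theorem fderiv_moll (k : ℕ) {f G : Plane → ℝ} (hf : LocallyIntegrable f) (v : Plane)
    (hG : ∀ φ : Plane → ℝ, ContDiff ℝ ∞ φ → HasCompactSupport φ →
      ∫ y, f y * fderiv ℝ φ y v = -∫ y, G y * φ y) (x : Plane) :
    fderiv ℝ (moll k f) x v = moll k G x := by
  set ρ := (shrinkingBump k).normed (volume : Measure Plane) with hρ
  have hρs : HasCompactSupport ρ := (shrinkingBump k).hasCompactSupport_normed
  have hρd : ContDiff ℝ ∞ ρ := (shrinkingBump k).contDiff_normed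
  have h1 := hρs.hasFDerivAt_convolution_left (ContinuousLinearMap.lsmul ℝ ℝ) (μ := volume)
    (hρd.of_le (by exact_mod_cast le_top)) hf x
  have hconv : MeasureTheory.ConvolutionExistsAt (fderiv ℝ ρ) f x
      ((ContinuousLinearMap.lsmul ℝ ℝ).precompL Plane) volume :=
    (hρs.fderiv ℝ).convolutionExists_left _ (hρd.continuous_fderiv (by simp)) hf x
  have h2 : fderiv ℝ (moll k f) x v = ∫ t, fderiv ℝ ρ t v * f (x - t) := by
    rw [moll, h1.fderiv, MeasureTheory.convolution,
      ContinuousLinearMap.integral_apply hconv]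
    rfl
  rw [h2, moll_apply']
  have h3 : ∫ t, fderiv ℝ ρ t v * f (x - t) = ∫ t, fderiv ℝ ρ (x - t) v * f t := by
    rw [← integral_sub_left_eq_self (fun t => fderiv ℝ ρ t v * f (x - t)) volume x]
    simp
  rw [h3]
  set φ : Plane → ℝ := fun y => ρ (x - y) with hφ
  have hφd : ContDiff ℝ ∞ φ := hρd.comp (contDiff_const.sub contDiff_id)
  have hφs : HasCompactSupport φ := hρs.comp_homeomorph (Homeomorph.subLeft x)
  have hd : ∀ y, fderiv ℝ φ y v = -fderiv ℝ ρ (x - y) v := by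
    intro y
    have : HasFDerivAt φ ((fderiv ℝ ρ (x - y)).comp (-ContinuousLinearMap.id ℝ Plane)) y :=
      ((hρd.differentiable (by simp)) (x - y)).hasFDerivAt.comp y
        ((hasFDerivAt_id y).const_sub x)
    rw [this.fderiv]
    simp
  have h4 := hG φ hφd hφs
  simp only [hd] at h4
  have h5 : ∫ y, f y * -fderiv ℝ ρ (x - y) v = -∫ t, fderiv ℝ ρ (x - t) v * f t := by
    rw [← integral_neg]
    congr 1
    funext y
    ring
  rw [h5, neg_inj] at h4
  rw [h4]
  congr 1
  funext y
  ring

/-! ### Weak gradients in the plane -/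

/-- `F` is the weak gradient of `f` on the open set `Ω`, both being in `L^p_loc(Ω)`. -/
structure WeakGrad (p : ℝ≥0∞) (Ω : Set Plane) (f : Plane → ℝ) (F : Fin 2 → Plane → ℝ) : Prop where
  memLp : ∀ K : Set Plane, IsCompact K → K ⊆ Ω → MemLp f p (volume.restrict K)
  memLp_grad : ∀ K : Set Plane, IsCompact K → K ⊆ Ω → ∀ i, MemLp (F i) p (volume.restrict K)
  parts : ∀ φ : Plane → ℝ, ContDiff ℝ ∞ φ → HasCompactSupport φ → tsupport φ ⊆ Ω → ∀ i,
    ∫ y in Ω, f y * fderiv ℝ φ y (stdVec i) = -∫ y in Ω, F i y * φ y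

theorem tsupport_fderiv_apply_subset (φ : Plane → ℝ) (v : Plane) :
    tsupport (fun y => fderiv ℝ φ y v) ⊆ tsupport φ :=
  (closure_mono fun x hx => by
    rw [Function.mem_support] at hx ⊢
    contrapose! hx
    simp [hx]).trans (tsupport_fderiv_subset ℝ)

theorem continuous_fderiv_apply_const {φ : Plane → ℝ} (hφ : ContDiff ℝ ∞ φ) (v : Plane) :
    Continuous fun y => fderiv ℝ φ y v :=
  (hφ.continuous_fderiv (by simp)).clm_apply continuous_const

theorem hasCompactSupport_fderiv_apply_const {φ : Plane → ℝ} (hφ : HasCompactSupport φ)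
    (v : Plane) :
    HasCompactSupport fun y => fderiv ℝ φ y v :=
  hφ.of_isClosed_subset (isClosed_tsupport _) (tsupport_fderiv_apply_subset φ v)

theorem contDiff_fderiv_apply_const {φ : Plane → ℝ} (hφ : ContDiff ℝ ∞ φ) (v : Plane) :
    ContDiff ℝ ∞ fun y => fderiv ℝ φ y v :=
  (hφ.fderiv_right (m := ∞) (by simp)).clm_apply contDiff_const

theorem integral_fderiv_eq_zero {φ : Plane → ℝ} (hφ : ContDiff ℝ ∞ φ) (hφs : HasCompactSupport φ)
    (v : Plane) : ∫ y, fderiv ℝ φ y v = 0 := by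
  have h1 := (continuous_fderiv_apply_const hφ v).integrable_of_hasCompactSupport (μ := volume)
    (hasCompactSupport_fderiv_apply_const hφs v)
  have h2 := hφ.continuous.integrable_of_hasCompactSupport (μ := volume) hφs
  have := integral_mul_fderiv_eq_neg_fderiv_mul_of_integrable (μ := (volume : Measure Plane))
    (f := fun _ => (1 : ℝ)) (g := φ) (v := v) (by simp) (by simpa using h1) (by simpa using h2)
    (fun x _ => by fun_prop) (fun x _ => hφ.differentiable (by simp) x)
  simpa using this

/-- A function that is integrable on compact subsets of `Ω` can be integrated against a continuous
function with compact support in `Ω`. -/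
theorem integrable_mul_of_tsupport_subset {Ω : Set Plane} {f φ : Plane → ℝ}
    (hf : ∀ K : Set Plane, IsCompact K → K ⊆ Ω → IntegrableOn f K)
    (hφ : Continuous φ) (hφs : HasCompactSupport φ) (hφΩ : tsupport φ ⊆ Ω) :
    Integrable fun y => f y * φ y := by
  have h1 : IntegrableOn (fun y => f y * φ y) (tsupport φ) :=
    (hf _ hφs hφΩ).mul_continuousOn_of_subset hφ.continuousOn
      (isClosed_tsupport φ).measurableSet hφs subset_rfl
  rwa [integrableOn_iff_integrable_of_support_subset] at h1
  intro x hx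
  exact subset_tsupport φ fun h => hx (by simp [h])

theorem setIntegral_mul_of_tsupport_subset {Ω : Set Plane} (f : Plane → ℝ) {φ : Plane → ℝ}
    (hφΩ : tsupport φ ⊆ Ω) : ∫ y in Ω, f y * φ y = ∫ y, f y * φ y := by
  apply setIntegral_eq_integral_of_forall_compl_eq_zero
  intro x hx
  rw [image_eq_zero_of_notMem_tsupport fun h => hx (hφΩ h), mul_zero]

/-- The fundamental lemma of the calculus of variations on compact subsets. -/
theorem ae_eq_zero_of_integral_test {Ω : Set Plane} (hΩ : IsOpen Ω) {h : Plane → ℝ}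
    (hh : ∀ K : Set Plane, IsCompact K → K ⊆ Ω → IntegrableOn h K)
    (H : ∀ φ : Plane → ℝ, ContDiff ℝ ∞ φ → HasCompactSupport φ → tsupport φ ⊆ Ω →
      ∫ y, h y * φ y = 0) : ∀ᵐ y ∂(volume.restrict Ω), h y = 0 := by
  rw [ae_restrict_iff' hΩ.measurableSet]
  refine hΩ.ae_eq_zero_of_integral_contDiff_smul_eq_zero
    ((locallyIntegrableOn_iff hΩ.isLocallyClosed).2 fun K hK hKc => hh K hKc hK) ?_
  intro φ h1 h2 h3
  rw [← H φ h1 h2 h3]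
  congr 1
  funext y
  rw [smul_eq_mul, mul_comm]

namespace WeakGrad

variable {p q : ℝ≥0∞} {Ω U : Set Plane} {f h : Plane → ℝ} {F H : Fin 2 → Plane → ℝ}

theorem integrableOn (hf : WeakGrad p Ω f F) (hp : 1 ≤ p) (K : Set Plane) (hK : IsCompact K)
    (hKΩ : K ⊆ Ω) : IntegrableOn f K :=
  have : IsFiniteMeasure (volume.restrict K) := ⟨by simpa using hK.measure_lt_top⟩
  (hf.memLp K hK hKΩ).integrable hp

theorem integrableOn_grad (hf : WeakGrad p Ω f F) (hp : 1 ≤ p) (i : Fin 2) (K : Set Plane)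
    (hK : IsCompact K) (hKΩ : K ⊆ Ω) : IntegrableOn (F i) K :=
  have : IsFiniteMeasure (volume.restrict K) := ⟨by simpa using hK.measure_lt_top⟩
  (hf.memLp_grad K hK hKΩ i).integrable hp

theorem parts' (hf : WeakGrad p Ω f F) {φ : Plane → ℝ} (hφ : ContDiff ℝ ∞ φ)
    (hφs : HasCompactSupport φ) (hφΩ : tsupport φ ⊆ Ω) (i : Fin 2) :
    ∫ y, f y * fderiv ℝ φ y (stdVec i) = -∫ y, F i y * φ y := by
  have := hf.parts φ hφ hφs hφΩ i
  rwa [setIntegral_mul_of_tsupport_subset _ hφΩ, setIntegral_mul_of_tsupport_subset _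
    ((tsupport_fderiv_apply_subset φ _).trans hφΩ)] at this

theorem of_parts (h1 : ∀ K : Set Plane, IsCompact K → K ⊆ Ω → MemLp f p (volume.restrict K))
    (h2 : ∀ K : Set Plane, IsCompact K → K ⊆ Ω → ∀ i, MemLp (F i) p (volume.restrict K))
    (h3 : ∀ φ : Plane → ℝ, ContDiff ℝ ∞ φ → HasCompactSupport φ → tsupport φ ⊆ Ω → ∀ i,
      ∫ y, f y * fderiv ℝ φ y (stdVec i) = -∫ y, F i y * φ y) : WeakGrad p Ω f F where
  memLp := h1
  memLp_grad := h2
  parts φ hφ hφs hφΩ i := by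
    rw [setIntegral_mul_of_tsupport_subset _ hφΩ, setIntegral_mul_of_tsupport_subset _
      ((tsupport_fderiv_apply_subset φ _).trans hφΩ)]
    exact h3 φ hφ hφs hφΩ i

theorem restrict (hf : WeakGrad p Ω f F) (hU : U ⊆ Ω) : WeakGrad p U f F :=
  of_parts (fun K hK hKU => hf.memLp K hK (hKU.trans hU))
    (fun K hK hKU => hf.memLp_grad K hK (hKU.trans hU))
    (fun _ hφ hφs hφU i => hf.parts' hφ hφs (hφU.trans hU) i)

theorem mono_exponent (hf : WeakGrad p Ω f F) (hqp : q ≤ p) : WeakGrad q Ω f F :=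
  of_parts
    (fun K hK hKU =>
      have : IsFiniteMeasure (volume.restrict K) := ⟨by simpa using hK.measure_lt_top⟩
      (hf.memLp K hK hKU).mono_exponent hqp)
    (fun K hK hKU i =>
      have : IsFiniteMeasure (volume.restrict K) := ⟨by simpa using hK.measure_lt_top⟩
      (hf.memLp_grad K hK hKU i).mono_exponent hqp)
    (fun _ hφ hφs hφU i => hf.parts' hφ hφs hφU i)

theorem add (hp : 1 ≤ p) (hf : WeakGrad p Ω f F) (hh : WeakGrad p Ω h H) :
    WeakGrad p Ω (fun y => f y + h y) (fun i y => F i y + H i y) := by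
  refine of_parts (fun K hK hKU => (hf.memLp K hK hKU).add (hh.memLp K hK hKU))
    (fun K hK hKU i => (hf.memLp_grad K hK hKU i).add (hh.memLp_grad K hK hKU i))
    (fun φ hφ hφs hφU i => ?_)
  have hd := continuous_fderiv_apply_const hφ (stdVec i)
  have hd' := hasCompactSupport_fderiv_apply_const hφs (stdVec i)
  have hd'' := (tsupport_fderiv_apply_subset φ (stdVec i)).trans hφU
  simp only [add_mul]
  rw [integral_add (integrable_mul_of_tsupport_subset (hf.integrableOn hp) hd hd' hd'')
    (integrable_mul_of_tsupport_subset (hh.integrableOn hp) hd hd' hd''),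
    integral_add (integrable_mul_of_tsupport_subset (hf.integrableOn_grad hp i) hφ.continuous hφs hφU)
    (integrable_mul_of_tsupport_subset (hh.integrableOn_grad hp i) hφ.continuous hφs hφU),
    hf.parts' hφ hφs hφU, hh.parts' hφ hφs hφU, neg_add]

theorem const_mul (c : ℝ) (hf : WeakGrad p Ω f F) :
    WeakGrad p Ω (fun y => c * f y) (fun i y => c * F i y) := by
  refine of_parts (fun K hK hKU => (hf.memLp K hK hKU).const_mul c)
    (fun K hK hKU i => (hf.memLp_grad K hK hKU i).const_mul c)
    (fun φ hφ hφs hφU i => ?_)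
  simp only [mul_assoc]
  rw [integral_const_mul, integral_const_mul, hf.parts' hφ hφs hφU, mul_neg]

theorem zero : WeakGrad p Ω (fun _ => 0) (fun _ _ => 0) :=
  of_parts (fun _ _ _ => MemLp.zero) (fun _ _ _ _ => MemLp.zero) (fun _ _ _ _ _ => by simp)

theorem sum (hp : 1 ≤ p) {ι : Type*} (s : Finset ι) {f : ι → Plane → ℝ}
    {F : ι → Fin 2 → Plane → ℝ} (hf : ∀ a ∈ s, WeakGrad p Ω (f a) (F a)) :
    WeakGrad p Ω (fun y => ∑ a ∈ s, f a y) (fun i y => ∑ a ∈ s, F a i y) := by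
  classical
  induction s using Finset.induction_on with
  | empty => simpa using zero
  | insert a s ha ih =>
    simp only [Finset.sum_insert ha]
    exact (hf a (by simp)).add hp (ih fun b hb => hf b (by simp [hb]))

/-- On an open set where a function is almost everywhere constant, its weak gradient vanishes. -/
theorem grad_ae_eq_zero_of_const (hp : 1 ≤ p) (hf : WeakGrad p Ω f F) (hU : IsOpen U) (hUΩ : U ⊆ Ω)
    (c : ℝ) (hc : ∀ᵐ y ∂(volume.restrict U), f y = c) (i : Fin 2) :
    ∀ᵐ y ∂(volume.restrict U), F i y = 0 := by
  refine ae_eq_zero_of_integral_test hU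
    (fun K hK hKU => hf.integrableOn_grad hp i K hK (hKU.trans hUΩ)) fun φ h1 h2 h3 => ?_
  have e := hf.parts' h1 h2 (h3.trans hUΩ) i
  have hd := (tsupport_fderiv_apply_subset φ (stdVec i)).trans h3
  have e2 : ∫ y, f y * fderiv ℝ φ y (stdVec i) = 0 := by
    rw [← setIntegral_mul_of_tsupport_subset _ hd,
      setIntegral_congr_ae (g := fun y => c * fderiv ℝ φ y (stdVec i)) hU.measurableSet
        (((ae_restrict_iff' hU.measurableSet).1 hc).mono fun y hy hyU => by rw [hy hyU]),
      setIntegral_mul_of_tsupport_subset _ hd, integral_const_mul]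
    rw [integral_fderiv_eq_zero h1 h2, mul_zero]
  linarith

/-- Two weak gradients of the same function agree almost everywhere. -/
theorem grad_ae_eq (hp : 1 ≤ p) (hf : WeakGrad p Ω f F) (hq : 1 ≤ q) (hh : WeakGrad q Ω h H)
    (hΩ : IsOpen Ω) (hfh : ∀ᵐ y ∂(volume.restrict Ω), f y = h y) (i : Fin 2) :
    ∀ᵐ y ∂(volume.restrict Ω), F i y = H i y := by
  have hf1 := hf.mono_exponent hp
  have hh1 := (hh.mono_exponent hq).const_mul (-1)
  filter_upwards [(hf1.add le_rfl hh1).grad_ae_eq_zero_of_const le_rfl hΩ subset_rfl 0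
    (hfh.mono fun y hy => by rw [hy]; ring) i] with y hy
  linarith

end WeakGrad

/-! ### Smooth approximation and products of weakly differentiable functions -/

theorem exists_contDiff_cutoff {Ω K : Set Plane} (hΩ : IsOpen Ω) (hK : IsCompact K) (hKΩ : K ⊆ Ω) :
    ∃ ζ : Plane → ℝ, ContDiff ℝ ∞ ζ ∧ HasCompactSupport ζ ∧ tsupport ζ ⊆ Ω ∧
      ∀ x ∈ K, ζ =ᶠ[𝓝 x] fun _ => 1 := by
  obtain ⟨L, hL, hKL, hLΩ⟩ := exists_compact_between hK hΩ hKΩ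
  obtain ⟨ζ, h1, h0, -⟩ := exists_contMDiffMap_one_nhds_of_subset_interior 𝓘(ℝ, Plane) (n := ⊤)
    hK.isClosed hKL
  have hsupp : tsupport ζ ⊆ L := closure_minimal
    (fun x hx => by_contra fun hxL => hx (h0 x hxL)) hL.isClosed
  exact ⟨ζ, ζ.contMDiff.contDiff, hL.of_isClosed_subset (isClosed_tsupport _) hsupp,
    hsupp.trans hLΩ, fun x hx => (eventually_nhdsSet_iff_forall.1 h1) x hx⟩

theorem memLp_mul_of_tsupport_subset {Ω : Set Plane} {p : ℝ≥0∞} {f φ : Plane → ℝ}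
    (hf : ∀ K : Set Plane, IsCompact K → K ⊆ Ω → MemLp f p (volume.restrict K))
    (hφ : Continuous φ) (hφs : HasCompactSupport φ) (hφΩ : tsupport φ ⊆ Ω) :
    MemLp (fun y => φ y * f y) p volume := by
  obtain ⟨C, hC⟩ := hφ.bounded_above_of_compact_support hφs
  have hφb : MemLp φ ⊤ (volume.restrict (tsupport φ)) :=
    memLp_top_of_bound hφ.aestronglyMeasurable C (ae_of_all _ hC)
  have h1 : MemLp (fun y => φ y * f y) p (volume.restrict (tsupport φ)) :=
    (hf _ hφs hφΩ).mul' hφb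
  rw [← memLp_indicator_iff_restrict (isClosed_tsupport φ).measurableSet] at h1
  rwa [indicator_eq_self.2 fun x hx => subset_tsupport φ fun h => hx (by simp [h])] at h1

theorem fderiv_mul_apply {φ ψ : Plane → ℝ} (hφ : ContDiff ℝ ∞ φ) (hψ : ContDiff ℝ ∞ ψ)
    (y v : Plane) :
    fderiv ℝ (fun y => φ y * ψ y) y v = φ y * fderiv ℝ ψ y v + fderiv ℝ φ y v * ψ y := by
  rw [fderiv_fun_mul (hφ.differentiable (by simp) y) (hψ.differentiable (by simp) y)]
  simp [mul_comm]

/-- Multiplying by a smooth cutoff extends a weakly differentiable function to the whole plane. -/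
theorem WeakGrad.cutoff {p : ℝ≥0∞} {Ω : Set Plane} {f : Plane → ℝ} {F : Fin 2 → Plane → ℝ}
    (hp : 1 ≤ p) (hf : WeakGrad p Ω f F) {ζ : Plane → ℝ} (hζ : ContDiff ℝ ∞ ζ)
    (hζs : HasCompactSupport ζ) (hζΩ : tsupport ζ ⊆ Ω) :
    MemLp (fun y => ζ y * f y) p volume ∧
    (∀ i, MemLp (fun y => fderiv ℝ ζ y (stdVec i) * f y + ζ y * F i y) p volume) ∧
    WeakGrad p univ (fun y => ζ y * f y)
      (fun i y => fderiv ℝ ζ y (stdVec i) * f y + ζ y * F i y) := by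
  have m1 := memLp_mul_of_tsupport_subset hf.memLp hζ.continuous hζs hζΩ
  have m2 : ∀ i, MemLp (fun y => fderiv ℝ ζ y (stdVec i) * f y + ζ y * F i y) p volume := fun i =>
    (memLp_mul_of_tsupport_subset hf.memLp (continuous_fderiv_apply_const hζ (stdVec i))
      (hasCompactSupport_fderiv_apply_const hζs _)
      ((tsupport_fderiv_apply_subset ζ _).trans hζΩ)).add
    (memLp_mul_of_tsupport_subset (fun K hK hKΩ => hf.memLp_grad K hK hKΩ i) hζ.continuous hζs hζΩ)
  refine ⟨m1, m2, WeakGrad.of_parts (fun K _ _ => m1.restrict K) (fun K _ _ i => (m2 i).restrict K)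
    fun φ hφ hφs _ i => ?_⟩
  have hs : tsupport (fun y => ζ y * φ y) ⊆ tsupport ζ := tsupport_mul_subset_left
  have hsc : HasCompactSupport (fun y => ζ y * φ y) := hφs.mul_left
  have e := hf.parts' (hζ.mul hφ) hsc (hs.trans hζΩ) i
  have i1 : Integrable fun y => f y * (fderiv ℝ ζ y (stdVec i) * φ y) := by
    refine integrable_mul_of_tsupport_subset (hf.integrableOn hp)
      ((continuous_fderiv_apply_const hζ _).mul hφ.continuous) hφs.mul_left ?_
    exact (tsupport_mul_subset_left.trans (tsupport_fderiv_apply_subset ζ _)).trans hζΩ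
  have i2 : Integrable fun y => f y * (ζ y * fderiv ℝ φ y (stdVec i)) :=
    integrable_mul_of_tsupport_subset (hf.integrableOn hp)
      (hζ.continuous.mul (continuous_fderiv_apply_const hφ _)) hζs.mul_right
      (tsupport_mul_subset_left.trans hζΩ)
  have i3 : Integrable fun y => F i y * (ζ y * φ y) :=
    integrable_mul_of_tsupport_subset (hf.integrableOn_grad hp i)
      (hζ.mul hφ).continuous hsc (hs.trans hζΩ)
  have e1 : ∫ y, f y * fderiv ℝ (fun y => ζ y * φ y) y (stdVec i) =
      ∫ y, f y * (ζ y * fderiv ℝ φ y (stdVec i)) + f y * (fderiv ℝ ζ y (stdVec i) * φ y) := by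
    congr 1
    funext y
    rw [fderiv_mul_apply hζ hφ, mul_add]
  rw [e1, integral_add i2 i1] at e
  have e2 : ∫ y, ζ y * f y * fderiv ℝ φ y (stdVec i) =
      ∫ y, f y * (ζ y * fderiv ℝ φ y (stdVec i)) := by
    congr 1
    funext y
    ring
  have e3 : ∫ y, (fderiv ℝ ζ y (stdVec i) * f y + ζ y * F i y) * φ y =
      (∫ y, f y * (fderiv ℝ ζ y (stdVec i) * φ y)) + ∫ y, F i y * (ζ y * φ y) := by
    rw [← integral_add i1 i3]
    congr 1
    funext y
    ring
  rw [e2, e3]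
  linarith

/-- Smooth approximation on a compact set: the gradients converge in `L^p`, and the functions
converge uniformly if the limit is continuous. -/
theorem WeakGrad.exists_approx {p : ℝ≥0∞} {Ω : Set Plane} {f : Plane → ℝ} {F : Fin 2 → Plane → ℝ}
    (hp : 1 ≤ p) (hp' : p ≠ ⊤) (hΩ : IsOpen Ω) (hf : WeakGrad p Ω f F) (hfc : ContinuousOn f Ω)
    {K : Set Plane} (hK : IsCompact K) (hKΩ : K ⊆ Ω) :
    ∃ a : ℕ → Plane → ℝ, (∀ k, ContDiff ℝ ∞ (a k)) ∧
      Tendsto (fun k => eLpNorm (a k - f) ⊤ (volume.restrict K)) atTop (𝓝 0) ∧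
      ∀ i, Tendsto (fun k => eLpNorm ((fun y => fderiv ℝ (a k) y (stdVec i)) - F i) p
        (volume.restrict K)) atTop (𝓝 0) := by
  obtain ⟨ζ, hζ, hζs, hζΩ, hζ1⟩ := exists_contDiff_cutoff hΩ hK hKΩ
  obtain ⟨m1, m2, hg⟩ := hf.cutoff hp hζ hζs hζΩ
  have hc : Continuous fun y => ζ y * f y := by
    rw [continuous_iff_continuousAt]
    intro x
    by_cases hx : x ∈ tsupport ζ
    · exact hζ.continuous.continuousAt.mul (hfc.continuousAt (hΩ.mem_nhds (hζΩ hx)))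
    · have : (fun y => ζ y * f y) =ᶠ[𝓝 x] fun _ => 0 :=
        ((notMem_tsupport_iff_eventuallyEq.1 hx)).mono fun y hy => by simp [hy]
      exact continuousAt_const.congr this.symm
  have hcs : HasCompactSupport fun y => ζ y * f y := hζs.mul_right
  have hu := hcs.uniformContinuous_of_continuous hc
  refine ⟨fun k => moll k fun y => ζ y * f y, fun k => contDiff_moll k (m1.locallyIntegrable hp),
    ?_, fun i => ?_⟩
  · rw [ENNReal.tendsto_nhds_zero]
    intro ε hε
    obtain ⟨c, hc0, hcε⟩ := ENNReal.lt_iff_exists_nnreal_btwn.1 hε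
    have hc0' : (0 : ℝ) < c := by exact_mod_cast hc0
    filter_upwards [Metric.tendstoUniformly_iff.1 (tendstoUniformly_moll hu) c hc0'] with k hk
    refine le_trans ?_ hcε.le
    have := eLpNorm_le_of_ae_bound (μ := volume.restrict K) (p := ⊤)
      (f := (moll k fun y => ζ y * f y) - f) (C := c)
      ((ae_restrict_iff' hK.measurableSet).2 (ae_of_all _ fun x hx => by
        have h1 : ζ x = 1 := (hζ1 x hx).eq_of_nhds
        have h2 := hk x
        rw [dist_comm, dist_eq_norm, h1, one_mul] at h2
        exact h2.le))
    simpa using this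
  · have h0 := tendsto_eLpNorm_moll_sub hp hp' (m2 i)
    refine tendsto_of_tendsto_of_tendsto_of_le_of_le tendsto_const_nhds h0 (fun _ => zero_le)
      fun k => ?_
    refine le_trans (le_of_eq ?_) (eLpNorm_mono_measure _ (Measure.restrict_le_self (s := K)))
    apply eLpNorm_congr_ae
    refine (ae_restrict_iff' hK.measurableSet).2 (ae_of_all _ fun x hx => ?_)
    have h1 : ζ x = 1 := (hζ1 x hx).eq_of_nhds
    have h2 : fderiv ℝ ζ x = 0 := by
      rw [(hζ1 x hx).fderiv_eq]
      simp
    simp only [Pi.sub_apply]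
    rw [fderiv_moll k (m1.locallyIntegrable hp) (stdVec i)
      (fun φ h1 h2 => hg.parts' h1 h2 (subset_univ _) i) x, h1, h2]
    simp

theorem tendsto_integral_mul_of_eLpNorm {α : Type*} [MeasurableSpace α] {μ : Measure α} {p q : ℝ≥0∞}
    [ENNReal.HolderConjugate p q] {a : ℕ → α → ℝ} {f b : α → ℝ}
    (ha : ∀ k, AEStronglyMeasurable (a k) μ) (hf : MemLp f p μ) (hb : MemLp b q μ)
    (h : Tendsto (fun k => eLpNorm (a k - f) p μ) atTop (𝓝 0)) :
    Tendsto (fun k => ∫ x, a k x * b x ∂μ) atTop (𝓝 (∫ x, f x * b x ∂μ)) := by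
  have hfb : MemLp (fun x => f x * b x) 1 μ := hb.mul' hf
  have hlim : Tendsto (fun k => eLpNorm ((fun x => a k x * b x) - fun x => f x * b x) 1 μ)
      atTop (𝓝 0) := by
    have h2 : Tendsto (fun k => eLpNorm (a k - f) p μ * eLpNorm b q μ) atTop (𝓝 0) := by
      have := ENNReal.Tendsto.mul_const h (Or.inr hb.eLpNorm_ne_top)
      rwa [zero_mul] at this
    refine tendsto_of_tendsto_of_tendsto_of_le_of_le tendsto_const_nhds h2 (fun _ => zero_le)
      fun k => ?_
    have := eLpNorm_smul_le_mul_eLpNorm (p := p) (q := q) (r := 1) hb.1 ((ha k).sub hf.1)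
    refine le_trans (le_of_eq ?_) this
    congr 1
    funext x
    simp [sub_mul]
  refine tendsto_integral_of_L1' _ hfb.1 ?_ hlim
  have hev := (ENNReal.tendsto_nhds_zero.1 hlim 1 one_pos)
  filter_upwards [hev] with k hk
  have hm : MemLp ((fun x => a k x * b x) - fun x => f x * b x) 1 μ :=
    ⟨(((ha k).mul hb.1).sub hfb.1), hk.trans_lt ENNReal.one_lt_top⟩
  have := hm.add hfb
  rw [sub_add_cancel] at this
  exact memLp_one_iff_integrable.1 this

section Product

variable {p q : ℝ≥0∞} [ENNReal.HolderConjugate p q] {Ω : Set Plane} {f h : Plane → ℝ}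
  {F H : Fin 2 → Plane → ℝ}

theorem ContinuousOn.memLp_top_restrict {Ω K : Set Plane} {f : Plane → ℝ} (hf : ContinuousOn f Ω)
    (hK : IsCompact K) (hKΩ : K ⊆ Ω) : MemLp f ⊤ (volume.restrict K) := by
  obtain ⟨C, hC⟩ := hK.exists_bound_of_continuousOn (hf.mono hKΩ)
  exact memLp_top_of_bound ((hf.mono hKΩ).aestronglyMeasurable hK.measurableSet) C
    ((ae_restrict_iff' hK.measurableSet).2 (ae_of_all _ hC))

/-- The product rule for a continuous function of class `W^{1,p}` and one of class `W^{1,q}`, tested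
against a smooth function. -/
theorem integral_mul_mul_fderiv (hp : 1 ≤ p) (hp' : p ≠ ⊤) (hq : 1 ≤ q) (hΩ : IsOpen Ω)
    (hf : WeakGrad p Ω f F) (hfc : ContinuousOn f Ω) (hh : WeakGrad q Ω h H) {φ : Plane → ℝ}
    (hφ : ContDiff ℝ ∞ φ) (hφs : HasCompactSupport φ) (hφΩ : tsupport φ ⊆ Ω) (i : Fin 2) :
    ∫ y, f y * h y * fderiv ℝ φ y (stdVec i) = -∫ y, (F i y * h y + f y * H i y) * φ y := by
  set K := tsupport φ with hKdef
  have hK : IsCompact K := hφs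
  obtain ⟨a, ha, ha0, ha1⟩ := hf.exists_approx hp hp' hΩ hfc hK hφΩ
  have : IsFiniteMeasure (volume.restrict K) := ⟨by simpa using hK.measure_lt_top⟩
  have hdφ := continuous_fderiv_apply_const hφ (stdVec i)
  have hdφs := hasCompactSupport_fderiv_apply_const hφs (stdVec i)
  have hdφK : tsupport (fun y => fderiv ℝ φ y (stdVec i)) ⊆ K := tsupport_fderiv_apply_subset φ _
  have cK := fun (u : Plane → ℝ) (hu : Continuous u) =>
    ContinuousOn.memLp_top_restrict (hu.continuousOn (s := univ)) hK (subset_univ K)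
  have b1 : MemLp (fun y => h y * fderiv ℝ φ y (stdVec i)) 1 (volume.restrict K) :=
    ((cK _ hdφ).mul' (hh.memLp K hK hφΩ)).mono_exponent hq
  have b2 : MemLp (fun y => h y * φ y) q (volume.restrict K) :=
    (cK _ hφ.continuous).mul' (hh.memLp K hK hφΩ)
  have b3 : MemLp (fun y => H i y * φ y) 1 (volume.restrict K) :=
    ((cK _ hφ.continuous).mul' (hh.memLp_grad K hK hφΩ i)).mono_exponent hq
  have fK := ContinuousOn.memLp_top_restrict hfc hK hφΩ
  have am : ∀ k, AEStronglyMeasurable (a k) (volume.restrict K) :=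
    fun k => (ha k).continuous.aestronglyMeasurable
  have adm : ∀ k, AEStronglyMeasurable (fun y => fderiv ℝ (a k) y (stdVec i)) (volume.restrict K) :=
    fun k => (continuous_fderiv_apply_const (ha k) _).aestronglyMeasurable
  have t1 := tendsto_integral_mul_of_eLpNorm (p := ⊤) (q := 1) am fK b1 ha0
  have t2 := tendsto_integral_mul_of_eLpNorm (p := p) (q := q) adm (hf.memLp_grad K hK hφΩ i) b2
    (ha1 i)
  have t3 := tendsto_integral_mul_of_eLpNorm (p := ⊤) (q := 1) am fK b3 ha0
  -- the identity for the smooth approximations is the definition of the weak gradient of `h`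
  have key : ∀ k, (∫ y in K, a k y * (h y * fderiv ℝ φ y (stdVec i))) +
      (∫ y in K, fderiv ℝ (a k) y (stdVec i) * (h y * φ y)) =
      -∫ y in K, a k y * (H i y * φ y) := by
    intro k
    have hs : tsupport (fun y => a k y * φ y) ⊆ K := tsupport_mul_subset_right
    have hsc : HasCompactSupport (fun y => a k y * φ y) := hφs.mul_left
    have e := hh.parts' ((ha k).mul hφ) hsc (hs.trans hφΩ) i
    have r1 : ∫ y in K, a k y * (h y * fderiv ℝ φ y (stdVec i)) =
        ∫ y, (a k y * h y) * fderiv ℝ φ y (stdVec i) := by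
      rw [← setIntegral_mul_of_tsupport_subset _ hdφK]
      congr 1
      funext y
      ring
    have r2 : ∫ y in K, fderiv ℝ (a k) y (stdVec i) * (h y * φ y) =
        ∫ y, (fderiv ℝ (a k) y (stdVec i) * h y) * φ y := by
      rw [← setIntegral_mul_of_tsupport_subset _ subset_rfl]
      congr 1
      funext y
      ring
    have r3 : ∫ y in K, a k y * (H i y * φ y) = ∫ y, H i y * (a k y * φ y) := by
      rw [← setIntegral_mul_of_tsupport_subset _ hs]
      congr 1
      funext y
      ring
    have i1 : Integrable fun y => h y * (a k y * fderiv ℝ φ y (stdVec i)) :=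
      integrable_mul_of_tsupport_subset (hh.integrableOn hq) ((ha k).continuous.mul hdφ)
        hdφs.mul_left ((tsupport_mul_subset_right.trans hdφK).trans hφΩ)
    have i2 : Integrable fun y => h y * (fderiv ℝ (a k) y (stdVec i) * φ y) :=
      integrable_mul_of_tsupport_subset (hh.integrableOn hq)
        ((continuous_fderiv_apply_const (ha k) _).mul hφ.continuous)
        hφs.mul_left (tsupport_mul_subset_right.trans hφΩ)
    rw [r1, r2, r3, ← e]
    rw [show (fun y => (a k y * h y) * fderiv ℝ φ y (stdVec i)) =
      fun y => h y * (a k y * fderiv ℝ φ y (stdVec i)) by funext y; ring,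
      show (fun y => (fderiv ℝ (a k) y (stdVec i) * h y) * φ y) =
      fun y => h y * (fderiv ℝ (a k) y (stdVec i) * φ y) by funext y; ring, ← integral_add i1 i2]
    congr 1
    funext y
    rw [fderiv_mul_apply (ha k) hφ, mul_add]
  have lim := tendsto_nhds_unique (t1.add t2) (t3.neg.congr fun k => (key k).symm)
  have m2 : MemLp (fun y => F i y * (h y * φ y)) 1 (volume.restrict K) :=
    b2.mul' (hf.memLp_grad K hK hφΩ i)
  have m3 : MemLp (fun y => f y * (H i y * φ y)) 1 (volume.restrict K) := b3.mul' fK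
  rw [← setIntegral_mul_of_tsupport_subset _ hdφK,
    ← setIntegral_mul_of_tsupport_subset _ (subset_rfl : tsupport φ ⊆ K)]
  have r4 : ∫ y in K, (F i y * h y + f y * H i y) * φ y =
      (∫ y in K, F i y * (h y * φ y)) + ∫ y in K, f y * (H i y * φ y) := by
    rw [← integral_add (memLp_one_iff_integrable.1 m2) (memLp_one_iff_integrable.1 m3)]
    congr 1
    funext y
    ring
  have r5 : ∫ y in K, f y * h y * fderiv ℝ φ y (stdVec i) =
      ∫ y in K, f y * (h y * fderiv ℝ φ y (stdVec i)) := by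
    congr 1
    funext y
    ring
  rw [r4, r5]
  linarith

/-- The product of a continuous `W^{1,p}` function `f` and a `W^{1,q}` function `h` is of class
`W^{1,q}`, provided that `h df` is locally in `L^q`. -/
theorem WeakGrad.mul (hp : 1 ≤ p) (hp' : p ≠ ⊤) (hq : 1 ≤ q) (hΩ : IsOpen Ω)
    (hf : WeakGrad p Ω f F) (hfc : ContinuousOn f Ω) (hh : WeakGrad q Ω h H)
    (hFh : ∀ K : Set Plane, IsCompact K → K ⊆ Ω → ∀ i,
      MemLp (fun y => F i y * h y) q (volume.restrict K)) :
    WeakGrad q Ω (fun y => f y * h y) (fun i y => F i y * h y + f y * H i y) :=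
  WeakGrad.of_parts
    (fun K hK hKΩ => (hh.memLp K hK hKΩ).mul' (ContinuousOn.memLp_top_restrict hfc hK hKΩ))
    (fun K hK hKΩ i => (hFh K hK hKΩ i).add
      ((hh.memLp_grad K hK hKΩ i).mul' (ContinuousOn.memLp_top_restrict hfc hK hKΩ)))
    (fun _ hφ hφs hφΩ i => integral_mul_mul_fderiv hp hp' hq hΩ hf hfc hh hφ hφs hφΩ i)

theorem fderiv_fderiv_comm {a : Plane → ℝ} (ha : ContDiff ℝ ∞ a) (y v w : Plane) :
    fderiv ℝ (fun z => fderiv ℝ a z v) y w = fderiv ℝ (fun z => fderiv ℝ a z w) y v := by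
  have hd : DifferentiableAt ℝ (fderiv ℝ a) y :=
    (ha.fderiv_right (m := ∞) (by simp)).differentiable (by simp) y
  have hs : IsSymmSndFDerivAt ℝ a y := ha.contDiffAt.isSymmSndFDerivAt (by
    rw [minSmoothness_of_isRCLikeNormedField]
    exact ENat.LEInfty.out)
  rw [fderiv_clm_apply hd (by fun_prop), fderiv_clm_apply hd (by fun_prop)]
  simpa using hs w v

/-- The exterior derivative of a weak differential vanishes, tested against the product of a smooth
`χ` with compact support and a continuous `f` of class `W^{1,p}`: `∫ d(χ f) ∧ dh = 0`. -/
theorem integral_wedge_eq_zero (hp : 1 ≤ p) (hp' : p ≠ ⊤) (hq : 1 ≤ q) (hΩ : IsOpen Ω)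
    (hf : WeakGrad p Ω f F) (hfc : ContinuousOn f Ω) (hh : WeakGrad q Ω h H) {χ : Plane → ℝ}
    (hχ : ContDiff ℝ ∞ χ) (hχs : HasCompactSupport χ) (hχΩ : tsupport χ ⊆ Ω) :
    Integrable (fun y => (χ y * F 0 y + fderiv ℝ χ y (stdVec 0) * f y) * H 1 y -
        (χ y * F 1 y + fderiv ℝ χ y (stdVec 1) * f y) * H 0 y) ∧
      ∫ y, ((χ y * F 0 y + fderiv ℝ χ y (stdVec 0) * f y) * H 1 y -
        (χ y * F 1 y + fderiv ℝ χ y (stdVec 1) * f y) * H 0 y) = 0 := by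
  set K := tsupport χ with hKdef
  have hK : IsCompact K := hχs
  obtain ⟨a, ha, ha0, ha1⟩ := hf.exists_approx hp hp' hΩ hfc hK hχΩ
  have : IsFiniteMeasure (volume.restrict K) := ⟨by simpa using hK.measure_lt_top⟩
  have cK := fun (u : Plane → ℝ) (hu : Continuous u) =>
    ContinuousOn.memLp_top_restrict (hu.continuousOn (s := univ)) hK (subset_univ K)
  have fK := ContinuousOn.memLp_top_restrict hfc hK hχΩ
  have hdK : ∀ i, tsupport (fun y => fderiv ℝ χ y (stdVec i)) ⊆ K := fun i =>
    tsupport_fderiv_apply_subset χ _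
  have b1 : ∀ j, MemLp (fun y => χ y * H j y) q (volume.restrict K) := fun j =>
    (hh.memLp_grad K hK hχΩ j).mul' (cK _ hχ.continuous)
  have b2 : ∀ i j, MemLp (fun y => fderiv ℝ χ y (stdVec i) * H j y) 1 (volume.restrict K) :=
    fun i j => ((hh.memLp_grad K hK hχΩ j).mul'
      (cK _ (continuous_fderiv_apply_const hχ _))).mono_exponent hq
  -- the four terms of the wedge product, for a function `u` with gradient `U`
  have int1 : ∀ _i j : Fin 2, ∀ U : Plane → ℝ, MemLp U p (volume.restrict K) →
      Integrable (fun y => U y * (χ y * H j y)) (volume.restrict K) := fun i j U hU =>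
    memLp_one_iff_integrable.1 ((b1 j).mul' hU)
  have int2 : ∀ i j : Fin 2, ∀ u : Plane → ℝ, MemLp u ⊤ (volume.restrict K) →
      Integrable (fun y => u y * (fderiv ℝ χ y (stdVec i) * H j y)) (volume.restrict K) :=
    fun i j u hu => memLp_one_iff_integrable.1 ((b2 i j).mul' hu)
  have decomp : ∀ (u : Plane → ℝ) (U : Fin 2 → Plane → ℝ),
      (fun y => (χ y * U 0 y + fderiv ℝ χ y (stdVec 0) * u y) * H 1 y -
        (χ y * U 1 y + fderiv ℝ χ y (stdVec 1) * u y) * H 0 y) =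
      fun y => (U 0 y * (χ y * H 1 y) + u y * (fderiv ℝ χ y (stdVec 0) * H 1 y)) -
        (U 1 y * (χ y * H 0 y) + u y * (fderiv ℝ χ y (stdVec 1) * H 0 y)) := by
    intro u U
    funext y
    ring
  have suppK : ∀ (u : Plane → ℝ) (U : Fin 2 → Plane → ℝ), Function.support
      (fun y => (χ y * U 0 y + fderiv ℝ χ y (stdVec 0) * u y) * H 1 y -
        (χ y * U 1 y + fderiv ℝ χ y (stdVec 1) * u y) * H 0 y) ⊆ K := by
    intro u U y hy
    by_contra hyK
    have e0 : χ y = 0 := image_eq_zero_of_notMem_tsupport hyK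
    have e1 : ∀ i, fderiv ℝ χ y (stdVec i) = 0 := fun i =>
      image_eq_zero_of_notMem_tsupport (f := fun y => fderiv ℝ χ y (stdVec i))
        fun h => hyK (hdK i h)
    exact hy (by simp [e0, e1])
  have intK : ∀ (u : Plane → ℝ) (U : Fin 2 → Plane → ℝ), MemLp u ⊤ (volume.restrict K) →
      (∀ i, MemLp (U i) p (volume.restrict K)) →
      IntegrableOn (fun y => (χ y * U 0 y + fderiv ℝ χ y (stdVec 0) * u y) * H 1 y -
        (χ y * U 1 y + fderiv ℝ χ y (stdVec 1) * u y) * H 0 y) K ∧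
      ∫ y in K, ((χ y * U 0 y + fderiv ℝ χ y (stdVec 0) * u y) * H 1 y -
        (χ y * U 1 y + fderiv ℝ χ y (stdVec 1) * u y) * H 0 y) =
      ((∫ y in K, U 0 y * (χ y * H 1 y)) + ∫ y in K, u y * (fderiv ℝ χ y (stdVec 0) * H 1 y)) -
        ((∫ y in K, U 1 y * (χ y * H 0 y)) + ∫ y in K, u y * (fderiv ℝ χ y (stdVec 1) * H 0 y)) := by
    intro u U hu hU
    rw [decomp u U]
    have j1 := int1 0 1 _ (hU 0)
    have j2 := int2 0 1 _ hu
    have j3 := int1 0 0 _ (hU 1)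
    have j4 := int2 1 0 _ hu
    have j5 : Integrable (fun y => U 0 y * (χ y * H 1 y) +
      u y * (fderiv ℝ χ y (stdVec 0) * H 1 y)) (volume.restrict K) := j1.add j2
    have j6 : Integrable (fun y => U 1 y * (χ y * H 0 y) +
      u y * (fderiv ℝ χ y (stdVec 1) * H 0 y)) (volume.restrict K) := j3.add j4
    exact ⟨j5.sub j6, by rw [integral_sub j5 j6, integral_add j1 j2, integral_add j3 j4]⟩
  obtain ⟨I1, I2⟩ := intK f F fK (fun i => hf.memLp_grad K hK hχΩ i)
  refine ⟨(integrableOn_iff_integrable_of_support_subset (suppK f F)).1 I1, ?_⟩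
  rw [← setIntegral_eq_integral_of_forall_compl_eq_zero
    (fun y hy => Function.notMem_support.1 fun h => hy (suppK f F h)), I2]
  have am : ∀ k, AEStronglyMeasurable (a k) (volume.restrict K) :=
    fun k => (ha k).continuous.aestronglyMeasurable
  have adm : ∀ k i, AEStronglyMeasurable (fun y => fderiv ℝ (a k) y (stdVec i))
      (volume.restrict K) := fun k i => (continuous_fderiv_apply_const (ha k) _).aestronglyMeasurable
  have t1 := fun i j => tendsto_integral_mul_of_eLpNorm (p := p) (q := q) (fun k => adm k i)
    (hf.memLp_grad K hK hχΩ i) (b1 j) (ha1 i)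
  have t2 := fun i j => tendsto_integral_mul_of_eLpNorm (p := ⊤) (q := 1) am fK (b2 i j) ha0
  refine tendsto_nhds_unique (((t1 0 1).add (t2 0 1)).sub ((t1 1 0).add (t2 1 0)))
    (tendsto_const_nhds.congr fun k => ?_)
  -- for smooth `a`, integrate `d(χ a)` by parts: the mixed second derivatives cancel
  set U : Fin 2 → Plane → ℝ := fun i y => fderiv ℝ (a k) y (stdVec i) with hU
  have hUK : ∀ i, MemLp (U i) p (volume.restrict K) := fun i =>
    (cK _ (continuous_fderiv_apply_const (ha k) _)).mono_exponent le_top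
  rw [← (intK (a k) U (cK _ (ha k).continuous) hUK).2,
    setIntegral_eq_integral_of_forall_compl_eq_zero
    (fun y hy => Function.notMem_support.1 fun h => hy (suppK (a k) U h))]
  set b : Plane → ℝ := fun y => χ y * a k y with hb
  have hbd : ContDiff ℝ ∞ b := hχ.mul (ha k)
  have hbs : HasCompactSupport b := hχs.mul_right
  have hbK : tsupport b ⊆ K := tsupport_mul_subset_left
  have hbi : ∀ i y, χ y * U i y + fderiv ℝ χ y (stdVec i) * a k y = fderiv ℝ b y (stdVec i) :=
    fun i y => (fderiv_mul_apply hχ (ha k) y _).symm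
  simp only [hbi]
  have hb' := fun i => contDiff_fderiv_apply_const hbd (stdVec i)
  have hb's := fun i => hasCompactSupport_fderiv_apply_const hbs (stdVec i)
  have hb'K := fun i => ((tsupport_fderiv_apply_subset b (stdVec i)).trans hbK).trans hχΩ
  have p1 := hh.parts' (hb' 0) (hb's 0) (hb'K 0) 1
  have p2 := hh.parts' (hb' 1) (hb's 1) (hb'K 1) 0
  have n1 : Integrable fun y => fderiv ℝ b y (stdVec 0) * H 1 y := by
    simpa only [mul_comm] using integrable_mul_of_tsupport_subset (hh.integrableOn_grad hq 1)
      (hb' 0).continuous (hb's 0) (hb'K 0)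
  have n2 : Integrable fun y => fderiv ℝ b y (stdVec 1) * H 0 y := by
    simpa only [mul_comm] using integrable_mul_of_tsupport_subset (hh.integrableOn_grad hq 0)
      (hb' 1).continuous (hb's 1) (hb'K 1)
  rw [integral_sub n1 n2]
  simp only [fderiv_fderiv_comm hbd _ (stdVec 0) (stdVec 1)] at p1
  rw [p1, neg_inj] at p2
  simp only [mul_comm (fderiv ℝ b _ _)]
  rw [p2, sub_self]

end Product

/-- The local Sobolev embedding `W^{1,q} ⊂ L^r`, `1/r ≥ 1/q - 1/2`, in the plane. The
Gagliardo–Nirenberg–Sobolev inequality is applied to the mollifications of a cutoff of `h`, and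
passed to the limit by Fatou's lemma. -/
theorem WeakGrad.memLp_sobolev {q r : ℝ} (hq : 1 ≤ q) (hq2 : q < 2) (hr : 0 < r)
    (hqr : q⁻¹ - 2⁻¹ ≤ r⁻¹) {Ω : Set Plane} (hΩ : IsOpen Ω) {h : Plane → ℝ}
    {H : Fin 2 → Plane → ℝ} (hh : WeakGrad (ENNReal.ofReal q) Ω h H) (K : Set Plane)
    (hK : IsCompact K) (hKΩ : K ⊆ Ω) : MemLp h (ENNReal.ofReal r) (volume.restrict K) := by
  have hq1 : 1 ≤ ENNReal.ofReal q := by simpa using hq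
  obtain ⟨ζ, hζ, hζs, hζΩ, hζ1⟩ := exists_contDiff_cutoff hΩ hK hKΩ
  obtain ⟨m1, m2, hg⟩ := hh.cutoff hq1 hζ hζs hζΩ
  set G : Fin 2 → Plane → ℝ := fun i y => fderiv ℝ ζ y (stdVec i) * h y + ζ y * H i y with hG
  have hloc := m1.locallyIntegrable hq1
  set s := Metric.cthickening 1 (tsupport fun y => ζ y * h y) with hs
  have hcs : HasCompactSupport fun y => ζ y * h y := hζs.mul_right
  have hsc : IsCompact s := hcs.isCompact.cthickening
  -- uniform bound for the mollifications
  have bound : ∀ k, eLpNorm (moll k fun y => ζ y * h y) (ENNReal.ofReal r) volume ≤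
      eLpNormLESNormFDerivOfLeConst ℝ volume s q.toNNReal r.toNNReal *
        (eLpNorm (G 0) (ENNReal.ofReal q) volume + eLpNorm (G 1) (ENNReal.ofReal q) volume) := by
    intro k
    have hd := contDiff_moll k hloc
    have b := eLpNorm_le_eLpNorm_fderiv_of_le (volume : Measure Plane) (p := q.toNNReal)
      (q := r.toNNReal) (hd.of_le (by exact_mod_cast le_top)) (support_moll_subset k _)
      (by simpa using hq) (by simpa using (Real.toNNReal_lt_ofNat (n := 2)).2 hq2)
      (by
        rw [NNReal.coe_inv, Real.coe_toNNReal _ (by linarith), Real.coe_toNNReal _ hr.le]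
        simpa using hqr) hsc.isBounded
    refine le_trans b (mul_le_mul_right ?_ _)
    have hm : ∀ i, AEStronglyMeasurable (moll k (G i)) volume := fun i =>
      (contDiff_moll k ((m2 i).locallyIntegrable hq1)).continuous.aestronglyMeasurable
    have hb : ∀ i, eLpNorm (moll k (G i)) (ENNReal.ofReal q) volume ≤
        eLpNorm (G i) (ENNReal.ofReal q) volume := fun i =>
      eLpNorm_moll_le k hq1 ENNReal.ofReal_ne_top (m2 i).1
    have hfd : ∀ x i, fderiv ℝ (moll k fun y => ζ y * h y) x (stdVec i) = moll k (G i) x :=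
      fun x i => fderiv_moll k hloc (stdVec i)
        (fun φ h1 h2 => hg.parts' h1 h2 (subset_univ _) i) x
    calc eLpNorm (fderiv ℝ (moll k fun y => ζ y * h y)) (ENNReal.ofReal q) volume
        ≤ eLpNorm ((fun x => ‖moll k (G 0) x‖) + fun x => ‖moll k (G 1) x‖)
          (ENNReal.ofReal q) volume := by
          refine eLpNorm_mono fun x => ?_
          rw [Real.norm_of_nonneg (by simp only [Pi.add_apply]; positivity)]
          refine ContinuousLinearMap.opNorm_le_bound _
            (by simp only [Pi.add_apply]; positivity) fun v => ?_
          have hv : v = v 0 • stdVec 0 + v 1 • stdVec 1 := by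
            ext j
            fin_cases j <;> simp [stdVec]
          conv_lhs => rw [hv]
          rw [map_add, map_smul, map_smul, hfd, hfd, Pi.add_apply, add_mul]
          refine (norm_add_le _ _).trans ?_
          rw [norm_smul, norm_smul, mul_comm ‖v 0‖, mul_comm ‖v 1‖]
          exact add_le_add
            (mul_le_mul_of_nonneg_left (PiLp.norm_apply_le v 0)
              (norm_nonneg _))
            (mul_le_mul_of_nonneg_left (PiLp.norm_apply_le v 1) (norm_nonneg _))
      _ ≤ _ := eLpNorm_add_le (hm 0).norm (hm 1).norm hq1
      _ ≤ _ := by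
          rw [eLpNorm_norm, eLpNorm_norm]
          exact add_le_add (hb 0) (hb 1)
  have hlim := Lp.eLpNorm_lim_le_liminf_eLpNorm (p := ENNReal.ofReal r)
    (fun k => (contDiff_moll k hloc).continuous.aestronglyMeasurable (μ := volume)) _
    (ae_tendsto_moll hloc)
  have hfin : eLpNorm (fun y => ζ y * h y) (ENNReal.ofReal r) volume < ⊤ := by
    refine hlim.trans_lt (lt_of_le_of_lt (liminf_le_of_frequently_le'
      (Frequently.of_forall bound)) ?_)
    exact ENNReal.mul_lt_top ENNReal.coe_lt_top
      (ENNReal.add_lt_top.2 ⟨(m2 0).eLpNorm_lt_top, (m2 1).eLpNorm_lt_top⟩)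
  have hmem : MemLp (fun y => ζ y * h y) (ENNReal.ofReal r) (volume.restrict K) :=
    (show MemLp _ _ volume from ⟨m1.1, hfin⟩).restrict K
  refine hmem.ae_eq ((ae_restrict_iff' hK.measurableSet).2 (ae_of_all _ fun x hx => ?_))
  rw [(hζ1 x hx).eq_of_nhds, one_mul]

/-! ### Weak gradients under diffeomorphisms of planar domains -/

theorem det_plane (A : Plane →L[ℝ] Plane) :
    A.det = A (stdVec 0) 0 * A (stdVec 1) 1 - A (stdVec 1) 0 * A (stdVec 0) 1 := by
  rw [ContinuousLinearMap.det, ← LinearMap.det_toMatrix (EuclideanSpace.basisFun (Fin 2) ℝ).toBasis,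
    Matrix.det_fin_two]
  simp [LinearMap.toMatrix_apply, stdVec]

theorem plane_eq_sum (v : Plane) : v = v 0 • stdVec 0 + v 1 • stdVec 1 := by
  ext j
  fin_cases j <;> simp [stdVec]

/-- Extension by zero of a smooth function that vanishes off a compact subset. -/
theorem contDiff_indicator_of_compact {U C : Set Plane} (hU : IsOpen U) (hC : IsCompact C)
    (hCU : C ⊆ U) {a : Plane → ℝ} (ha : ContDiffOn ℝ ∞ a U) (h0 : ∀ z ∈ U, z ∉ C → a z = 0) :
    ContDiff ℝ ∞ (U.indicator a) ∧ HasCompactSupport (U.indicator a) ∧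
      tsupport (U.indicator a) ⊆ U := by
  have hz : ∀ z, z ∉ C → U.indicator a z = 0 := by
    intro z hz
    by_cases hzU : z ∈ U
    · rw [indicator_of_mem hzU, h0 z hzU hz]
    · exact indicator_of_notMem hzU _
  have hsupp : tsupport (U.indicator a) ⊆ C := closure_minimal
    (fun x hx => by_contra fun hxL => hx (hz x hxL)) hC.isClosed
  refine ⟨contDiff_iff_contDiffAt.2 fun z => ?_, hC.of_isClosed_subset (isClosed_tsupport _) hsupp,
    hsupp.trans hCU⟩
  by_cases hzU : z ∈ U
  · refine (ha.contDiffAt (hU.mem_nhds hzU)).congr_of_eventuallyEq ?_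
    filter_upwards [hU.mem_nhds hzU] with w hw using indicator_of_mem hw a
  · refine contDiffAt_const (c := (0 : ℝ)) |>.congr_of_eventuallyEq ?_
    filter_upwards [hC.isClosed.isOpen_compl.mem_nhds fun h => hzU (hCU h)] with w hw using hz w hw

theorem fderiv_apply_comp_comm {Ψ : Plane → Plane} {z : Plane} (hΨ : ContDiffAt ℝ ∞ Ψ z)
    (v w : Plane) (j : Fin 2) :
    fderiv ℝ (fun z => fderiv ℝ Ψ z v j) z w = fderiv ℝ (fun z => fderiv ℝ Ψ z w j) z v := by
  have hd : DifferentiableAt ℝ (fderiv ℝ Ψ) z :=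
    (hΨ.fderiv_right (m := ∞) (by simp)).differentiableAt (by simp)
  have hs : IsSymmSndFDerivAt ℝ Ψ z := hΨ.isSymmSndFDerivAt (by
    rw [minSmoothness_of_isRCLikeNormedField]
    exact ENat.LEInfty.out)
  have h1 : ∀ v w : Plane, fderiv ℝ (fun z => fderiv ℝ Ψ z v j) z w =
      (fderiv ℝ (fderiv ℝ Ψ) z w v) j := by
    intro v w
    have e1 : HasFDerivAt (fun z => fderiv ℝ Ψ z v) ((fderiv ℝ (fderiv ℝ Ψ) z).flip v) z := by
      have := hd.hasFDerivAt.clm_apply (hasFDerivAt_const v z)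
      simpa using this
    have e2 : HasFDerivAt (fun z => fderiv ℝ Ψ z v j)
        ((EuclideanSpace.proj j : Plane →L[ℝ] ℝ).comp ((fderiv ℝ (fderiv ℝ Ψ) z).flip v)) z :=
      (EuclideanSpace.proj j : Plane →L[ℝ] ℝ).hasFDerivAt.comp z e1
    rw [e2.fderiv]
    rfl
  rw [h1, h1, hs w v]

section Diffeo

variable {e : OpenPartialHomeomorph Plane Plane}

theorem fderiv_comp_fderiv_symm (he : ContDiffOn ℝ ∞ e e.source)
    (he' : ContDiffOn ℝ ∞ e.symm e.target) {z : Plane} (hz : z ∈ e.target) (v : Plane) :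
    fderiv ℝ e.symm z (fderiv ℝ e (e.symm z) v) = v := by
  have hs := e.map_target hz
  have h1 : HasFDerivAt e (fderiv ℝ e (e.symm z)) (e.symm z) :=
    ((he.contDiffAt (e.open_source.mem_nhds hs)).differentiableAt (by simp)).hasFDerivAt
  have h2 : HasFDerivAt e.symm (fderiv ℝ e.symm z) (e (e.symm z)) := by
    rw [e.right_inv hz]
    exact ((he'.contDiffAt (e.open_target.mem_nhds hz)).differentiableAt (by simp)).hasFDerivAt
  have h3 := h2.comp _ h1
  have h4 : HasFDerivAt (e.symm ∘ e) (ContinuousLinearMap.id ℝ Plane) (e.symm z) := by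
    refine (hasFDerivAt_id _).congr_of_eventuallyEq ?_
    filter_upwards [e.open_source.mem_nhds hs] with y hy using e.left_inv hy
  exact congrArg (fun A : Plane →L[ℝ] Plane => A v) (h3.unique h4)

theorem setIntegral_source_eq (he' : ContDiffOn ℝ ∞ e.symm e.target) (G : Plane → ℝ) :
    ∫ y in e.source, G y = ∫ z in e.target, |(fderiv ℝ e.symm z).det| * G (e.symm z) := by
  rw [← e.symm_image_target_eq_source, integral_image_eq_integral_abs_det_fderiv_smul volume
    e.open_target.measurableSet
    (fun z hz => ((he'.contDiffAt (e.open_target.mem_nhds hz)).differentiableAt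
      (by simp)).hasFDerivAt.hasFDerivWithinAt) e.symm.injOn]
  rfl

theorem integrableOn_comp_diffeo (he : ContDiffOn ℝ ∞ e e.source)
    (he' : ContDiffOn ℝ ∞ e.symm e.target) {κ : Plane → ℝ}
    (hκ : ∀ C : Set Plane, IsCompact C → C ⊆ e.target → IntegrableOn κ C) (C : Set Plane)
    (hC : IsCompact C) (hCs : C ⊆ e.source) : IntegrableOn (fun y => κ (e y)) C := by
  have hd : ∀ y ∈ C, HasFDerivAt e (fderiv ℝ e y) y := fun y hy =>
    ((he.contDiffAt (e.open_source.mem_nhds (hCs hy))).differentiableAt (by simp)).hasFDerivAt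
  have h1 : IntegrableOn κ (e '' C) := hκ _ (hC.image_of_continuousOn (e.continuousOn.mono hCs))
    (by rintro _ ⟨y, hy, rfl⟩; exact e.map_source (hCs hy))
  rw [integrableOn_image_iff_integrableOn_abs_det_fderiv_smul volume hC.measurableSet
    (fun y hy => (hd y hy).hasFDerivWithinAt) (e.injOn.mono hCs)] at h1
  have hdet : ∀ y ∈ C, (fderiv ℝ e y).det ≠ 0 := by
    intro y hy h0
    have hz : e y ∈ e.target := e.map_source (hCs hy)
    have hinv : ∀ v, fderiv ℝ e.symm (e y) (fderiv ℝ e y v) = v := by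
      intro v
      have := fderiv_comp_fderiv_symm he he' hz v
      rwa [e.left_inv (hCs hy)] at this
    have hc : (fderiv ℝ e.symm (e y)).comp (fderiv ℝ e y) = ContinuousLinearMap.id ℝ Plane := by
      ext1 v
      exact hinv v
    have hdd := congrArg ContinuousLinearMap.det hc
    have : (fderiv ℝ e.symm (e y)).det * (fderiv ℝ e y).det = 1 := by
      rw [ContinuousLinearMap.det, ContinuousLinearMap.det, ← LinearMap.det_comp]
      have h5 : LinearMap.det ((fderiv ℝ e.symm (e y)).comp (fderiv ℝ e y)).toLinearMap =
        LinearMap.det (ContinuousLinearMap.id ℝ Plane).toLinearMap := hdd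
      rw [ContinuousLinearMap.coe_id, LinearMap.det_id] at h5
      exact h5
    rw [h0, mul_zero] at this
    exact zero_ne_one this
  have hcont : ContinuousOn (fun y => |(fderiv ℝ e y).det|⁻¹) C := by
    refine ContinuousOn.inv₀ ?_ fun y hy => abs_ne_zero.2 (hdet y hy)
    refine continuous_abs.comp_continuousOn ?_
    refine ContinuousLinearMap.continuous_det.comp_continuousOn ?_
    exact (he.continuousOn_fderiv_of_isOpen e.open_source (by simp)).mono hCs
  refine (h1.continuousOn_mul hcont hC).congr_fun (fun y hy => ?_) hC.measurableSet
  simp only [smul_eq_mul]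
  rw [← mul_assoc, inv_mul_cancel₀ (abs_ne_zero.2 (hdet y hy)), one_mul]

/-- The chain rule for weak gradients. The sign `s` of the Jacobian is assumed constant. The proof
moves the derivatives to the test function by the identity
`det DΨ · (∂_i φ) ∘ Ψ = ± d(φ ∘ Ψ) ∧ dΨ_{1-i}`, `Ψ = e⁻¹`. -/
theorem WeakGrad.comp_diffeo {p : ℝ≥0∞} (hp : 1 ≤ p) (he : ContDiffOn ℝ ∞ e e.source)
    (he' : ContDiffOn ℝ ∞ e.symm e.target) {s : ℝ}
    (hs : ∀ z ∈ e.target, |(fderiv ℝ e.symm z).det| = s * (fderiv ℝ e.symm z).det)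
    {κ : Plane → ℝ} {G : Fin 2 → Plane → ℝ} (hκ : WeakGrad p e.target κ G) :
    WeakGrad 1 e.source (fun y => κ (e y))
      (fun i y => ∑ j, fderiv ℝ e y (stdVec i) j * G j (e y)) := by
  refine WeakGrad.of_parts
    (fun C hC hCs => memLp_one_iff_integrable.2
      (integrableOn_comp_diffeo he he' (hκ.integrableOn hp) C hC hCs))
    (fun C hC hCs i => ?_) (fun φ hφ hφs hφe i => ?_)
  · refine memLp_one_iff_integrable.2 (integrable_finsetSum _ fun j _ => ?_)
    refine (integrableOn_comp_diffeo he he' (hκ.integrableOn_grad hp j) C hC hCs).continuousOn_mul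
      ?_ hC
    have h1 := (he.continuousOn_fderiv_of_isOpen e.open_source (by simp)).mono hCs
    exact (EuclideanSpace.proj j : Plane →L[ℝ] ℝ).continuous.comp_continuousOn
      (h1.clm_apply continuousOn_const)
  set i' : Fin 2 := 1 - i with hi'
  set σ : ℝ := if i = 0 then 1 else -1 with hσ
  set C := e '' tsupport φ with hCdef
  have hC : IsCompact C := hφs.isCompact.image_of_continuousOn (e.continuousOn.mono hφe)
  have hCt : C ⊆ e.target := by
    rintro _ ⟨y, hy, rfl⟩
    exact e.map_source (hφe hy)
  set w : Fin 2 → Plane → ℝ := fun j z => fderiv ℝ e.symm z (stdVec (1 - j)) i' with hw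
  set a : Fin 2 → Plane → ℝ := fun j z => φ (e.symm z) * w j z with ha
  have hws : ∀ j, ContDiffOn ℝ ∞ (w j) e.target := fun j =>
    (EuclideanSpace.proj i' : Plane →L[ℝ] ℝ).contDiff.comp_contDiffOn
      ((he'.fderiv_of_isOpen e.open_target (by simp)).clm_apply contDiffOn_const)
  have has : ∀ j, ContDiffOn ℝ ∞ (a j) e.target := fun j => (hφ.comp_contDiffOn he').mul (hws j)
  have ha0 : ∀ j, ∀ z ∈ e.target, z ∉ C → a j z = 0 := by
    intro j z hz hzC
    have : φ (e.symm z) = 0 := by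
      by_contra h
      exact hzC ⟨e.symm z, subset_tsupport φ h, e.right_inv hz⟩
    simp [ha, this]
  have hθ := fun j => contDiff_indicator_of_compact e.open_target hC hCt (has j) (ha0 j)
  set θ : Fin 2 → Plane → ℝ := fun j => e.target.indicator (a j) with hθdef
  -- pointwise identities on the target
  have key1 : ∀ z ∈ e.target, (fderiv ℝ e.symm z).det * fderiv ℝ φ (e.symm z) (stdVec i) =
      σ * (fderiv ℝ (θ 0) z (stdVec 0) - fderiv ℝ (θ 1) z (stdVec 1)) := by
    intro z hz
    have hzn := e.open_target.mem_nhds hz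
    have hΨ : ContDiffAt ℝ ∞ e.symm z := he'.contDiffAt hzn
    have hdθ : ∀ j v, fderiv ℝ (θ j) z v = φ (e.symm z) * fderiv ℝ (w j) z v +
        fderiv ℝ φ (e.symm z) (fderiv ℝ e.symm z v) * w j z := by
      intro j v
      have e1 : θ j =ᶠ[𝓝 z] a j := by
        filter_upwards [hzn] with y hy using indicator_of_mem hy _
      have d1 : HasFDerivAt (fun z => φ (e.symm z))
          ((fderiv ℝ φ (e.symm z)).comp (fderiv ℝ e.symm z)) z :=
        (hφ.differentiable (by simp) _).hasFDerivAt.comp z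
          (hΨ.differentiableAt (by simp)).hasFDerivAt
      have d2 : HasFDerivAt (w j) (fderiv ℝ (w j) z) z :=
        (((hws j).contDiffAt hzn).differentiableAt (by simp)).hasFDerivAt
      have d3 : HasFDerivAt (a j) _ z := d1.mul d2
      rw [e1.fderiv_eq, d3.fderiv]
      simp [mul_comm]
    have hcomm : fderiv ℝ (w 0) z (stdVec 0) = fderiv ℝ (w 1) z (stdVec 1) :=
      fderiv_apply_comp_comm hΨ (stdVec 1) (stdVec 0) i'
    rw [hdθ, hdθ, hcomm, det_plane]
    have hexp : ∀ v, fderiv ℝ φ (e.symm z) v = v 0 * fderiv ℝ φ (e.symm z) (stdVec 0) +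
        v 1 * fderiv ℝ φ (e.symm z) (stdVec 1) := by
      intro v
      conv_lhs => rw [plane_eq_sum v]
      simp
    rw [hexp (fderiv ℝ e.symm z (stdVec 0)), hexp (fderiv ℝ e.symm z (stdVec 1))]
    fin_cases i <;> simp [hσ, hw, hi'] <;> ring
  have key2 : ∀ z ∈ e.target, (fderiv ℝ e.symm z).det *
      ((∑ j, fderiv ℝ e (e.symm z) (stdVec i) j * G j z) * φ (e.symm z)) =
      σ * (G 0 z * θ 0 z - G 1 z * θ 1 z) := by
    intro z hz
    have hinv := fderiv_comp_fderiv_symm he he' hz (stdVec i)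
    set b := fderiv ℝ e (e.symm z) (stdVec i) with hb
    rw [plane_eq_sum b, map_add, map_smul, map_smul] at hinv
    have c0 : b 0 * fderiv ℝ e.symm z (stdVec 0) 0 + b 1 * fderiv ℝ e.symm z (stdVec 1) 0 =
        if i = 0 then 1 else 0 := by
      have := congrArg (fun v : Plane => v 0) hinv
      fin_cases i <;> simpa using this
    have c1 : b 0 * fderiv ℝ e.symm z (stdVec 0) 1 + b 1 * fderiv ℝ e.symm z (stdVec 1) 1 =
        if i = 0 then 0 else 1 := by
      have := congrArg (fun v : Plane => v 1) hinv
      fin_cases i <;> simpa using this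
    rw [Fin.sum_univ_two, det_plane]
    simp only [hθdef, indicator_of_mem hz, ha, hw, hσ, hi']
    clear_value b
    generalize hA : fderiv ℝ e.symm z = A at c0 c1 ⊢
    have hcoef := fun (d0 d1 : ℝ) (c0 : b 0 * A (stdVec 0) 0 + b 1 * A (stdVec 1) 0 = d0)
      (c1 : b 0 * A (stdVec 0) 1 + b 1 * A (stdVec 1) 1 = d1) =>
      show (A (stdVec 0) 0 * A (stdVec 1) 1 - A (stdVec 1) 0 * A (stdVec 0) 1) *
          ((b 0 * G 0 z + b 1 * G 1 z) * φ (e.symm z)) =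
          φ (e.symm z) * (G 0 z * (A (stdVec 1) 1 * d0 - A (stdVec 1) 0 * d1) +
            G 1 z * (A (stdVec 0) 0 * d1 - A (stdVec 0) 1 * d0)) by
        rw [← c0, ← c1]
        ring
    rw [hcoef _ _ c0 c1]
    fin_cases i <;> simp <;> ring
  have hm := e.open_target.measurableSet
  have tsub := fun j k => (tsupport_fderiv_apply_subset (θ j) (stdVec k)).trans (hθ j).2.2
  have I1 : ∫ y, κ (e y) * fderiv ℝ φ y (stdVec i) =
      s * σ * ((∫ z, κ z * fderiv ℝ (θ 0) z (stdVec 0)) -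
        ∫ z, κ z * fderiv ℝ (θ 1) z (stdVec 1)) := by
    rw [← setIntegral_mul_of_tsupport_subset (fun y => κ (e y))
      ((tsupport_fderiv_apply_subset φ (stdVec i)).trans hφe), setIntegral_source_eq he',
      ← integral_sub
        (integrable_mul_of_tsupport_subset (hκ.integrableOn hp)
          (continuous_fderiv_apply_const (hθ 0).1 _)
          (hasCompactSupport_fderiv_apply_const (hθ 0).2.1 _) (tsub 0 0))
        (integrable_mul_of_tsupport_subset (hκ.integrableOn hp)
          (continuous_fderiv_apply_const (hθ 1).1 _)
          (hasCompactSupport_fderiv_apply_const (hθ 1).2.1 _) (tsub 1 1)),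
      ← integral_const_mul]
    refine Eq.trans ?_ (setIntegral_eq_integral_of_forall_compl_eq_zero (s := e.target) ?_)
    · refine setIntegral_congr_fun hm fun z hz => ?_
      rw [hs z hz, e.right_inv hz]
      linear_combination (s * κ z) * key1 z hz
    · intro z hz
      rw [image_eq_zero_of_notMem_tsupport (f := fun y => fderiv ℝ (θ 0) y (stdVec 0))
        fun h => hz (tsub 0 0 h), image_eq_zero_of_notMem_tsupport
        (f := fun y => fderiv ℝ (θ 1) y (stdVec 1)) fun h => hz (tsub 1 1 h)]
      simp
  have I2 : ∫ y, (∑ j, fderiv ℝ e y (stdVec i) j * G j (e y)) * φ y =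
      s * σ * ((∫ z, G 0 z * θ 0 z) - ∫ z, G 1 z * θ 1 z) := by
    rw [← setIntegral_mul_of_tsupport_subset _ hφe, setIntegral_source_eq he',
      ← integral_sub
        (integrable_mul_of_tsupport_subset (hκ.integrableOn_grad hp 0)
          (hθ 0).1.continuous (hθ 0).2.1 (hθ 0).2.2)
        (integrable_mul_of_tsupport_subset (hκ.integrableOn_grad hp 1)
          (hθ 1).1.continuous (hθ 1).2.1 (hθ 1).2.2),
      ← integral_const_mul]
    refine Eq.trans ?_ (setIntegral_eq_integral_of_forall_compl_eq_zero (s := e.target) ?_)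
    · refine setIntegral_congr_fun hm fun z hz => ?_
      simp only
      rw [hs z hz, e.right_inv hz]
      linear_combination s * key2 z hz
    · intro z hz
      simp [indicator_of_notMem hz]
  rw [I1, I2, hκ.parts' (hθ 0).1 (hθ 0).2.1 (hθ 0).2.2, hκ.parts' (hθ 1).1 (hθ 1).2.1 (hθ 1).2.2]
  ring

end Diffeo

/-! ### Real powers of endomorphisms and their traces -/

section Powers

variable {V : Type*} [AddCommGroup V] [Module ℝ V] [Module.Finite ℝ V]

/-- The interpolation polynomial defining `powEnd` takes the value `t ^ a` at an eigenvalue `t`. -/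
theorem eval_interpolate_of_eigen (a : ℝ) (T : V →ₗ[ℝ] V) {t : ℝ} {w : V} (hw : w ≠ 0)
    (h : T w = t • w) :
    (Lagrange.interpolate T.charpoly.roots.toFinset id fun t : ℝ => t ^ a).eval t = t ^ a := by
  have hev : Module.End.HasEigenvalue T t :=
    Module.End.hasEigenvalue_of_hasEigenvector ⟨Module.End.mem_eigenspace_iff.2 h, hw⟩
  have hroot : t ∈ T.charpoly.roots.toFinset := by
    rw [Multiset.mem_toFinset, Polynomial.mem_roots (LinearMap.charpoly_monic T).ne_zero]
    exact (Module.End.hasEigenvalue_iff_isRoot_charpoly T t).1 hev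
  exact Lagrange.eval_interpolate_at_node (v := id) (fun t : ℝ => t ^ a)
    (Function.injective_id.injOn) hroot

theorem powEnd_apply_of_eigen (a : ℝ) (T : V →ₗ[ℝ] V) {t : ℝ} {w : V} (h : T w = t • w) :
    powEnd a T w = t ^ a • w := by
  by_cases hw : w = 0
  · simp [hw]
  have he : Module.End.HasEigenvector T t w := ⟨Module.End.mem_eigenspace_iff.2 h, hw⟩
  rw [powEnd, Module.End.aeval_apply_of_hasEigenvector he, eval_interpolate_of_eigen a T hw h]

/-- For `a ≠ 0`, the power `T^a` is divisible by `T`. -/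
theorem exists_mul_eq_powEnd {a : ℝ} (ha : a ≠ 0) (T : V →ₗ[ℝ] V) :
    ∃ S : V →ₗ[ℝ] V, T ∘ₗ S = powEnd a T ∧ S ∘ₗ T = powEnd a T := by
  set r := Lagrange.interpolate T.charpoly.roots.toFinset id fun t : ℝ => t ^ a with hr
  have hcomm : T ∘ₗ powEnd a T = powEnd a T ∘ₗ T := by
    have h1 : T * Polynomial.aeval T r = Polynomial.aeval T r * T := by
      have e1 : T * Polynomial.aeval T r = Polynomial.aeval T (Polynomial.X * r) := by simp
      have e2 : Polynomial.aeval T r * T = Polynomial.aeval T (r * Polynomial.X) := by simp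
      rw [e1, e2, mul_comm]
    exact h1
  by_cases hT : Function.Injective T
  · set T' := LinearEquiv.ofInjectiveEndo T hT with hT'
    have hT1 : ∀ v, T (T'.symm v) = v := fun v => T'.apply_symm_apply v
    have hT2 : ∀ v, T'.symm (T v) = v := fun v => T'.symm_apply_apply v
    refine ⟨T'.symm.toLinearMap ∘ₗ powEnd a T, ?_, ?_⟩
    · ext v
      exact hT1 _
    · ext v
      have := congrArg (fun L : V →ₗ[ℝ] V => L v) hcomm
      simp only [LinearMap.comp_apply] at this
      simp only [LinearMap.comp_apply, LinearEquiv.coe_coe]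
      rw [← this, hT2]
  · rw [injective_iff_map_eq_zero] at hT
    push Not at hT
    obtain ⟨w, hw, hw0⟩ := hT
    have h0 : r.eval 0 = 0 := by
      rw [hr, eval_interpolate_of_eigen a T hw0 (t := 0) (by rw [hw, zero_smul]),
        Real.zero_rpow ha]
    have hdiv : Polynomial.X * r.divX = r := by
      have := Polynomial.X_mul_divX_add r
      rw [Polynomial.coeff_zero_eq_eval_zero, h0, Polynomial.C_0, add_zero] at this
      exact this
    refine ⟨Polynomial.aeval T r.divX, ?_, ?_⟩
    · have : T * Polynomial.aeval T r.divX = Polynomial.aeval T (Polynomial.X * r.divX) := by simp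
      rw [hdiv] at this
      exact this
    · have : Polynomial.aeval T r.divX * T = Polynomial.aeval T (r.divX * Polynomial.X) := by simp
      rw [mul_comm r.divX, hdiv] at this
      exact this

/-- If `T = ∑ B(w_i, ·) w_i` with `w_0 ⊥ w_1`, then `w_i` is an eigenvector of `T` with eigenvalue
`B(w_i, w_i)`. Writing `T ^ a = T S` shows that only these two vectors contribute to its trace. -/
theorem trace_powEnd_of_orthogonal (B : LinearMap.BilinForm ℝ V) (T : V →ₗ[ℝ] V) (w : Fin 2 → V)
    (hT : ∀ v, T v = ∑ i, B (w i) v • w i) (h01 : B (w 0) (w 1) = 0) (h10 : B (w 1) (w 0) = 0)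
    (hdef : ∀ i, B (w i) (w i) = 0 → w i = 0) {a : ℝ} (ha : a ≠ 0) :
    LinearMap.trace ℝ V (powEnd a T) = ∑ i, B (w i) (w i) ^ a := by
  obtain ⟨S, hS1, hS2⟩ := exists_mul_eq_powEnd ha T
  have heig : ∀ i, T (w i) = B (w i) (w i) • w i := by
    intro i
    rw [hT]
    fin_cases i <;> simp [h01, h10]
  have hTS : powEnd a T = ∑ i, (B (w i) ∘ₗ S).smulRight (w i) := by
    rw [← hS1]
    ext v
    simp [hT]
  rw [hTS, map_sum]
  refine Finset.sum_congr rfl fun i _ => ?_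
  rw [LinearMap.trace_smulRight, LinearMap.comp_apply]
  by_cases h0 : B (w i) (w i) = 0
  · rw [hdef i h0]
    simp [Real.zero_rpow ha]
  · have hw : w i = (B (w i) (w i))⁻¹ • T (w i) := by
      rw [heig, smul_smul, inv_mul_cancel₀ h0, one_smul]
    have hSw : S (w i) = ((B (w i) (w i))⁻¹ * B (w i) (w i) ^ a) • w i := by
      conv_lhs => rw [hw]
      rw [map_smul, ← LinearMap.comp_apply, hS2, powEnd_apply_of_eigen a T (heig i), smul_smul]
    rw [hSw, map_smul, smul_eq_mul]
    field_simp

end Powers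

/-! ### Frames of a tangent plane -/

section Frames

variable {M : Type*} [TopologicalSpace M] [ChartedSpace Plane M]

/-- The coordinates of a tangent vector in the basis `tanVec x`. -/
def tanCoord (x : M) (v : TangentSpace (𝓡 2) x) (i : Fin 2) : ℝ := (show Plane from v) i

theorem tangent_eq_sum (x : M) (v : TangentSpace (𝓡 2) x) :
    v = tanCoord x v 0 • tanVec x 0 + tanCoord x v 1 • tanVec x 1 :=
  plane_eq_sum (show Plane from v)

variable [IsManifold (𝓡 2) ∞ M]

/-- The Gram matrix of a pair of tangent vectors. -/
def gram (g : Metric M) (x : M) (b : Fin 2 → TangentSpace (𝓡 2) x) : Matrix (Fin 2) (Fin 2) ℝ :=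
  Matrix.of fun i j => g.inner x (b i) (b j)

theorem gram_eq_mul (g : Metric M) (x : M) (b : Fin 2 → TangentSpace (𝓡 2) x) :
    gram g x b = (Matrix.of fun i => tanCoord x (b i)) * gram g x (tanVec x) *
      (Matrix.of fun i => tanCoord x (b i)).transpose := by
  ext i j
  simp only [gram, Matrix.of_apply, Matrix.mul_apply, Fin.sum_univ_two, Matrix.transpose_apply]
  conv_lhs => rw [tangent_eq_sum x (b i), tangent_eq_sum x (b j)]
  simp only [map_add, map_smul, _root_.add_apply, _root_.smul_apply, smul_eq_mul]
  ring

/-- Contraction with the inverse metric can be computed in any basis. -/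
theorem sum_gInv_smul (g : Metric M) (x : M) (b : Fin 2 → TangentSpace (𝓡 2) x)
    (hb : (gram g x b).det ≠ 0) {E : Type*} [AddCommGroup E] [Module ℝ E]
    (β : TangentSpace (𝓡 2) x →ₗ[ℝ] TangentSpace (𝓡 2) x →ₗ[ℝ] E) :
    ∑ i, ∑ j, gInv g x i j • β (tanVec x i) (tanVec x j) =
      ∑ i, ∑ j, (gram g x b)⁻¹ i j • β (b i) (b j) := by
  set m : Matrix (Fin 2) (Fin 2) ℝ := Matrix.of fun i => tanCoord x (b i) with hm
  set G : Matrix (Fin 2) (Fin 2) ℝ := gram g x (tanVec x) with hG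
  have hbm : ∀ i, b i = m i 0 • tanVec x 0 + m i 1 • tanVec x 1 := fun i => tangent_eq_sum x (b i)
  have hgram : gram g x b = m * G * m.transpose := gram_eq_mul g x b
  have hdet : m.det ≠ 0 := by
    intro h
    apply hb
    rw [hgram, Matrix.det_mul, Matrix.det_mul, h, zero_mul, zero_mul]
  have hu : IsUnit m.det := isUnit_iff_ne_zero.2 hdet
  have hinv : gInv g x = m.transpose * (gram g x b)⁻¹ * m := by
    have hut : IsUnit m.transpose.det := by rwa [Matrix.det_transpose]
    rw [hgram, Matrix.mul_inv_rev, Matrix.mul_inv_rev, ← Matrix.mul_assoc, ← Matrix.mul_assoc,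
      Matrix.mul_nonsing_inv _ hut, Matrix.one_mul, Matrix.nonsing_inv_mul_cancel_right _ _ hu]
    rfl
  rw [hinv]
  simp only [Fin.sum_univ_two, Matrix.mul_apply, Matrix.transpose_apply, hbm 0, hbm 1, map_add,
    map_smul, LinearMap.add_apply, LinearMap.smul_apply]
  module

variable {g : Metric M} (o : SurfaceOrientation g) {x : M}

theorem inner_rot_left (v w : TangentSpace (𝓡 2) x) :
    g.inner x (o.rot x v) w = -g.inner x v (o.rot x w) := by
  have := o.inner_rot x v (o.rot x w)
  rw [o.rot_rot, map_neg] at this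
  linarith

theorem inner_self_rot (v : TangentSpace (𝓡 2) x) : g.inner x v (o.rot x v) = 0 := by
  have h1 := inner_rot_left o v v
  rw [g.symm] at h1
  linarith

theorem exists_unit (g : Metric M) (x : M) :
    ∃ v : TangentSpace (𝓡 2) x, g.inner x v v = 1 := by
  have hne : tanVec x 0 ≠ 0 := by
    intro h
    have h1 : (stdVec 0 : Plane) 0 = 0 := congrArg (fun w : Plane => w 0) h
    simp at h1
  have hpos := g.pos x _ hne
  refine ⟨(Real.sqrt (g.inner x (tanVec x 0) (tanVec x 0)))⁻¹ • tanVec x 0, ?_⟩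
  simp only [map_smul, _root_.smul_apply, smul_eq_mul]
  rw [← mul_assoc, ← mul_inv, Real.mul_self_sqrt hpos.le, inv_mul_cancel₀ hpos.ne']

/-- The frame `(v, rot v)`. -/
def rotFrame (v : TangentSpace (𝓡 2) x) : Fin 2 → TangentSpace (𝓡 2) x := ![v, o.rot x v]

theorem gram_rotFrame {v : TangentSpace (𝓡 2) x} (hv : g.inner x v v = 1) :
    gram g x (rotFrame o v) = 1 := by
  ext i j
  fin_cases i <;> fin_cases j <;>
    simp [gram, rotFrame, hv, inner_self_rot, o.inner_rot, g.symm x (o.rot x v) v]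

theorem sum_gInv_smul_frame {v : TangentSpace (𝓡 2) x} (hv : g.inner x v v = 1) {E : Type*}
    [AddCommGroup E] [Module ℝ E]
    (β : TangentSpace (𝓡 2) x →ₗ[ℝ] TangentSpace (𝓡 2) x →ₗ[ℝ] E) :
    ∑ i, ∑ j, gInv g x i j • β (tanVec x i) (tanVec x j) =
      β v v + β (o.rot x v) (o.rot x v) := by
  rw [sum_gInv_smul g x (rotFrame o v) (by rw [gram_rotFrame o hv]; simp), gram_rotFrame o hv]
  simp [Fin.sum_univ_two, rotFrame]

theorem det_gram_tanVec_ne_zero (o : SurfaceOrientation g) : (gram g x (tanVec x)).det ≠ 0 := by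
  obtain ⟨v, hv⟩ := exists_unit g x
  intro h
  have h1 := gram_eq_mul g x (rotFrame o v)
  rw [gram_rotFrame o hv] at h1
  have h2 := congrArg Matrix.det h1
  rw [Matrix.det_mul, Matrix.det_mul, h] at h2
  simp at h2

/-- Coordinates with respect to the frame `(v, rot v)`. -/
theorem eq_frame {v : TangentSpace (𝓡 2) x} (hv : g.inner x v v = 1) (w : TangentSpace (𝓡 2) x) :
    w = g.inner x v w • v + g.inner x (o.rot x v) w • o.rot x v := by
  have e := sum_gInv_smul_frame o hv
    (LinearMap.lsmul ℝ (TangentSpace (𝓡 2) x) ∘ₗ (g.inner x w).toLinearMap)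
  simp only [LinearMap.comp_apply, ContinuousLinearMap.coe_coe, LinearMap.lsmul_apply,
    Fin.sum_univ_two] at e
  have hG : gram g x (tanVec x) * gInv g x = 1 :=
    Matrix.mul_nonsing_inv _ (isUnit_iff_ne_zero.2 (det_gram_tanVec_ne_zero o))
  have hGij : ∀ i j, g.inner x (tanVec x i) (tanVec x 0) * gInv g x 0 j +
      g.inner x (tanVec x i) (tanVec x 1) * gInv g x 1 j = (1 : Matrix (Fin 2) (Fin 2) ℝ) i j := by
    intro i j
    rw [← hG, Matrix.mul_apply, Fin.sum_univ_two]
    rfl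
  rw [g.symm x v w, g.symm x (o.rot x v) w, ← e]
  have hw := tangent_eq_sum x w
  set c0 := tanCoord x w 0
  set c1 := tanCoord x w 1
  have hin : ∀ i, g.inner x w (tanVec x i) = c0 * g.inner x (tanVec x 0) (tanVec x i) +
      c1 * g.inner x (tanVec x 1) (tanVec x i) := by
    intro i
    conv_lhs => rw [hw]
    simp
  have h00 := hGij 0 0
  have h01 := hGij 0 1
  have h10 := hGij 1 0
  have h11 := hGij 1 1
  simp only [Matrix.one_apply, Fin.isValue, if_true, zero_ne_one, one_ne_zero, if_false] at *
  rw [hin, hin]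
  conv_lhs => rw [hw]
  match_scalars
  · linear_combination (-c0) * h00 - c1 * h10
  · linear_combination (-c0) * h01 - c1 * h11

end Frames

/-! ### Schatten norms of vector-valued covectors -/

section Schatten

variable {M : Type*} [TopologicalSpace M] [ChartedSpace Plane M] [IsManifold (𝓡 2) ∞ M]
  {V : Type*} [AddCommGroup V] [Module ℝ V] {g : Metric M} {x : M} {B : LinearMap.BilinForm ℝ V}

theorem pairing_basis (b : Fin 2 → TangentSpace (𝓡 2) x) (hb : (gram g x b).det ≠ 0)
    (A C : TangentSpace (𝓡 2) x →ₗ[ℝ] V) :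
    pairing g B x A C = ∑ i, ∑ j, (gram g x b)⁻¹ i j * B (A (b i)) (C (b j)) :=
  sum_gInv_smul g x b hb (B.compl₁₂ A C)

theorem pairing_frame (o : SurfaceOrientation g) {v : TangentSpace (𝓡 2) x}
    (hv : g.inner x v v = 1) (A C : TangentSpace (𝓡 2) x →ₗ[ℝ] V) :
    pairing g B x A C = B (A v) (C v) + B (A (o.rot x v)) (C (o.rot x v)) :=
  sum_gInv_smul_frame o hv (B.compl₁₂ A C)

theorem Qsq_frame (o : SurfaceOrientation g) {v : TangentSpace (𝓡 2) x}
    (hv : g.inner x v v = 1) (W : TangentSpace (𝓡 2) x →ₗ[ℝ] V) (z : V) :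
    Qsq g B x W z = B (W v) z • W v + B (W (o.rot x v)) z • W (o.rot x v) := by
  have e := sum_gInv_smul_frame o hv (LinearMap.mk₂ ℝ (fun a b => B (W b) z • W a)
    (fun a a' b => by rw [map_add, smul_add]) (fun c a b => by rw [map_smul, smul_comm])
    (fun a b b' => by rw [map_add, map_add, LinearMap.add_apply, add_smul])
    (fun c a b => by
      rw [map_smul, map_smul, LinearMap.smul_apply, smul_eq_mul, mul_smul]))
  simp only [LinearMap.mk₂_apply] at e
  rw [← e]
  simp [Qsq]

theorem pairing_add_left (A A' C : TangentSpace (𝓡 2) x →ₗ[ℝ] V) :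
    pairing g B x (A + A') C = pairing g B x A C + pairing g B x A' C := by
  simp only [pairing, LinearMap.add_apply, map_add, mul_add, Finset.sum_add_distrib]

theorem pairing_add_right (A C C' : TangentSpace (𝓡 2) x →ₗ[ℝ] V) :
    pairing g B x A (C + C') = pairing g B x A C + pairing g B x A C' := by
  simp only [pairing, LinearMap.add_apply, map_add, mul_add, Finset.sum_add_distrib]

theorem pairing_smul_left (c : ℝ) (A C : TangentSpace (𝓡 2) x →ₗ[ℝ] V) :
    pairing g B x (c • A) C = c * pairing g B x A C := by
  simp only [pairing, LinearMap.smul_apply, map_smul, smul_eq_mul, Finset.mul_sum]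
  exact Finset.sum_congr rfl fun i _ => Finset.sum_congr rfl fun j _ => by ring

theorem pairing_smul_right (c : ℝ) (A C : TangentSpace (𝓡 2) x →ₗ[ℝ] V) :
    pairing g B x A (c • C) = c * pairing g B x A C := by
  simp only [pairing, LinearMap.smul_apply, map_smul, smul_eq_mul, Finset.mul_sum]
  exact Finset.sum_congr rfl fun i _ => Finset.sum_congr rfl fun j _ => by ring

theorem pairing_neg_right (A C : TangentSpace (𝓡 2) x →ₗ[ℝ] V) :
    pairing g B x A (-C) = -pairing g B x A C := by
  rw [← neg_one_smul ℝ C, pairing_smul_right, neg_one_mul]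

theorem pairing_sub_right (A C C' : TangentSpace (𝓡 2) x →ₗ[ℝ] V) :
    pairing g B x A (C - C') = pairing g B x A C - pairing g B x A C' := by
  rw [sub_eq_add_neg, pairing_add_right, pairing_neg_right, sub_eq_add_neg]

/-- A unit vector `v` such that `W` maps the orthonormal frame `(v, rot v)` to orthogonal vectors:
the singular value decomposition of `W`. -/
structure IsDiagFrame (o : SurfaceOrientation g) (B : LinearMap.BilinForm ℝ V)
    (W : TangentSpace (𝓡 2) x →ₗ[ℝ] V) (v : TangentSpace (𝓡 2) x) : Prop where
  unit : g.inner x v v = 1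
  orth : B (W v) (W (o.rot x v)) = 0
  orth' : B (W (o.rot x v)) (W v) = 0

theorem exists_isDiagFrame (o : SurfaceOrientation g) (hB : ∀ v w, B v w = B w v)
    (W : TangentSpace (𝓡 2) x →ₗ[ℝ] V) : ∃ v, IsDiagFrame o B W v := by
  obtain ⟨e, he⟩ := exists_unit g x
  set f := o.rot x e with hf
  have hff : g.inner x f f = 1 := by rw [hf, o.inner_rot, he]
  have hef : g.inner x e f = 0 := inner_self_rot o e
  have hfe : g.inner x f e = 0 := by rw [g.symm]; exact hef
  have hrf : o.rot x f = -e := o.rot_rot x e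
  -- rotate by half the argument of `(B₀₀ - B₁₁) / 2 + i B₀₁`
  set z : ℂ := ⟨(B (W e) (W e) - B (W f) (W f)) / 2, B (W e) (W f)⟩ with hz
  set t := z.arg / 2 with ht
  have h2t : z.arg = 2 * t := by rw [ht]; ring
  have hc := Complex.norm_mul_cos_arg z
  have hs := Complex.norm_mul_sin_arg z
  rw [h2t, Real.cos_two_mul] at hc
  rw [h2t, Real.sin_two_mul] at hs
  have hcs := Real.sin_sq_add_cos_sq t
  set C := Real.cos t
  set S := Real.sin t
  have hre : z.re = (B (W e) (W e) - B (W f) (W f)) / 2 := rfl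
  have him : z.im = B (W e) (W f) := rfl
  rw [hre] at hc
  rw [him] at hs
  have hrot : o.rot x (C • e + S • f) = C • f - S • e := by
    rw [map_add, map_smul, map_smul, hrf, ← hf, smul_neg, ← sub_eq_add_neg]
  have key : B (W (C • e + S • f)) (W (o.rot x (C • e + S • f))) = 0 := by
    rw [hrot]
    simp only [map_add, map_sub, map_smul, LinearMap.add_apply, LinearMap.smul_apply, smul_eq_mul]
    rw [hB (W f) (W e)]
    linear_combination (2 * C * S) * hc - (2 * C ^ 2 - 1) * hs -
      B (W e) (W f) * hcs
  refine ⟨C • e + S • f, ?_, key, by rw [hB]; exact key⟩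
  simp only [map_add, map_smul, _root_.add_apply, _root_.smul_apply, smul_eq_mul, he, hff, hef, hfe]
  linear_combination hcs

/-- `B` is positive definite on the subspace `N`. -/
structure PosDefOn (B : LinearMap.BilinForm ℝ V) (N : Submodule ℝ V) : Prop where
  symm : ∀ v w, B v w = B w v
  nonneg : ∀ v ∈ N, 0 ≤ B v v
  definite : ∀ v ∈ N, B v v = 0 → v = 0

/-- A linear map on the tangent plane is determined by its values on a frame. -/
theorem ext_frame (o : SurfaceOrientation g) {v : TangentSpace (𝓡 2) x}
    (hv : g.inner x v v = 1) {A C : TangentSpace (𝓡 2) x →ₗ[ℝ] V} (h1 : A v = C v)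
    (h2 : A (o.rot x v) = C (o.rot x v)) : A = C := by
  ext z
  rw [eq_frame o hv z]
  simp only [map_add, map_smul, h1, h2]

theorem mem_of_frame (o : SurfaceOrientation g) {v : TangentSpace (𝓡 2) x}
    (hv : g.inner x v v = 1) {N : Submodule ℝ V}
    {A : TangentSpace (𝓡 2) x →ₗ[ℝ] V} (h1 : A v ∈ N)
    (h2 : A (o.rot x v) ∈ N) (z : TangentSpace (𝓡 2) x) : A z ∈ N := by
  rw [eq_frame o hv z, map_add, map_smul, map_smul]
  exact N.add_mem (N.smul_mem _ h1) (N.smul_mem _ h2)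

/-- The Hodge star at a point. -/
def starAt (o : SurfaceOrientation g) (W : TangentSpace (𝓡 2) x →ₗ[ℝ] V) :
    TangentSpace (𝓡 2) x →ₗ[ℝ] V := -(W ∘ₗ (o.rot x).toLinearMap)

theorem starAt_apply (o : SurfaceOrientation g) (W : TangentSpace (𝓡 2) x →ₗ[ℝ] V)
    (z : TangentSpace (𝓡 2) x) : starAt o W z = -W (o.rot x z) := rfl

theorem IsDiagFrame.starAt {o : SurfaceOrientation g} {W : TangentSpace (𝓡 2) x →ₗ[ℝ] V}
    {v : TangentSpace (𝓡 2) x} (h : IsDiagFrame o B W v) : IsDiagFrame o B (starAt o W) v :=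
  ⟨h.unit, by simp [starAt_apply, o.rot_rot, h.orth'], by simp [starAt_apply, o.rot_rot, h.orth]⟩

theorem IsDiagFrame.smul {o : SurfaceOrientation g} {W : TangentSpace (𝓡 2) x →ₗ[ℝ] V}
    {v : TangentSpace (𝓡 2) x} (h : IsDiagFrame o B W v) (c : ℝ) : IsDiagFrame o B (c • W) v :=
  ⟨h.unit, by simp [h.orth], by simp [h.orth']⟩

/-- Bessel's inequality for an orthogonal pair `y`, normalized: the cosines `c j` of the angles
between `a` and `y j` have square sum at most one. -/
theorem bessel_cosines {N : Submodule ℝ V} (hN : PosDefOn B N) {a : V} (ha : a ∈ N)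
    {y : Fin 2 → V} (hy : ∀ j, y j ∈ N)
    (h01 : B (y 0) (y 1) = 0) :
    ∑ j, (B a (y j) / (Real.sqrt (B a a) * Real.sqrt (B (y j) (y j)))) ^ 2 ≤ 1 := by
  have h10 : B (y 1) (y 0) = 0 := by rw [hN.symm]; exact h01
  have hτ := fun j => hN.nonneg _ (hy j)
  have hα := hN.nonneg _ ha
  have hz : a - (B a (y 0) / B (y 0) (y 0)) • y 0 - (B a (y 1) / B (y 1) (y 1)) • y 1 ∈ N :=
    N.sub_mem (N.sub_mem ha (N.smul_mem _ (hy 0))) (N.smul_mem _ (hy 1))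
  have h := hN.nonneg _ hz
  have hdiv : ∀ j, B a (y j) / B (y j) (y j) * B (y j) (y j) = B a (y j) := by
    intro j
    by_cases h0 : B (y j) (y j) = 0
    · rw [hN.definite _ (hy j) h0]
      simp
    · field_simp
  have hbes : B a (y 0) ^ 2 / B (y 0) (y 0) + B a (y 1) ^ 2 / B (y 1) (y 1) ≤ B a a := by
    simp only [map_sub, map_smul, LinearMap.sub_apply, LinearMap.smul_apply, smul_eq_mul, h01, h10,
      hN.symm (y 0) a, hN.symm (y 1) a] at h
    have d0 := hdiv 0
    have d1 := hdiv 1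
    have q0 : B a (y 0) ^ 2 / B (y 0) (y 0) = B a (y 0) / B (y 0) (y 0) * B a (y 0) := by ring
    have q1 : B a (y 1) ^ 2 / B (y 1) (y 1) = B a (y 1) / B (y 1) (y 1) * B a (y 1) := by ring
    simp only [mul_zero, sub_zero, d0, d1, sub_self] at h
    rw [q0, q1]
    linarith
  rw [Fin.sum_univ_two, div_pow, div_pow, mul_pow, mul_pow, Real.sq_sqrt hα, Real.sq_sqrt (hτ 0),
    Real.sq_sqrt (hτ 1)]
  by_cases h0 : B a a = 0
  · simp [h0]
  · have hpos : 0 < B a a := lt_of_le_of_ne hα (Ne.symm h0)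
    rw [mul_comm (B a a), mul_comm (B a a), ← div_div, ← div_div, ← add_div, div_le_one hpos]
    exact hbes

theorem eq_sqrt_mul_cosine {N : Submodule ℝ V} (hN : PosDefOn B N) {a y : V} (ha : a ∈ N)
    (hy : y ∈ N) :
    B a y = Real.sqrt (B a a) * Real.sqrt (B y y) *
      (B a y / (Real.sqrt (B a a) * Real.sqrt (B y y))) := by
  by_cases h0 : Real.sqrt (B a a) * Real.sqrt (B y y) = 0
  · rcases mul_eq_zero.1 h0 with h | h
    · rw [Real.sqrt_eq_zero (hN.nonneg _ ha)] at h
      rw [hN.definite _ ha h]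
      simp
    · rw [Real.sqrt_eq_zero (hN.nonneg _ hy)] at h
      rw [hN.definite _ hy h]
      simp
  · rw [mul_div_cancel₀ _ h0]

theorem abs_mul_sum_le_one {m c : Fin 2 → ℝ} (hm : m 0 ^ 2 + m 1 ^ 2 ≤ 1)
    (hc : c 0 ^ 2 + c 1 ^ 2 ≤ 1) : |m 0 * c 0| + |m 1 * c 1| ≤ 1 := by
  rw [abs_mul, abs_mul]
  nlinarith [sq_nonneg (|m 0| - |c 0|), sq_nonneg (|m 1| - |c 1|), sq_abs (m 0), sq_abs (c 0),
    sq_abs (m 1), sq_abs (c 1)]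

section Diag

variable [Module.Finite ℝ V] {o : SurfaceOrientation g} {N : Submodule ℝ V}
  {W : TangentSpace (𝓡 2) x →ₗ[ℝ] V} {v : TangentSpace (𝓡 2) x}

theorem IsDiagFrame.Qpow_apply (h : IsDiagFrame o B W v) (a : ℝ) :
    Qpow g B a x W (W v) = B (W v) (W v) ^ (a / 2) • W v :=
  powEnd_apply_of_eigen _ _ (by rw [Qsq_frame o h.unit, h.orth']; simp)

theorem IsDiagFrame.Qpow_apply_rot (h : IsDiagFrame o B W v) (a : ℝ) :
    Qpow g B a x W (W (o.rot x v)) =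
      B (W (o.rot x v)) (W (o.rot x v)) ^ (a / 2) • W (o.rot x v) :=
  powEnd_apply_of_eigen _ _ (by rw [Qsq_frame o h.unit, h.orth]; simp)

theorem IsDiagFrame.svPow_eq (h : IsDiagFrame o B W v) (hN : PosDefOn B N) (hW : ∀ z, W z ∈ N)
    {a : ℝ} (ha : a ≠ 0) : svPow g B a x W =
      B (W v) (W v) ^ (a / 2) + B (W (o.rot x v)) (W (o.rot x v)) ^ (a / 2) := by
  have := trace_powEnd_of_orthogonal B (Qsq g B x W) ![W v, W (o.rot x v)]
    (fun z => by rw [Qsq_frame o h.unit, Fin.sum_univ_two]; rfl) h.orth h.orth'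
    (fun i => by
      fin_cases i
      · exact hN.definite _ (hW _)
      · exact hN.definite _ (hW _)) (a := a / 2) (by simpa using ha)
  rw [Fin.sum_univ_two] at this
  exact this

theorem svPow_nonneg (o : SurfaceOrientation g) (hN : PosDefOn B N) (hW : ∀ z, W z ∈ N)
    {a : ℝ} (ha : a ≠ 0) : 0 ≤ svPow g B a x W := by
  obtain ⟨v, h⟩ := exists_isDiagFrame o hN.symm W
  rw [h.svPow_eq hN hW ha]
  exact add_nonneg (Real.rpow_nonneg (hN.nonneg _ (hW _)) _)
    (Real.rpow_nonneg (hN.nonneg _ (hW _)) _)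

theorem svPow_smul (o : SurfaceOrientation g) (hN : PosDefOn B N) (hW : ∀ z, W z ∈ N)
    {a : ℝ} (ha : a ≠ 0) {c : ℝ} (hc : 0 ≤ c) :
    svPow g B a x (c • W) = c ^ a * svPow g B a x W := by
  obtain ⟨v, h⟩ := exists_isDiagFrame o hN.symm W
  rw [h.svPow_eq hN hW ha, (h.smul c).svPow_eq hN (fun z => N.smul_mem c (hW z)) ha]
  have key : ∀ z, B ((c • W) z) ((c • W) z) ^ (a / 2) = c ^ a * B (W z) (W z) ^ (a / 2) := by
    intro z
    have e1 : B ((c • W) z) ((c • W) z) = c ^ (2 : ℝ) * B (W z) (W z) := by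
      simp only [LinearMap.smul_apply, map_smul, smul_eq_mul, Real.rpow_two]
      ring
    rw [e1, Real.mul_rpow (by positivity) (hN.nonneg _ (hW _)), ← Real.rpow_mul hc]
    congr 2
    ring
  rw [key, key, mul_add]

theorem svPow_neg (a : ℝ) : svPow g B a x (-W) = svPow g B a x W := by
  have : Qsq g B x (-W) = Qsq g B x W := by
    ext z
    simp [Qsq]
  rw [svPow, svPow, Qpow, Qpow, this]

/-- Young's inequality for Schatten norms. -/
theorem pairing_le_svPow (o : SurfaceOrientation g) (hN : PosDefOn B N) {p q : ℝ}
    (hpq : p.HolderConjugate q) {A Y : TangentSpace (𝓡 2) x →ₗ[ℝ] V} (hA : ∀ z, A z ∈ N)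
    (hY : ∀ z, Y z ∈ N) :
    pairing g B x A Y ≤ svPow g B p x A / p + svPow g B q x Y / q := by
  obtain ⟨v, hv⟩ := exists_isDiagFrame o hN.symm A
  obtain ⟨w, hw⟩ := exists_isDiagFrame o hN.symm Y
  rw [hv.svPow_eq hN hA hpq.pos.ne', hw.svPow_eq hN hY hpq.symm.pos.ne', pairing_frame o hv.unit]
  -- With `σ`, `τ` the singular values, `m` the cosines between the two frames of the tangent plane
  -- and `c` those between the values of `A` and `Y` on them, the pairing is
  -- `∑ σ i τ j (m i j c i j)`. Rows and columns of `m` and of `c` have square sum at most one, so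
  -- those of `|m i j c i j|` have sum at most one, and the scalar Young inequality for `σ i τ j` can
  -- be summed with these weights.
  set e : Fin 2 → TangentSpace (𝓡 2) x := ![v, o.rot x v] with he
  set f : Fin 2 → TangentSpace (𝓡 2) x := ![w, o.rot x w] with hf
  set m : Fin 2 → Fin 2 → ℝ := fun i j => g.inner x (e i) (f j) with hm
  set c : Fin 2 → Fin 2 → ℝ := fun i j => B (A (e i)) (Y (f j)) /
    (Real.sqrt (B (A (e i)) (A (e i))) * Real.sqrt (B (Y (f j)) (Y (f j)))) with hc
  set σ : Fin 2 → ℝ := fun i => Real.sqrt (B (A (e i)) (A (e i))) with hσ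
  set τ : Fin 2 → ℝ := fun j => Real.sqrt (B (Y (f j)) (Y (f j))) with hτ
  have hee : ∀ i, g.inner x (e i) (e i) = 1 := by
    intro i
    fin_cases i
    · exact hv.unit
    · exact (o.inner_rot x v v).trans hv.unit
  have hff : ∀ i, g.inner x (f i) (f i) = 1 := by
    intro i
    fin_cases i
    · exact hw.unit
    · exact (o.inner_rot x w w).trans hw.unit
  have hef : ∀ i, e i = m i 0 • f 0 + m i 1 • f 1 := by
    intro i
    have := eq_frame o hw.unit (e i)
    rwa [g.symm x w, g.symm x (o.rot x w)] at this
  have hfe : ∀ j, f j = m 0 j • e 0 + m 1 j • e 1 := fun j => eq_frame o hv.unit (f j)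
  have hmrow : ∀ i, m i 0 ^ 2 + m i 1 ^ 2 ≤ 1 := by
    intro i
    have h := hee i
    nth_rewrite 2 [hef i] at h
    rw [map_add, map_smul, map_smul, smul_eq_mul, smul_eq_mul] at h
    have h' : m i 0 * m i 0 + m i 1 * m i 1 = 1 := h
    nlinarith
  have hmcol : ∀ j, m 0 j ^ 2 + m 1 j ^ 2 ≤ 1 := by
    intro j
    have h := hff j
    nth_rewrite 1 [hfe j] at h
    rw [map_add, map_smul, map_smul, _root_.add_apply, _root_.smul_apply, _root_.smul_apply,
      smul_eq_mul, smul_eq_mul] at h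
    have h' : m 0 j * m 0 j + m 1 j * m 1 j = 1 := h
    nlinarith
  have hcrow : ∀ i, c i 0 ^ 2 + c i 1 ^ 2 ≤ 1 := by
    intro i
    have := bessel_cosines hN (hA (e i)) (y := fun j => Y (f j)) (fun j => hY _) hw.orth
    rwa [Fin.sum_univ_two] at this
  have hccol : ∀ j, c 0 j ^ 2 + c 1 j ^ 2 ≤ 1 := by
    intro j
    have := bessel_cosines hN (hY (f j)) (y := fun i => A (e i)) (fun j => hA _) hv.orth
    rw [Fin.sum_univ_two, hN.symm _ (A (e 0)), hN.symm _ (A (e 1)),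
      mul_comm (Real.sqrt (B (Y (f j)) (Y (f j)))), mul_comm (Real.sqrt (B (Y (f j)) (Y (f j))))]
      at this
    exact this
  have hBc : ∀ i j, B (A (e i)) (Y (f j)) = σ i * τ j * c i j := fun i j =>
    eq_sqrt_mul_cosine hN (hA _) (hY _)
  have hrow : ∀ i, |m i 0 * c i 0| + |m i 1 * c i 1| ≤ 1 := fun i =>
    abs_mul_sum_le_one (hmrow i) (hcrow i)
  have hcol : ∀ j, |m 0 j * c 0 j| + |m 1 j * c 1 j| ≤ 1 := fun j =>
    abs_mul_sum_le_one (m := fun i => m i j) (c := fun i => c i j) (hmcol j) (hccol j)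
  have hexp : ∀ i, B (A (e i)) (Y (e i)) =
      σ i * τ 0 * (m i 0 * c i 0) + σ i * τ 1 * (m i 1 * c i 1) := by
    intro i
    conv_lhs => rw [show Y (e i) = m i 0 • Y (f 0) + m i 1 • Y (f 1) by
      conv_lhs => rw [hef i]
      rw [map_add, map_smul, map_smul]]
    rw [map_add, map_smul, map_smul, smul_eq_mul, smul_eq_mul, hBc, hBc]
    ring
  have hσ0 : ∀ i, 0 ≤ σ i := fun i => Real.sqrt_nonneg _
  have hτ0 : ∀ i, 0 ≤ τ i := fun i => Real.sqrt_nonneg _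
  have hpow : ∀ (y a : ℝ), 0 ≤ y → y ^ (a / 2) = Real.sqrt y ^ a := by
    intro y a hy
    rw [Real.sqrt_eq_rpow, ← Real.rpow_mul hy]
    congr 1
    ring
  set P : Fin 2 → ℝ := fun i => σ i ^ p / p with hP
  set R : Fin 2 → ℝ := fun j => τ j ^ q / q with hR
  have hP0 : ∀ i, 0 ≤ P i := fun i => div_nonneg (Real.rpow_nonneg (hσ0 i) _) hpq.pos.le
  have hR0 : ∀ i, 0 ≤ R i := fun i => div_nonneg (Real.rpow_nonneg (hτ0 i) _) hpq.symm.pos.le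
  have hterm : ∀ i j, σ i * τ j * (m i j * c i j) ≤ (P i + R j) * |m i j * c i j| := by
    intro i j
    calc σ i * τ j * (m i j * c i j) ≤ σ i * τ j * |m i j * c i j| :=
          mul_le_mul_of_nonneg_left (le_abs_self _) (mul_nonneg (hσ0 i) (hτ0 j))
      _ ≤ _ := mul_le_mul_of_nonneg_right
          (Real.young_inequality_of_nonneg (hσ0 i) (hτ0 j) hpq) (abs_nonneg _)
  have e0 : B (A v) (Y v) = σ 0 * τ 0 * (m 0 0 * c 0 0) + σ 0 * τ 1 * (m 0 1 * c 0 1) := hexp 0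
  have e1 : B (A (o.rot x v)) (Y (o.rot x v)) =
      σ 1 * τ 0 * (m 1 0 * c 1 0) + σ 1 * τ 1 * (m 1 1 * c 1 1) := hexp 1
  have r0 : B (A v) (A v) ^ (p / 2) = σ 0 ^ p := hpow _ _ (hN.nonneg _ (hA _))
  have r1 : B (A (o.rot x v)) (A (o.rot x v)) ^ (p / 2) = σ 1 ^ p := hpow _ _ (hN.nonneg _ (hA _))
  have s0 : B (Y w) (Y w) ^ (q / 2) = τ 0 ^ q := hpow _ _ (hN.nonneg _ (hY _))
  have s1 : B (Y (o.rot x w)) (Y (o.rot x w)) ^ (q / 2) = τ 1 ^ q := hpow _ _ (hN.nonneg _ (hY _))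
  rw [e0, e1, r0, r1, s0, s1, add_div, add_div]
  change _ ≤ P 0 + P 1 + (R 0 + R 1)
  have t00 := hterm 0 0
  have t01 := hterm 0 1
  have t10 := hterm 1 0
  have t11 := hterm 1 1
  have u0 := mul_le_mul_of_nonneg_left (hrow 0) (hP0 0)
  have u1 := mul_le_mul_of_nonneg_left (hrow 1) (hP0 1)
  have w0 := mul_le_mul_of_nonneg_left (hcol 0) (hR0 0)
  have w1 := mul_le_mul_of_nonneg_left (hcol 1) (hR0 1)
  nlinarith

theorem abs_pairing_le_svPow (o : SurfaceOrientation g) (hN : PosDefOn B N) {p q : ℝ}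
    (hpq : p.HolderConjugate q) {A Y : TangentSpace (𝓡 2) x →ₗ[ℝ] V} (hA : ∀ z, A z ∈ N)
    (hY : ∀ z, Y z ∈ N) :
    |pairing g B x A Y| ≤ svPow g B p x A / p + svPow g B q x Y / q := by
  refine abs_le'.2 ⟨pairing_le_svPow o hN hpq hA hY, ?_⟩
  have := pairing_le_svPow o hN hpq hA (Y := -Y) (fun z => N.neg_mem (hY z))
  rwa [pairing_neg_right, svPow_neg] at this

/-- The covector `S_{p-1}(W) = Q(W)^{p-2} W` at a point. -/
def Spow (g : Metric M) (B : LinearMap.BilinForm ℝ V) (p : ℝ) (x : M)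
    (W : TangentSpace (𝓡 2) x →ₗ[ℝ] V) : TangentSpace (𝓡 2) x →ₗ[ℝ] V :=
  Qpow g B (p - 2) x W ∘ₗ W

theorem IsDiagFrame.Spow_apply (h : IsDiagFrame o B W v) (p : ℝ) :
    Spow g B p x W v = B (W v) (W v) ^ ((p - 2) / 2) • W v := h.Qpow_apply _

theorem IsDiagFrame.Spow_apply_rot (h : IsDiagFrame o B W v) (p : ℝ) :
    Spow g B p x W (o.rot x v) =
      B (W (o.rot x v)) (W (o.rot x v)) ^ ((p - 2) / 2) • W (o.rot x v) := h.Qpow_apply_rot _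

theorem IsDiagFrame.Spow (h : IsDiagFrame o B W v) (p : ℝ) :
    IsDiagFrame o B (Spow g B p x W) v :=
  ⟨h.unit, by simp [h.Spow_apply, h.Spow_apply_rot, h.orth],
    by simp [h.Spow_apply, h.Spow_apply_rot, h.orth']⟩

theorem Spow_mem (o : SurfaceOrientation g) (hN : PosDefOn B N) (hW : ∀ z, W z ∈ N) (p : ℝ)
    (z : TangentSpace (𝓡 2) x) : Spow g B p x W z ∈ N := by
  obtain ⟨v, h⟩ := exists_isDiagFrame o hN.symm W
  refine mem_of_frame o h.unit ?_ ?_ z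
  · rw [h.Spow_apply]
    exact N.smul_mem _ (hW _)
  · rw [h.Spow_apply_rot]
    exact N.smul_mem _ (hW _)

theorem rpow_smul_sq {l : ℝ} (hl : 0 ≤ l) {q : ℝ} (hq : 0 < q) :
    l ^ ((q - 2) / 2) * l = l ^ (q / 2) := by
  rcases hl.eq_or_lt with rfl | hl
  · rw [mul_zero, Real.zero_rpow (by positivity)]
  · nth_rewrite 2 [← Real.rpow_one l]
    rw [← Real.rpow_add hl]
    congr 1
    ring

theorem rpow_smul_conj {l : ℝ} (hl : 0 ≤ l) {p q : ℝ} (hpq : p.HolderConjugate q) :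
    (l ^ ((q - 2) / 2) * (l ^ ((q - 2) / 2) * l)) ^ (p / 2) = l ^ (q / 2) := by
  have hq := hpq.symm.pos
  have hmul := hpq.mul_eq_add
  rcases hl.eq_or_lt with rfl | hl
  · rw [mul_zero, mul_zero, Real.zero_rpow (by have := hpq.pos; positivity),
      Real.zero_rpow (by positivity)]
  · rw [rpow_smul_sq hl.le hq, ← Real.rpow_add hl, ← Real.rpow_mul hl.le]
    congr 1
    nlinarith

theorem svPow_Spow (o : SurfaceOrientation g) (hN : PosDefOn B N) (hW : ∀ z, W z ∈ N) {p q : ℝ}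
    (hpq : p.HolderConjugate q) : svPow g B p x (Spow g B q x W) = svPow g B q x W := by
  obtain ⟨v, h⟩ := exists_isDiagFrame o hN.symm W
  rw [(h.Spow q).svPow_eq hN (Spow_mem o hN hW q) hpq.pos.ne', h.svPow_eq hN hW hpq.symm.pos.ne',
    h.Spow_apply, h.Spow_apply_rot]
  simp only [map_smul, LinearMap.smul_apply, smul_eq_mul]
  rw [rpow_smul_conj (hN.nonneg _ (hW _)) hpq, rpow_smul_conj (hN.nonneg _ (hW _)) hpq]

theorem pairing_Spow_self (o : SurfaceOrientation g) (hN : PosDefOn B N) (hW : ∀ z, W z ∈ N) {q : ℝ}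
    (hq : 0 < q) : pairing g B x (Spow g B q x W) W = svPow g B q x W := by
  obtain ⟨v, h⟩ := exists_isDiagFrame o hN.symm W
  rw [h.svPow_eq hN hW hq.ne', pairing_frame o h.unit, h.Spow_apply, h.Spow_apply_rot]
  simp only [map_smul, LinearMap.smul_apply, smul_eq_mul]
  rw [rpow_smul_sq (hN.nonneg _ (hW _)) hq, rpow_smul_sq (hN.nonneg _ (hW _)) hq]

/-- Convexity of the Schatten power: `q S_{q-1}(W)` is a subgradient of `|·|_{sv^q}^q` at `W`. -/
theorem svPow_add_le (o : SurfaceOrientation g) (hN : PosDefOn B N) {p q : ℝ}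
    (hpq : p.HolderConjugate q) {X : TangentSpace (𝓡 2) x →ₗ[ℝ] V} (hW : ∀ z, W z ∈ N)
    (hX : ∀ z, X z ∈ N) :
    svPow g B q x W + q * pairing g B x (Spow g B q x W) X ≤ svPow g B q x (W + X) := by
  have hy := pairing_le_svPow o hN hpq (Spow_mem o hN hW q)
    (Y := W + X) (fun z => N.add_mem (hW z) (hX z))
  rw [pairing_add_right, pairing_Spow_self o hN hW hpq.symm.pos, svPow_Spow o hN hW hpq] at hy
  have hq := hpq.symm.pos
  have hqp : q / p = q - 1 := by
    have := hpq.mul_eq_add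
    rw [div_eq_iff hpq.pos.ne']
    nlinarith
  have h1 := mul_le_mul_of_nonneg_left hy hq.le
  have h2 : q * (svPow g B q x W / p + svPow g B q x (W + X) / q) =
      (q - 1) * svPow g B q x W + svPow g B q x (W + X) := by
    rw [← hqp]
    field_simp
  rw [h2] at h1
  linarith

/-- Comparison of the Schatten power with the power of the Hilbert-Schmidt norm. -/
theorem svPow_le_pairing_rpow (o : SurfaceOrientation g) (hN : PosDefOn B N) (hW : ∀ z, W z ∈ N)
    {p : ℝ} (hp : 0 < p) :
    svPow g B p x W ≤ 2 * pairing g B x W W ^ (p / 2) ∧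
      pairing g B x W W ^ (p / 2) ≤ 2 ^ (p / 2) * svPow g B p x W := by
  obtain ⟨v, h⟩ := exists_isDiagFrame o hN.symm W
  rw [h.svPow_eq hN hW hp.ne', pairing_frame o h.unit]
  set a := B (W v) (W v) with ha
  set b := B (W (o.rot x v)) (W (o.rot x v)) with hb
  have ha0 : 0 ≤ a := hN.nonneg _ (hW _)
  have hb0 : 0 ≤ b := hN.nonneg _ (hW _)
  have hp2 : 0 ≤ p / 2 := by positivity
  constructor
  · have h1 : a ^ (p / 2) ≤ (a + b) ^ (p / 2) := Real.rpow_le_rpow ha0 (by linarith) hp2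
    have h2 : b ^ (p / 2) ≤ (a + b) ^ (p / 2) := Real.rpow_le_rpow hb0 (by linarith) hp2
    linarith
  · have h1 := Real.rpow_nonneg ha0 (p / 2)
    have h2 := Real.rpow_nonneg hb0 (p / 2)
    have h3 : 0 ≤ (2 : ℝ) ^ (p / 2) := by positivity
    rcases le_total a b with hab | hab
    · calc (a + b) ^ (p / 2) ≤ (2 * b) ^ (p / 2) :=
            Real.rpow_le_rpow (by linarith) (by linarith) hp2
        _ = 2 ^ (p / 2) * b ^ (p / 2) := Real.mul_rpow (by norm_num) hb0
        _ ≤ _ := mul_le_mul_of_nonneg_left (by linarith) h3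
    · calc (a + b) ^ (p / 2) ≤ (2 * a) ^ (p / 2) :=
            Real.rpow_le_rpow (by linarith) (by linarith) hp2
        _ = 2 ^ (p / 2) * a ^ (p / 2) := Real.mul_rpow (by norm_num) ha0
        _ ≤ _ := mul_le_mul_of_nonneg_left (by linarith) h3

/-- If `Z = *S_{p-1}(W)` with `1/p + 1/q = 1`, then `S_{q-1}(Z) = *W`. -/
theorem Spow_starAt_Spow (hN : PosDefOn B N) (hW : ∀ z, W z ∈ N) {p q : ℝ}
    (hpq : p.HolderConjugate q) :
    DualHarmonic.Spow g B q x (DualHarmonic.starAt o (DualHarmonic.Spow g B p x W)) =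
      DualHarmonic.starAt o W := by
  obtain ⟨v, h⟩ := exists_isDiagFrame o hN.symm W
  have hmul := hpq.mul_eq_add
  have key : ∀ y ∈ N, (B y y ^ ((p - 2) / 2) * (B y y ^ ((p - 2) / 2) * B y y)) ^ ((q - 2) / 2) •
      B y y ^ ((p - 2) / 2) • y = y := by
    intro y hy
    rcases (hN.nonneg y hy).eq_or_lt with h0 | hl
    · rw [hN.definite y hy h0.symm, smul_zero, smul_zero]
    · rw [rpow_smul_sq hl.le hpq.pos, ← Real.rpow_add hl, ← Real.rpow_mul hl.le, smul_smul,
        ← Real.rpow_add hl]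
      have : ((p - 2) / 2 + p / 2) * ((q - 2) / 2) + (p - 2) / 2 = 0 := by nlinarith
      rw [this, Real.rpow_zero, one_smul]
  have hneg : ∀ y, B (-y) (-y) = B y y := fun y => by
    rw [map_neg, map_neg, LinearMap.neg_apply, neg_neg]
  have hd := (h.Spow p).starAt
  refine ext_frame o h.unit ?_ ?_
  · rw [hd.Spow_apply, starAt_apply, starAt_apply, h.Spow_apply_rot, hneg]
    simp only [map_smul, LinearMap.smul_apply, smul_eq_mul, smul_neg]
    rw [key _ (hW _)]
  · have e1 : DualHarmonic.starAt o (DualHarmonic.Spow g B p x W) (o.rot x v) =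
        B (W v) (W v) ^ ((p - 2) / 2) • W v := by
      rw [starAt_apply, o.rot_rot, map_neg, neg_neg, h.Spow_apply]
    have e2 : DualHarmonic.starAt o W (o.rot x v) = W v := by
      rw [starAt_apply, o.rot_rot, map_neg, neg_neg]
    rw [hd.Spow_apply_rot, e1, e2]
    simp only [map_smul, LinearMap.smul_apply, smul_eq_mul]
    rw [key _ (hW _)]

theorem svPow_starAt (hN : PosDefOn B N) (hW : ∀ z, W z ∈ N) {p : ℝ} (hp : p ≠ 0) :
    svPow g B p x (DualHarmonic.starAt o W) = svPow g B p x W := by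
  obtain ⟨v, h⟩ := exists_isDiagFrame o hN.symm W
  rw [h.starAt.svPow_eq hN (fun z => N.neg_mem (hW _)) hp, h.svPow_eq hN hW hp]
  simp only [starAt_apply, o.rot_rot, map_neg, LinearMap.neg_apply, neg_neg]
  rw [add_comm]

/-- Composition with a homothety `β` onto its image: `S_{q-1}(β W) = c^{(q-2)/2} β S_{q-1}(W)`. -/
theorem Spow_comp {V' : Type*} [AddCommGroup V'] [Module ℝ V'] [Module.Finite ℝ V']
    {B' : LinearMap.BilinForm ℝ V'} (o : SurfaceOrientation g) (hN : PosDefOn B N)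
    (hW : ∀ z, W z ∈ N) (β : V →ₗ[ℝ] V') {c : ℝ} (hc : 0 ≤ c)
    (hβ : ∀ v ∈ N, ∀ w ∈ N, B' (β v) (β w) = c * B v w) (q : ℝ) :
    DualHarmonic.Spow g B' q x (β ∘ₗ W) =
      c ^ ((q - 2) / 2) • (β ∘ₗ DualHarmonic.Spow g B q x W) := by
  obtain ⟨v, h⟩ := exists_isDiagFrame o hN.symm W
  have h' : IsDiagFrame o B' (β ∘ₗ W) v := ⟨h.unit,
    by rw [LinearMap.comp_apply, LinearMap.comp_apply, hβ _ (hW _) _ (hW _), h.orth, mul_zero],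
    by rw [LinearMap.comp_apply, LinearMap.comp_apply, hβ _ (hW _) _ (hW _), h.orth', mul_zero]⟩
  refine ext_frame o h.unit ?_ ?_
  · rw [h'.Spow_apply, LinearMap.comp_apply, hβ _ (hW _) _ (hW _),
      Real.mul_rpow hc (hN.nonneg _ (hW _)), LinearMap.smul_apply, LinearMap.comp_apply,
      h.Spow_apply, map_smul, smul_smul]
  · rw [h'.Spow_apply_rot, LinearMap.comp_apply, hβ _ (hW _) _ (hW _),
      Real.mul_rpow hc (hN.nonneg _ (hW _)), LinearMap.smul_apply, LinearMap.comp_apply,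
      h.Spow_apply_rot, map_smul, smul_smul]

theorem svPow_comp {V' : Type*} [AddCommGroup V'] [Module ℝ V'] [Module.Finite ℝ V']
    {B' : LinearMap.BilinForm ℝ V'} {N' : Submodule ℝ V'} (o : SurfaceOrientation g)
    (hN : PosDefOn B N) (hN' : PosDefOn B' N')
    (hW : ∀ z, W z ∈ N) (β : V →ₗ[ℝ] V') {c : ℝ} (hc : 0 ≤ c) (hβN : ∀ v ∈ N, β v ∈ N')
    (hβ : ∀ v ∈ N, ∀ w ∈ N, B' (β v) (β w) = c * B v w) {q : ℝ} (hq : q ≠ 0) :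
    svPow g B' q x (β ∘ₗ W) = c ^ (q / 2) * svPow g B q x W := by
  obtain ⟨v, h⟩ := exists_isDiagFrame o hN.symm W
  have h' : IsDiagFrame o B' (β ∘ₗ W) v := ⟨h.unit,
    by rw [LinearMap.comp_apply, LinearMap.comp_apply, hβ _ (hW _) _ (hW _), h.orth, mul_zero],
    by rw [LinearMap.comp_apply, LinearMap.comp_apply, hβ _ (hW _) _ (hW _), h.orth', mul_zero]⟩
  rw [h.svPow_eq hN hW hq, h'.svPow_eq hN' (fun z => hβN _ (hW z)) hq, LinearMap.comp_apply,
    LinearMap.comp_apply, hβ _ (hW _) _ (hW _), hβ _ (hW _) _ (hW _),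
    Real.mul_rpow hc (hN.nonneg _ (hW _)), Real.mul_rpow hc (hN.nonneg _ (hW _)), mul_add]

end Diag

/-- The pairing with a star in an arbitrary basis is a wedge product. -/
theorem pairing_starAt_mul (o : SurfaceOrientation g) (b : Fin 2 → TangentSpace (𝓡 2) x)
    (A C : TangentSpace (𝓡 2) x →ₗ[ℝ] V) :
    pairing g B x (starAt o A) C * g.inner x (o.rot x (b 0)) (b 1) =
      B (A (b 0)) (C (b 1)) - B (A (b 1)) (C (b 0)) := by
  obtain ⟨v, hv⟩ := exists_unit g x
  have hrv : g.inner x (o.rot x v) (o.rot x v) = 1 := by rw [o.inner_rot, hv]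
  have hvr : g.inner x v (o.rot x v) = 0 := inner_self_rot o v
  have hrv' : g.inner x (o.rot x v) v = 0 := by rw [g.symm]; exact hvr
  rw [pairing_frame o hv, eq_frame o hv (b 0), eq_frame o hv (b 1)]
  simp only [starAt_apply, o.rot_rot, map_add, map_smul, map_neg, LinearMap.add_apply,
    LinearMap.smul_apply, LinearMap.neg_apply, smul_eq_mul, _root_.add_apply, _root_.smul_apply,
    _root_.neg_apply, hv, hrv, hvr, hrv', neg_neg]
  ring

theorem gram_det_eq (o : SurfaceOrientation g) (b : Fin 2 → TangentSpace (𝓡 2) x) :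
    (gram g x b).det = g.inner x (o.rot x (b 0)) (b 1) ^ 2 := by
  obtain ⟨v, hv⟩ := exists_unit g x
  have hrv : g.inner x (o.rot x v) (o.rot x v) = 1 := by rw [o.inner_rot, hv]
  have hvr : g.inner x v (o.rot x v) = 0 := inner_self_rot o v
  have hrv' : g.inner x (o.rot x v) v = 0 := by rw [g.symm]; exact hvr
  rw [Matrix.det_fin_two]
  simp only [gram, Matrix.of_apply]
  rw [eq_frame o hv (b 0), eq_frame o hv (b 1)]
  simp only [o.rot_rot, map_add, map_smul, map_neg, smul_eq_mul, _root_.add_apply,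
    _root_.smul_apply, _root_.neg_apply, hv, hrv, hvr, hrv']
  ring

end Schatten

/-! ### Coordinate frames and the area density -/

section Charts

variable {M : Type*} [TopologicalSpace M] [ChartedSpace Plane M]

/-- The coordinate vector field `∂_i` of the chart at `c`, as a function of the point of `M`. -/
def coordAt (c x : M) (i : Fin 2) : TangentSpace (𝓡 2) x :=
  (mfderiv 𝓘(ℝ, Plane) (𝓡 2) (chartAt Plane c).symm (chartAt Plane c x) (stdVec i) : Plane)

theorem coordVec_eq_coordAt (c : M) {y : Plane} (hy : y ∈ (chartAt Plane c).target) (i : Fin 2) :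
    coordVec c y i = coordAt c ((chartAt Plane c).symm y) i := by
  have h := (chartAt Plane c).right_inv hy
  have : ∀ z, z = y → (mfderiv 𝓘(ℝ, Plane) (𝓡 2) (chartAt Plane c).symm y (stdVec i) : Plane) =
      (mfderiv 𝓘(ℝ, Plane) (𝓡 2) (chartAt Plane c).symm z (stdVec i) : Plane) := by
    rintro z rfl
    rfl
  exact this _ h

variable [IsManifold (𝓡 2) ∞ M]

theorem mfderiv_chart_coordAt (c : M) {x : M} (hx : x ∈ (chartAt Plane c).source) (i : Fin 2) :
    mfderiv (𝓡 2) 𝓘(ℝ, Plane) (chartAt Plane c) x (coordAt c x i) = stdVec i := by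
  have h := (mdifferentiable_chart (I := 𝓡 2) c).comp_symm_deriv
    ((chartAt Plane c).map_source hx)
  have h2 : ∀ z, z = x → (mfderiv (𝓡 2) 𝓘(ℝ, Plane) (chartAt Plane c) z : Plane →L[ℝ] Plane)
      (coordAt c x i) = mfderiv (𝓡 2) 𝓘(ℝ, Plane) (chartAt Plane c) x (coordAt c x i) := by
    rintro z rfl
    rfl
  rw [← h2 _ ((chartAt Plane c).left_inv hx)]
  exact congrArg (fun L : Plane →L[ℝ] Plane => L (stdVec i)) h

/-- The smooth map `f` in the charts at `c` and `c'`. -/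
def chartMap (f : M → M) (c c' : M) : Plane → Plane :=
  chartAt Plane c' ∘ f ∘ (chartAt Plane c).symm

/-- Expansion of a tangent vector in the coordinate frame. -/
theorem eq_sum_coordAt (c : M) {x : M} (hx : x ∈ (chartAt Plane c).source)
    (w : TangentSpace (𝓡 2) x) :
    w = (show Plane from mfderiv (𝓡 2) 𝓘(ℝ, Plane) (chartAt Plane c) x w) 0 • coordAt c x 0 +
      (show Plane from mfderiv (𝓡 2) 𝓘(ℝ, Plane) (chartAt Plane c) x w) 1 • coordAt c x 1 := by
  have h := (mdifferentiable_chart (I := 𝓡 2) c).symm_comp_deriv hx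
  have h1 := congrArg (fun L : Plane →L[ℝ] Plane => L w) h
  set v : Plane := mfderiv (𝓡 2) 𝓘(ℝ, Plane) (chartAt Plane c) x w with hv
  have h2 : (mfderiv 𝓘(ℝ, Plane) (𝓡 2) (chartAt Plane c).symm (chartAt Plane c x) :
      Plane →L[ℝ] Plane) v = w := h1
  have key : ∀ L : Plane →L[ℝ] Plane, L v = v 0 • L (stdVec 0) + v 1 • L (stdVec 1) := fun L => by
    conv_lhs => rw [plane_eq_sum v, map_add, map_smul, map_smul]
  exact h2.symm.trans (key _)

theorem contDiffAt_chartMap {f : M → M} (hf : ContMDiff (𝓡 2) (𝓡 2) ∞ f) {c c' x : M}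
    (hx : x ∈ (chartAt Plane c).source) (hfx : f x ∈ (chartAt Plane c').source) :
    ContDiffAt ℝ ∞ (chartMap f c c') (chartAt Plane c x) := by
  have h1 : ContMDiffAt 𝓘(ℝ, Plane) (𝓡 2) ∞ (chartAt Plane c).symm (chartAt Plane c x) :=
    (contMDiffOn_chart_symm (I := 𝓡 2) (n := ∞)).contMDiffAt
      ((chartAt Plane c).open_target.mem_nhds ((chartAt Plane c).map_source hx))
  have hl := (chartAt Plane c).left_inv hx
  have h2 : ContMDiffAt (𝓡 2) 𝓘(ℝ, Plane) ∞ (chartAt Plane c') (f x) :=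
    (contMDiffOn_chart (I := 𝓡 2) (n := ∞)).contMDiffAt
      ((chartAt Plane c').open_source.mem_nhds hfx)
  have h3 : ContMDiffAt 𝓘(ℝ, Plane) (𝓡 2) ∞ (f ∘ (chartAt Plane c).symm) (chartAt Plane c x) :=
    hf.contMDiffAt.comp _ h1
  have h4 := ContMDiffAt.comp (chartAt Plane c x) (g := chartAt Plane c')
    (by rw [Function.comp_apply, hl]; exact h2) h3
  exact contMDiffAt_iff_contDiffAt.1 h4

theorem mfderiv_chart_mfderiv {f : M → M} (hf : ContMDiff (𝓡 2) (𝓡 2) ∞ f) {c c' x : M}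
    (hx : x ∈ (chartAt Plane c).source) (hfx : f x ∈ (chartAt Plane c').source) (i : Fin 2) :
    (mfderiv (𝓡 2) 𝓘(ℝ, Plane) (chartAt Plane c') (f x)
      (mfderiv (𝓡 2) (𝓡 2) f x (coordAt c x i)) : Plane) =
      fderiv ℝ (chartMap f c c') (chartAt Plane c x) (stdVec i) := by
  have hl := (chartAt Plane c).left_inv hx
  have ht := (chartAt Plane c).map_source hx
  have h1 : MDifferentiableAt 𝓘(ℝ, Plane) (𝓡 2) (chartAt Plane c).symm (chartAt Plane c x) :=
    (mdifferentiable_chart (I := 𝓡 2) c).mdifferentiableAt_symm ht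
  have h2 : MDifferentiableAt (𝓡 2) 𝓘(ℝ, Plane) (chartAt Plane c')
      (f ((chartAt Plane c).symm (chartAt Plane c x))) := by
    rw [hl]
    exact (mdifferentiable_chart (I := 𝓡 2) c').mdifferentiableAt hfx
  have h3 : MDifferentiableAt (𝓡 2) (𝓡 2) f ((chartAt Plane c).symm (chartAt Plane c x)) :=
    hf.mdifferentiable (by simp) _
  have e1 := mfderiv_comp (chartAt Plane c x) h3 h1
  have e2 := mfderiv_comp (chartAt Plane c x) (g := chartAt Plane c')
    (f := f ∘ (chartAt Plane c).symm) h2 (h3.comp _ h1)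
  rw [e1] at e2
  have e3 : mfderiv 𝓘(ℝ, Plane) 𝓘(ℝ, Plane) (chartAt Plane c' ∘ f ∘ (chartAt Plane c).symm)
    (chartAt Plane c x) = fderiv ℝ (chartMap f c c') (chartAt Plane c x) := mfderiv_eq_fderiv
  have e4 := congrArg (fun L : Plane →L[ℝ] Plane => L (stdVec i)) (e3.symm.trans e2)
  refine Eq.trans ?_ e4.symm
  have key : ∀ z : M, z = x → (mfderiv (𝓡 2) 𝓘(ℝ, Plane) (chartAt Plane c') (f x)
      (mfderiv (𝓡 2) (𝓡 2) f x (coordAt c x i)) : Plane) =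
      (mfderiv (𝓡 2) 𝓘(ℝ, Plane) (chartAt Plane c') (f z) : Plane →L[ℝ] Plane)
      ((mfderiv (𝓡 2) (𝓡 2) f z : Plane →L[ℝ] Plane) (coordAt c x i)) := by
    rintro z rfl
    rfl
  exact key _ hl

/-- The coordinate frames at `c` and `c'` are related by the Jacobian matrix of `f`. -/
theorem mfderiv_coordAt {f : M → M} (hf : ContMDiff (𝓡 2) (𝓡 2) ∞ f) {c c' x : M}
    (hx : x ∈ (chartAt Plane c).source) (hfx : f x ∈ (chartAt Plane c').source) (i : Fin 2) :
    mfderiv (𝓡 2) (𝓡 2) f x (coordAt c x i) =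
      (fderiv ℝ (chartMap f c c') (chartAt Plane c x) (stdVec i)) 0 • coordAt c' (f x) 0 +
      (fderiv ℝ (chartMap f c c') (chartAt Plane c x) (stdVec i)) 1 • coordAt c' (f x) 1 := by
  rw [← mfderiv_chart_mfderiv hf hx hfx i]
  exact eq_sum_coordAt c' hfx _

/-- The differential of a function in coordinates. -/
theorem fderiv_comp_chart_symm {χ : M → ℝ} {c x : M} (hx : x ∈ (chartAt Plane c).source)
    (hχ : MDifferentiableAt (𝓡 2) 𝓘(ℝ, ℝ) χ x) (i : Fin 2) :
    fderiv ℝ (χ ∘ (chartAt Plane c).symm) (chartAt Plane c x) (stdVec i) =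
      (mfderiv (𝓡 2) 𝓘(ℝ, ℝ) χ x (coordAt c x i) : ℝ) := by
  have hl := (chartAt Plane c).left_inv hx
  have ht := (chartAt Plane c).map_source hx
  have h1 : MDifferentiableAt 𝓘(ℝ, Plane) (𝓡 2) (chartAt Plane c).symm (chartAt Plane c x) :=
    (mdifferentiable_chart (I := 𝓡 2) c).mdifferentiableAt_symm ht
  have e1 := mfderiv_comp (chartAt Plane c x) (g := χ) (by rw [hl]; exact hχ) h1
  rw [← mfderiv_eq_fderiv]
  have e4 := congrArg (fun L : Plane →L[ℝ] ℝ => L (stdVec i)) e1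
  refine Eq.trans e4 ?_
  have key : ∀ z : M, z = x → (mfderiv (𝓡 2) 𝓘(ℝ, ℝ) χ z : Plane →L[ℝ] ℝ) (coordAt c x i) =
      (mfderiv (𝓡 2) 𝓘(ℝ, ℝ) χ x (coordAt c x i) : ℝ) := by
    rintro z rfl
    rfl
  exact key _ hl

variable {g : Metric M} (o : SurfaceOrientation g)

/-- The area form `dA(∂₀, ∂₁)` of the chart at `c`, negative if the chart reverses the
orientation. -/
def areaCoeff (o : SurfaceOrientation g) (c x : M) : ℝ :=
  g.inner x (o.rot x (coordAt c x 0)) (coordAt c x 1)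

theorem areaCoeff_ne_zero {c x : M} (hx : x ∈ (chartAt Plane c).source) : areaCoeff o c x ≠ 0 := by
  intro h
  obtain ⟨v, hv⟩ := exists_unit g x
  -- otherwise `∂₀` and `∂₁` are parallel
  have hp := mfderiv_chart_coordAt c hx
  have hne : coordAt c x 0 ≠ 0 := by
    intro h0
    have := hp 0
    rw [h0, map_zero] at this
    have h1 := congrArg (fun w : Plane => w 0) this
    have h2 : ((0 : Plane) 0 : ℝ) = (stdVec 0 : Plane) 0 := h1
    simp at h2
  have hpos := g.pos x _ hne
  set a := coordAt c x 0 with ha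
  set r := Real.sqrt (g.inner x a a) with hr
  have hr0 : 0 < r := Real.sqrt_pos.2 hpos
  have hu : g.inner x (r⁻¹ • a) (r⁻¹ • a) = 1 := by
    simp only [map_smul, _root_.smul_apply, smul_eq_mul]
    rw [← mul_assoc, ← mul_inv, hr, Real.mul_self_sqrt hpos.le, inv_mul_cancel₀ hpos.ne']
  have he := eq_frame o hu (coordAt c x 1)
  have h0 : g.inner x (o.rot x (r⁻¹ • a)) (coordAt c x 1) = 0 := by
    rw [map_smul, map_smul, _root_.smul_apply]
    exact (congrArg (r⁻¹ • ·) h).trans (smul_zero _)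
  rw [h0, zero_smul, add_zero] at he
  have key : ∀ (L : Plane →L[ℝ] Plane) (s t : ℝ) (v : Plane), L (s • t • v) = s • t • L v := by
    intros
    rw [map_smul, map_smul]
  have h1 := (hp 1).symm.trans ((congrArg (mfderiv (𝓡 2) 𝓘(ℝ, Plane) (chartAt Plane c) x) he).trans
    ((key _ _ _ _).trans (congrArg (fun w : Plane => g.inner x (r⁻¹ • a) (coordAt c x 1) •
      r⁻¹ • w) (hp 0))))
  have h2 := congrArg (fun w : Plane => w 1) h1
  have h3 : (stdVec 1 : Plane) 1 = (g.inner x (r⁻¹ • a) (coordAt c x 1) • r⁻¹ •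
    (stdVec 0 : Plane)) 1 := h2
  simp at h3

/-- Change of variables for the area form under an isometry preserving the orientation. -/
theorem areaCoeff_map {f : M → M} (hf : ContMDiff (𝓡 2) (𝓡 2) ∞ f) {c c' x : M}
    (hx : x ∈ (chartAt Plane c).source) (hfx : f x ∈ (chartAt Plane c').source)
    (hiso : ∀ v w, g.inner (f x) (mfderiv (𝓡 2) (𝓡 2) f x v) (mfderiv (𝓡 2) (𝓡 2) f x w) =
      g.inner x v w)
    (hrot : ∀ v, mfderiv (𝓡 2) (𝓡 2) f x (o.rot x v) = o.rot (f x) (mfderiv (𝓡 2) (𝓡 2) f x v)) :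
    areaCoeff o c x =
      (fderiv ℝ (chartMap f c c') (chartAt Plane c x)).det * areaCoeff o c' (f x) := by
  rw [det_plane, areaCoeff, ← hiso, hrot, mfderiv_coordAt hf hx hfx 0, mfderiv_coordAt hf hx hfx 1,
    areaCoeff]
  simp only [map_add, map_smul, _root_.add_apply, _root_.smul_apply, smul_eq_mul, inner_rot_left o,
    inner_self_rot o]
  have h := inner_rot_left o (coordAt c' (f x) 0) (coordAt c' (f x) 1)
  have h' := g.symm (f x) (o.rot (f x) (coordAt c' (f x) 0)) (coordAt c' (f x) 1)
  have h2 : g.inner (f x) (coordAt c' (f x) 1) (o.rot (f x) (coordAt c' (f x) 0)) =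
    - g.inner (f x) (coordAt c' (f x) 0) (o.rot (f x) (coordAt c' (f x) 1)) := by
    rw [← h', h]
  rw [h2]
  ring

theorem contMDiffOn_coordAt (c : M) (i : Fin 2) :
    ContMDiffOn (𝓡 2) ((𝓡 2).prod 𝓘(ℝ, Plane)) ∞
      (fun x => Bundle.TotalSpace.mk' Plane (E := fun x : M => TangentSpace (𝓡 2) x) x
        (coordAt c x i)) (chartAt Plane c).source := by
  have h := (trivializationAt Plane (TangentSpace (𝓡 2) : M → Type _) c).contMDiffOn_symm
    (IB := 𝓡 2) (n := ∞)
  have h2 : ContMDiffOn (𝓡 2) ((𝓡 2).prod 𝓘(ℝ, Plane)) ∞ (fun x : M => (x, (stdVec i : Plane)))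
      (chartAt Plane c).source := contMDiffOn_id.prodMk contMDiffOn_const
  have h3 := h.comp h2 (fun x hx => by
    rw [Set.mem_preimage, Bundle.Trivialization.mem_target]
    exact hx)
  refine h3.congr fun x hx => ?_
  have e := TangentBundle.symmL_trivializationAt (I := 𝓡 2) (𝕜 := ℝ) hx
  rw [ModelWithCorners.range_eq_univ, mfderivWithin_univ] at e
  have e1 : (trivializationAt Plane (TangentSpace (𝓡 2) : M → Type _) c).symm x (stdVec i) =
      coordAt c x i := by
    refine (Bundle.Trivialization.symmL_apply (R := ℝ) _ hx _).symm.trans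
      ((congrArg (fun L : Plane →L[ℝ] Plane => L (stdVec i)) e).trans ?_)
    simp only [extChartAt, mfld_simps, OpenPartialHomeomorph.extend]
    rfl
  rw [← e1]
  exact Bundle.Trivialization.mk_symm _ hx _

theorem continuousOn_areaCoeff (c : M) : ContinuousOn (areaCoeff o c) (chartAt Plane c).source := by
  have h1 := ContMDiffOn.clm_bundle_apply (o.contMDiff.contMDiffOn (s := (chartAt Plane c).source))
    (contMDiffOn_coordAt c 0)
  have h2 := ContMDiffOn.clm_bundle_apply₂ (F₃ := ℝ) (E₃ := Bundle.Trivial M ℝ)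
    (g.contMDiff.contMDiffOn (s := (chartAt Plane c).source)) h1 (contMDiffOn_coordAt c 1)
  intro x hx
  have h3 := (h2 x hx)
  rw [Bundle.contMDiffWithinAt_section] at h3
  exact h3.continuousWithinAt

theorem continuousOn_gram (g : Metric M) (c : M) (i j : Fin 2) :
    ContinuousOn (fun x => g.inner x (coordAt c x i) (coordAt c x j)) (chartAt Plane c).source := by
  have h2 := ContMDiffOn.clm_bundle_apply₂ (F₃ := ℝ) (E₃ := Bundle.Trivial M ℝ)
    (g.contMDiff.contMDiffOn (s := (chartAt Plane c).source)) (contMDiffOn_coordAt c i)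
    (contMDiffOn_coordAt c j)
  intro x hx
  have h3 := (h2 x hx)
  rw [Bundle.contMDiffWithinAt_section] at h3
  exact h3.continuousWithinAt

end Charts

/-! ### The Riemannian measure in charts -/

section Measure

variable {M : Type*} [TopologicalSpace M] [ChartedSpace Plane M]

theorem measurableSet_target (c : M) : MeasurableSet (chartAt Plane c).target :=
  (chartAt Plane c).open_target.measurableSet

theorem measurableSet_source [MeasurableSpace M] [BorelSpace M] (c : M) :
    MeasurableSet (chartAt Plane c).source :=
  (chartAt Plane c).open_source.measurableSet

theorem exists_countable_chart_cover [SecondCountableTopology M] :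
    ∃ s : Set M, s.Countable ∧ ⋃ c : s, (chartAt Plane (c : M)).source = univ := by
  obtain ⟨s, hs, hU⟩ := TopologicalSpace.countable_cover_nhds
    (f := fun c : M => (chartAt Plane c).source) (fun c => chart_source_mem_nhds Plane c)
  exact ⟨s, hs, by rw [← hU, biUnion_eq_iUnion]⟩

theorem measurableSet_symm_preimage [MeasurableSpace M] [BorelSpace M] {c : M} {A : Set M}
    (hA : MeasurableSet A) :
    MeasurableSet ((chartAt Plane c).symm ⁻¹' A ∩ (chartAt Plane c).target) := by
  classical
  have h : Measurable ((chartAt Plane c).target.piecewise (chartAt Plane c).symm fun _ => c) :=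
    (chartAt Plane c).continuousOn_symm.measurable_piecewise continuousOn_const
      (measurableSet_target c)
  have h2 := (h hA).inter (measurableSet_target c)
  convert h2 using 1
  ext y
  refine and_congr_left fun hy => ?_
  rw [mem_preimage, mem_preimage, Set.piecewise_eq_of_mem _ _ _ hy]

variable [IsManifold (𝓡 2) ∞ M] {g : Metric M} (o : SurfaceOrientation g)

/-- The density of the Riemannian measure in the chart at `c`. -/
def areaDensity (o : SurfaceOrientation g) (c : M) (y : Plane) : ℝ≥0∞ :=
  ENNReal.ofReal |areaCoeff o c ((chartAt Plane c).symm y)|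

theorem continuousOn_areaCoeff_symm (c : M) :
    ContinuousOn (fun y => areaCoeff o c ((chartAt Plane c).symm y)) (chartAt Plane c).target :=
  (continuousOn_areaCoeff o c).comp (chartAt Plane c).continuousOn_symm
    fun _ hy => (chartAt Plane c).map_target hy

theorem aemeasurable_areaDensity (c : M) :
    AEMeasurable (areaDensity o c) (volume.restrict (chartAt Plane c).target) :=
  ((continuousOn_areaCoeff_symm o c).abs.aemeasurable (measurableSet_target c)).ennreal_ofReal

theorem areaDensity_ne_zero (c : M) {y : Plane} (hy : y ∈ (chartAt Plane c).target) :
    areaDensity o c y ≠ 0 := by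
  rw [areaDensity, Ne, ENNReal.ofReal_eq_zero, not_le, abs_pos]
  exact areaCoeff_ne_zero o ((chartAt Plane c).map_target hy)

theorem toReal_areaDensity (c : M) (y : Plane) :
    (areaDensity o c y).toReal = |areaCoeff o c ((chartAt Plane c).symm y)| :=
  ENNReal.toReal_ofReal (abs_nonneg _)

theorem sqrt_det_gram (c : M) {y : Plane} (hy : y ∈ (chartAt Plane c).target) :
    Real.sqrt (Matrix.det (Matrix.of fun i j : Fin 2 =>
      g.inner ((chartAt Plane c).symm y) (coordVec c y i) (coordVec c y j))) =
      |areaCoeff o c ((chartAt Plane c).symm y)| := by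
  simp only [coordVec_eq_coordAt c hy]
  rw [← Real.sqrt_sq_eq_abs]
  exact congrArg Real.sqrt (gram_det_eq o (coordAt c ((chartAt Plane c).symm y)))

variable [MeasurableSpace M]

/-- The Riemannian measure of the domain of the chart at `c`. -/
def chartMeasure (o : SurfaceOrientation g) (c : M) : Measure M :=
  ((volume.restrict (chartAt Plane c).target).withDensity (areaDensity o c)).map
    (chartAt Plane c).symm

theorem riemVol_eq_iSup : riemVol g = ⨆ c, chartMeasure o c := by
  refine iSup_congr fun c => ?_
  rw [chartMeasure]
  congr 1
  refine withDensity_congr_ae ?_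
  filter_upwards [ae_restrict_mem (measurableSet_target c)] with y hy
  rw [areaDensity, sqrt_det_gram o c hy]

variable [BorelSpace M]

theorem aemeasurable_chart_symm (c : M) : AEMeasurable (chartAt Plane c).symm
    ((volume.restrict (chartAt Plane c).target).withDensity (areaDensity o c)) :=
  ((chartAt Plane c).continuousOn_symm.aemeasurable (measurableSet_target c)).mono_ac
    (withDensity_absolutelyContinuous _ _)

theorem chartMeasure_apply (c : M) {A : Set M} (hA : MeasurableSet A) :
    chartMeasure o c A =
      ∫⁻ y in (chartAt Plane c).symm ⁻¹' A ∩ (chartAt Plane c).target, areaDensity o c y := by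
  rw [chartMeasure, Measure.map_apply_of_aemeasurable (aemeasurable_chart_symm o c) hA,
    withDensity_apply', Measure.restrict_restrict' (measurableSet_target c)]

theorem chartMeasure_restrict_source (c : M) :
    (chartMeasure o c).restrict (chartAt Plane c).source = chartMeasure o c := by
  ext A hA
  rw [Measure.restrict_apply hA, chartMeasure_apply o c (hA.inter (measurableSet_source c)),
    chartMeasure_apply o c hA]
  congr 2
  ext y
  constructor
  · rintro ⟨⟨h1, h2⟩, h3⟩
    exact ⟨h1, h3⟩
  · rintro ⟨h1, h3⟩
    exact ⟨⟨h1, (chartAt Plane c).map_target h3⟩, h3⟩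

/-- Change of variables: isometries preserve the measures of charts. -/
theorem chartMeasure_image (f : M ≃ₜ M) (hf : ContMDiff (𝓡 2) (𝓡 2) ∞ f)
    (hiso : ∀ x v w, g.inner (f x) (mfderiv (𝓡 2) (𝓡 2) f x v) (mfderiv (𝓡 2) (𝓡 2) f x w) =
      g.inner x v w)
    (hrot : ∀ x v, mfderiv (𝓡 2) (𝓡 2) f x (o.rot x v) =
      o.rot (f x) (mfderiv (𝓡 2) (𝓡 2) f x v)) {c c' : M} {A : Set M} (hA : MeasurableSet A)
    (hc : A ⊆ (chartAt Plane c).source) (hc' : A ⊆ f ⁻¹' (chartAt Plane c').source) :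
    chartMeasure o c' (f '' A) = chartMeasure o c A := by
  have hfA : MeasurableSet (f '' A) := f.measurableEmbedding.measurableSet_image.2 hA
  rw [chartMeasure_apply o c hA, chartMeasure_apply o c' hfA]
  set S := (chartAt Plane c).symm ⁻¹' A ∩ (chartAt Plane c).target with hS
  have hSm : MeasurableSet S := measurableSet_symm_preimage hA
  have himg : (chartAt Plane c').symm ⁻¹' (f '' A) ∩ (chartAt Plane c').target =
      chartMap f c c' '' S := by
    ext z
    constructor
    · rintro ⟨⟨x, hx, hxz⟩, hz⟩
      refine ⟨chartAt Plane c x, ⟨?_, (chartAt Plane c).map_source (hc hx)⟩, ?_⟩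
      · rw [mem_preimage, (chartAt Plane c).left_inv (hc hx)]
        exact hx
      · rw [chartMap, Function.comp_apply, Function.comp_apply,
          (chartAt Plane c).left_inv (hc hx), hxz, (chartAt Plane c').right_inv hz]
    · rintro ⟨y, ⟨hy, hyt⟩, rfl⟩
      refine ⟨?_, (chartAt Plane c').map_source (hc' hy)⟩
      rw [mem_preimage, chartMap, Function.comp_apply, Function.comp_apply,
        (chartAt Plane c').left_inv (hc' hy)]
      exact mem_image_of_mem _ hy
  have hinj : InjOn (chartMap f c c') S := by
    rintro y ⟨hy, hyt⟩ z ⟨hz, hzt⟩ h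
    exact (chartAt Plane c).symm.injOn hyt hzt
      (f.injective ((chartAt Plane c').injOn (hc' hy) (hc' hz) h))
  have hder : ∀ y ∈ S, HasFDerivWithinAt (chartMap f c c') (fderiv ℝ (chartMap f c c') y) S y := by
    rintro y ⟨hy, hyt⟩
    have h := contDiffAt_chartMap hf (hc hy) (hc' hy)
    rw [(chartAt Plane c).right_inv hyt] at h
    exact (h.differentiableAt (by simp)).hasFDerivAt.hasFDerivWithinAt
  rw [himg, lintegral_image_eq_lintegral_abs_det_fderiv_mul volume hSm hder hinj]
  refine setLIntegral_congr_fun hSm fun y hy => ?_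
  have h := areaCoeff_map o hf (hc hy.1) (hc' hy.1) (hiso _) (hrot _)
  rw [(chartAt Plane c).right_inv hy.2] at h
  simp only [areaDensity]
  rw [h, abs_mul, ENNReal.ofReal_mul (abs_nonneg _), chartMap, Function.comp_apply,
    Function.comp_apply, (chartAt Plane c').left_inv (hc' hy.1)]

/-- The Riemannian measure, defined as a supremum of chart measures, restricts to the measure of
each chart on its domain, since any two of them agree on overlaps. -/
theorem riemVol_restrict_source (c : M) :
    (riemVol g).restrict (chartAt Plane c).source = chartMeasure o c := by
  have hle : ∀ c', chartMeasure o c' ≤ riemVol g := fun c' => by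
    rw [riemVol_eq_iSup o]
    exact le_iSup _ c'
  have hle' : ∀ c', (chartMeasure o c').restrict (chartAt Plane c).source ≤ chartMeasure o c := by
    intro c'
    rw [← chartMeasure_restrict_source o c']
    refine Measure.le_iff.2 fun A hA => ?_
    have hs := measurableSet_source c
    have hs' := measurableSet_source c'
    rw [Measure.restrict_apply hA, Measure.restrict_apply (hA.inter hs)]
    have h := chartMeasure_image o (Homeomorph.refl M) contMDiff_id
      (fun x v w => by
        have : mfderiv (𝓡 2) (𝓡 2) (Homeomorph.refl M) x = ContinuousLinearMap.id ℝ _ :=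
          mfderiv_id
        rw [this]
        rfl)
      (fun x v => by
        have : mfderiv (𝓡 2) (𝓡 2) (Homeomorph.refl M) x = ContinuousLinearMap.id ℝ _ :=
          mfderiv_id
        rw [this]
        rfl) (c := c) (c' := c') (A := A ∩ (chartAt Plane c).source ∩ (chartAt Plane c').source)
      ((hA.inter hs).inter hs') (fun x hx => hx.1.2) (fun x hx => hx.2)
    have h' : (Homeomorph.refl M) '' (A ∩ (chartAt Plane c).source ∩ (chartAt Plane c').source) =
      A ∩ (chartAt Plane c).source ∩ (chartAt Plane c').source := image_id _
    rw [h'] at h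
    rw [h]
    exact measure_mono fun x hx => hx.1.1
  refine le_antisymm ?_ ?_
  · have h1 : riemVol g ≤ chartMeasure o c + (riemVol g).restrict (chartAt Plane c).sourceᶜ := by
      nth_rewrite 1 [riemVol_eq_iSup o]
      refine iSup_le fun c' => ?_
      rw [← Measure.restrict_add_restrict_compl (μ := chartMeasure o c') (measurableSet_source c)]
      exact add_le_add (hle' c') (Measure.restrict_mono le_rfl (hle c'))
    calc (riemVol g).restrict (chartAt Plane c).source ≤
        (chartMeasure o c + (riemVol g).restrict (chartAt Plane c).sourceᶜ).restrict
          (chartAt Plane c).source := Measure.restrict_mono le_rfl h1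
      _ = chartMeasure o c := by
        rw [Measure.restrict_add, chartMeasure_restrict_source,
          Measure.restrict_restrict (measurableSet_source c), inter_compl_self,
          Measure.restrict_empty, add_zero]
  · rw [← chartMeasure_restrict_source o c]
    exact Measure.restrict_mono le_rfl (hle c)

theorem riemVol_eq_chartMeasure {c : M} {A : Set M} (hA : MeasurableSet A)
    (hc : A ⊆ (chartAt Plane c).source) : riemVol g A = chartMeasure o c A := by
  rw [← riemVol_restrict_source o c, Measure.restrict_apply hA, inter_eq_left.2 hc]

/-- Isometries preserving the orientation preserve the Riemannian measure. -/
theorem map_riemVol [SecondCountableTopology M] (f : M ≃ₜ M) (hf : ContMDiff (𝓡 2) (𝓡 2) ∞ f)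
    (hiso : ∀ x v w, g.inner (f x) (mfderiv (𝓡 2) (𝓡 2) f x v) (mfderiv (𝓡 2) (𝓡 2) f x w) =
      g.inner x v w)
    (hrot : ∀ x v, mfderiv (𝓡 2) (𝓡 2) f x (o.rot x v) =
      o.rot (f x) (mfderiv (𝓡 2) (𝓡 2) f x v)) :
    (riemVol g).map f.symm = riemVol g := by
  obtain ⟨s, hs, hU⟩ := exists_countable_chart_cover (M := M)
  have : Countable s := hs.to_subtype
  have hU' : ⋃ ij : s × s, (chartAt Plane (ij.1 : M)).source ∩
      f ⁻¹' (chartAt Plane (ij.2 : M)).source = univ := by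
    refine eq_univ_of_forall fun x => ?_
    obtain ⟨i, hi⟩ := mem_iUnion.1 (hU ▸ mem_univ x)
    obtain ⟨j, hj⟩ := mem_iUnion.1 (hU ▸ mem_univ (f x))
    exact mem_iUnion.2 ⟨(i, j), hi, hj⟩
  rw [Measure.ext_iff_of_iUnion_eq_univ hU']
  rintro ⟨i, j⟩
  ext A hA
  have hT : MeasurableSet ((chartAt Plane (i : M)).source ∩
      f ⁻¹' (chartAt Plane (j : M)).source) :=
    (measurableSet_source _).inter (f.continuous.measurable (measurableSet_source _))
  have hAT := hA.inter hT
  rw [Measure.restrict_apply hA, Measure.restrict_apply hA,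
    Measure.map_apply f.symm.continuous.measurable hAT]
  have himg : f.symm ⁻¹' (A ∩ ((chartAt Plane (i : M)).source ∩
      f ⁻¹' (chartAt Plane (j : M)).source)) = f '' (A ∩ ((chartAt Plane (i : M)).source ∩
      f ⁻¹' (chartAt Plane (j : M)).source)) := (f.image_eq_preimage_symm _).symm
  have hfA := f.measurableEmbedding.measurableSet_image.2 hAT
  rw [himg, riemVol_eq_chartMeasure o hAT (fun x hx => hx.2.1),
    riemVol_eq_chartMeasure (c := (j : M)) o hfA (by rintro _ ⟨x, hx, rfl⟩; exact hx.2.2)]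
  exact chartMeasure_image o f hf hiso hrot hAT (fun x hx => hx.2.1) (fun x hx => hx.2.2)

theorem map_chart_restrict_source (c : M) :
    ((riemVol g).restrict (chartAt Plane c).source).map (chartAt Plane c) =
      (volume.restrict (chartAt Plane c).target).withDensity (areaDensity o c) := by
  have he : AEMeasurable (chartAt Plane c) (chartMeasure o c) := by
    rw [← riemVol_restrict_source o c]
    exact (chartAt Plane c).continuousOn.aemeasurable (measurableSet_source c)
  rw [riemVol_restrict_source o c, chartMeasure,
    AEMeasurable.map_map_of_aemeasurable he (aemeasurable_chart_symm o c)]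
  refine (Measure.map_congr ?_).trans Measure.map_id
  refine (withDensity_absolutelyContinuous _ _).ae_le ?_
  filter_upwards [ae_restrict_mem (measurableSet_target c)] with y hy
  exact (chartAt Plane c).right_inv hy

theorem aemeasurable_chart (c : M) :
    AEMeasurable (chartAt Plane c) ((riemVol g).restrict (chartAt Plane c).source) :=
  (chartAt Plane c).continuousOn.aemeasurable (measurableSet_source c)

/-- Null sets can be recognized in charts. -/
theorem ae_restrict_source_iff (o : SurfaceOrientation g) (c : M) {P : M → Prop} :
    (∀ᵐ x ∂(riemVol g).restrict (chartAt Plane c).source, P x) ↔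
      ∀ᵐ y ∂volume.restrict (chartAt Plane c).target, P ((chartAt Plane c).symm y) := by
  constructor
  · intro h
    rw [riemVol_restrict_source o c, chartMeasure] at h
    have h2 := ae_of_ae_map (aemeasurable_chart_symm o c) h
    refine (withDensity_absolutelyContinuous' (aemeasurable_areaDensity o c) ?_).ae_le h2
    filter_upwards [ae_restrict_mem (measurableSet_target c)] with y hy
    exact areaDensity_ne_zero o c hy
  · intro h
    have h1 := (withDensity_absolutelyContinuous _ (areaDensity o c)).ae_le h
    rw [← map_chart_restrict_source o c] at h1
    filter_upwards [ae_of_ae_map (aemeasurable_chart c) h1,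
      ae_restrict_mem (measurableSet_source c)] with x hx hxs
    rwa [(chartAt Plane c).left_inv hxs] at hx

theorem ae_iff_forall_chart (o : SurfaceOrientation g) [SecondCountableTopology M] {P : M → Prop} :
    (∀ᵐ x ∂riemVol g, P x) ↔
      ∀ c : M, ∀ᵐ y ∂volume.restrict (chartAt Plane c).target, P ((chartAt Plane c).symm y) := by
  constructor
  · intro h c
    exact (ae_restrict_source_iff o c).1 (ae_restrict_of_ae h)
  · intro h
    obtain ⟨s, hs, hU⟩ := exists_countable_chart_cover (M := M)
    have : Countable s := hs.to_subtype
    rw [← Measure.restrict_univ (μ := riemVol g), ← hU, ae_restrict_iUnion_iff]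
    exact fun c => (ae_restrict_source_iff o c).2 (h c)

theorem aestronglyMeasurable_restrict_source_iff (o : SurfaceOrientation g) {E : Type*}
    [NormedAddCommGroup E] (c : M) {k : M → E} :
    AEStronglyMeasurable k ((riemVol g).restrict (chartAt Plane c).source) ↔
      AEStronglyMeasurable (fun y => k ((chartAt Plane c).symm y))
        (volume.restrict (chartAt Plane c).target) := by
  constructor
  · intro h
    rw [riemVol_restrict_source o c, chartMeasure] at h
    have h2 := h.comp_aemeasurable (aemeasurable_chart_symm o c)
    refine h2.mono_ac (withDensity_absolutelyContinuous' (aemeasurable_areaDensity o c) ?_)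
    filter_upwards [ae_restrict_mem (measurableSet_target c)] with y hy
    exact areaDensity_ne_zero o c hy
  · intro h
    have h1 := h.mono_ac (withDensity_absolutelyContinuous _ (areaDensity o c))
    rw [← map_chart_restrict_source o c] at h1
    refine (h1.comp_aemeasurable (aemeasurable_chart c)).congr ?_
    filter_upwards [ae_restrict_mem (measurableSet_source c)] with x hxs
    rw [Function.comp_apply, (chartAt Plane c).left_inv hxs]

theorem aestronglyMeasurable_iff_forall_chart (o : SurfaceOrientation g)
    [SecondCountableTopology M] {E : Type*} [NormedAddCommGroup E] {k : M → E} :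
    AEStronglyMeasurable k (riemVol g) ↔ ∀ c : M,
      AEStronglyMeasurable (fun y => k ((chartAt Plane c).symm y))
        (volume.restrict (chartAt Plane c).target) := by
  constructor
  · intro h c
    exact (aestronglyMeasurable_restrict_source_iff o c).1 h.restrict
  · intro h
    obtain ⟨s, hs, hU⟩ := exists_countable_chart_cover (M := M)
    have : Countable s := hs.to_subtype
    rw [← Measure.restrict_univ (μ := riemVol g), ← hU, aestronglyMeasurable_iUnion_iff]
    exact fun c => (aestronglyMeasurable_restrict_source_iff o c).2 (h c)

/-- Integration in a chart. -/
theorem integrableOn_source_iff (c : M) {k : M → ℝ}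
    (hk : AEStronglyMeasurable k ((riemVol g).restrict (chartAt Plane c).source)) :
    IntegrableOn k (chartAt Plane c).source (riemVol g) ↔
      IntegrableOn (fun y => |areaCoeff o c ((chartAt Plane c).symm y)| *
        k ((chartAt Plane c).symm y)) (chartAt Plane c).target := by
  rw [riemVol_restrict_source o c, chartMeasure] at hk
  rw [IntegrableOn, riemVol_restrict_source o c, chartMeasure,
    integrable_map_measure hk (aemeasurable_chart_symm o c),
    integrable_withDensity_iff_integrable_smul₀' (aemeasurable_areaDensity o c)
      (ae_of_all _ fun y => ENNReal.ofReal_lt_top)]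
  simp only [toReal_areaDensity, smul_eq_mul, Function.comp_apply]
  rfl

theorem setIntegral_source_chart (c : M) {k : M → ℝ}
    (hk : AEStronglyMeasurable k ((riemVol g).restrict (chartAt Plane c).source)) :
    ∫ x in (chartAt Plane c).source, k x ∂riemVol g =
      ∫ y in (chartAt Plane c).target, |areaCoeff o c ((chartAt Plane c).symm y)| *
        k ((chartAt Plane c).symm y) := by
  rw [riemVol_restrict_source o c, chartMeasure] at hk ⊢
  rw [integral_map (aemeasurable_chart_symm o c) hk,
    integral_withDensity_eq_integral_toReal_smul₀ (aemeasurable_areaDensity o c)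
      (ae_of_all _ fun y => ENNReal.ofReal_lt_top)]
  simp only [toReal_areaDensity, smul_eq_mul]

end Measure

/-! ### The deck group -/

section Deck

variable {M : Type*} [TopologicalSpace M] [ChartedSpace Plane M] [IsManifold (𝓡 2) ∞ M]
  {g : Metric M} {o : SurfaceOrientation g} {Γ : Type*} [Group Γ] [MulAction Γ M]

theorem IsDeckAction.continuousConstSMul (h : IsDeckAction Γ g o) : ContinuousConstSMul Γ M :=
  ⟨fun γ => (h.contMDiff γ).continuous⟩

theorem IsDeckAction.smulInvariantMeasure [MeasurableSpace M] [BorelSpace M]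
    [SecondCountableTopology M] (h : IsDeckAction Γ g o) : SMulInvariantMeasure Γ M (riemVol g) := by
  have := h.continuousConstSMul
  refine ⟨fun γ s hs => ?_⟩
  have hm := map_riemVol o (Homeomorph.smul γ⁻¹) (h.contMDiff γ⁻¹) (h.isometry γ⁻¹) (h.oriented γ⁻¹)
  nth_rewrite 2 [← hm]
  rw [Measure.map_apply (Homeomorph.smul γ⁻¹).symm.continuous.measurable hs]
  congr 1
  ext x
  simp [Homeomorph.smul_symm_apply]

end Deck

/-! ### Weak differentials on the surface -/

section WeakDiff

variable {M : Type*} [TopologicalSpace M] [ChartedSpace Plane M]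

/-- `df` is the weak differential of `f`, with both in `L^p_loc`, in terms of the frames
`coordAt`. -/
def HasWeakDiff (p : ℝ≥0∞) (f : M → ℝ) (df : OneForm M ℝ) : Prop :=
  ∀ c : M, WeakGrad p (chartAt Plane c).target (fun y => f ((chartAt Plane c).symm y))
    (fun i y => df ((chartAt Plane c).symm y) (coordAt c ((chartAt Plane c).symm y) i))

theorem IsW1locScalar.hasWeakDiff {p : ℝ} {f : M → ℝ} {df : OneForm M ℝ}
    (h : IsW1locScalar p f df) : HasWeakDiff (ENNReal.ofReal p) f df := by
  intro c
  obtain ⟨h1, h2⟩ := h c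
  refine ⟨fun K hK hKc => (h1 K hK hKc).1, fun K hK hKc i => ?_, fun φ hφ hφs hφc i => ?_⟩
  · refine ((h1 K hK hKc).2 i).ae_eq ?_
    filter_upwards [ae_restrict_mem hK.measurableSet] with y hy
    rw [coordVec_eq_coordAt c (hKc hy)]
  · rw [h2 φ hφ hφs hφc i]
    congr 1
    refine setIntegral_congr_fun (measurableSet_target c) fun y hy => ?_
    simp only [coordVec_eq_coordAt c hy]

section Vector

variable {V : Type*} [AddCommGroup V] [Module ℝ V]

/-- The analogue of `HasWeakDiff` for functions with values in a vector space, tested on linear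
functionals. -/
def HasWeakDiffV (p : ℝ≥0∞) (ξ : M → V) (dξ : OneForm M V) : Prop :=
  ∀ l : V →ₗ[ℝ] ℝ, HasWeakDiff p (fun x => l (ξ x)) (fun x => l ∘ₗ dξ x)

theorem IsW1loc.hasWeakDiffV {p : ℝ} {ξ : M → V} {dξ : OneForm M V} (h : IsW1loc p ξ dξ) :
    HasWeakDiffV (ENNReal.ofReal p) ξ dξ := fun l => (h l).hasWeakDiff

end Vector

/-- The part of an open set seen in the chart at `c`. -/
def chartSet (c : M) (U : Set M) : Set Plane :=
  (chartAt Plane c).target ∩ (chartAt Plane c).symm ⁻¹' U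

theorem isOpen_chartSet (c : M) {U : Set M} (hU : IsOpen U) : IsOpen (chartSet c U) :=
  (chartAt Plane c).isOpen_inter_preimage_symm hU

theorem HasWeakDiff.zero (p : ℝ≥0∞) : HasWeakDiff p (fun _ : M => 0) (fun _ => 0) :=
  fun _ => WeakGrad.zero

theorem ae_eq_of_forall_dual {V : Type*} [AddCommGroup V] [Module ℝ V] [Module.Finite ℝ V]
    [MeasurableSpace M] {μ : Measure M} {P : M → Prop} {A C : OneForm M V}
    (h : ∀ l : V →ₗ[ℝ] ℝ, ∀ᵐ x ∂μ, P x → l ∘ₗ A x = l ∘ₗ C x) : ∀ᵐ x ∂μ, P x → A x = C x := by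
  set b := Module.finBasis ℝ V
  have h1 := ae_all_iff.2 fun i => h (b.coord i)
  filter_upwards [h1] with x hx hP
  ext v
  refine b.ext_elem fun i => ?_
  exact congrArg (fun L => L v) (hx i hP)

variable [IsManifold (𝓡 2) ∞ M]

theorem ext_coordAt {V : Type*} [AddCommGroup V] [Module ℝ V] {c x : M}
    (hx : x ∈ (chartAt Plane c).source) {A C : TangentSpace (𝓡 2) x →ₗ[ℝ] V}
    (h : ∀ i, A (coordAt c x i) = C (coordAt c x i)) : A = C := by
  ext v
  rw [eq_sum_coordAt c hx v]
  simp only [map_add, map_smul, h]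

variable {g : Metric M} [MeasurableSpace M] [BorelSpace M] [SecondCountableTopology M]

/-- A property holding almost everywhere in a coordinate neighbourhood of each point holds almost
everywhere. -/
theorem ae_of_forall_exists_chartSet (o : SurfaceOrientation g) {P : M → Prop}
    (h : ∀ x, ∃ U, IsOpen U ∧ x ∈ U ∧
      ∀ᵐ y ∂volume.restrict (chartSet x U), P ((chartAt Plane x).symm y)) :
    ∀ᵐ x ∂riemVol g, P x := by
  choose U hU hxU hP using h
  obtain ⟨s, hs, hsU⟩ := TopologicalSpace.countable_cover_nhds
    (f := fun x => (chartAt Plane x).source ∩ U x)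
    (fun x => inter_mem (chart_source_mem_nhds Plane x) ((hU x).mem_nhds (hxU x)))
  have h1 : ∀ c ∈ s, ∀ᵐ x ∂riemVol g, x ∈ (chartAt Plane c).source ∩ U c → P x := by
    intro c _
    have h2 : ∀ᵐ x ∂(riemVol g).restrict (chartAt Plane c).source, x ∈ U c → P x := by
      rw [ae_restrict_source_iff o c]
      have h3 := hP c
      rw [ae_restrict_iff' (isOpen_chartSet c (hU c)).measurableSet] at h3
      rw [ae_restrict_iff' (measurableSet_target c)]
      filter_upwards [h3] with y hy hyt hyU
      exact hy ⟨hyt, hyU⟩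
    rw [ae_restrict_iff' (measurableSet_source c)] at h2
    filter_upwards [h2] with x hx hxU
    exact hx hxU.1 hxU.2
  rw [← ae_ball_iff hs] at h1
  filter_upwards [h1] with x hx
  have hx' : x ∈ ⋃ c ∈ s, (chartAt Plane c).source ∩ U c := hsU ▸ mem_univ x
  obtain ⟨c, hc, hxc⟩ := mem_iUnion₂.1 hx'
  exact hx c hc hxc

/-- Uniqueness of weak differentials. -/
theorem HasWeakDiff.ae_eq (o : SurfaceOrientation g) {p q : ℝ≥0∞} (hp : 1 ≤ p) (hq : 1 ≤ q)
    {f h : M → ℝ} {df dh : OneForm M ℝ} (hf : HasWeakDiff p f df) (hh : HasWeakDiff q h dh)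
    {U : Set M} (hU : IsOpen U) (hfh : ∀ x ∈ U, f x = h x) :
    ∀ᵐ x ∂riemVol g, x ∈ U → df x = dh x := by
  rw [ae_iff_forall_chart o]
  intro c
  have hW := isOpen_chartSet c hU
  have key : ∀ i, ∀ᵐ y ∂volume.restrict (chartSet c U),
      df ((chartAt Plane c).symm y) (coordAt c ((chartAt Plane c).symm y) i) =
        dh ((chartAt Plane c).symm y) (coordAt c ((chartAt Plane c).symm y) i) := fun i =>
    ((hf c).restrict inter_subset_left).grad_ae_eq hp hq ((hh c).restrict inter_subset_left) hW
      (by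
        filter_upwards [ae_restrict_mem hW.measurableSet] with y hy
        exact hfh _ hy.2) i
  have key2 := (ae_restrict_iff' hW.measurableSet).1 (ae_all_iff.2 key)
  rw [ae_restrict_iff' (measurableSet_target c)]
  filter_upwards [key2] with y hy hyt hyU
  exact ext_coordAt ((chartAt Plane c).map_target hyt) (hy ⟨hyt, hyU⟩)

variable {Γ : Type*} [Group Γ] [MulAction Γ M] {o : SurfaceOrientation g}

/-- The chain rule for weak differentials under the deck group. -/
theorem HasWeakDiff.ae_eq_comp_smul (hΓ : IsDeckAction Γ g o) {p q : ℝ≥0∞} (hp : 1 ≤ p)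
    (hq : 1 ≤ q) {f h : M → ℝ} {df dh : OneForm M ℝ} (hf : HasWeakDiff p f df)
    (hh : HasWeakDiff q h dh) (γ : Γ) (hfh : ∀ x, h x = f (γ • x)) :
    ∀ᵐ x ∂riemVol g, dh x =
      df (γ • x) ∘ₗ (mfderiv (𝓡 2) (𝓡 2) (fun x : M => γ • x) x).toLinearMap := by
  have := hΓ.continuousConstSMul
  refine ae_of_forall_exists_chartSet o fun c => ?_
  set c' : M := γ • c with hc'
  obtain ⟨s, hs, hsc⟩ : ∃ s : ℝ, |s| = 1 ∧ 0 < s * areaCoeff o c c := by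
    rcases lt_or_gt_of_ne (areaCoeff_ne_zero o (mem_chart_source Plane c)) with h0 | h0
    · exact ⟨-1, by simp, by linarith⟩
    · exact ⟨1, by simp, by linarith⟩
  obtain ⟨s', hs', hsc'⟩ : ∃ s : ℝ, |s| = 1 ∧ 0 < s * areaCoeff o c' c' := by
    rcases lt_or_gt_of_ne (areaCoeff_ne_zero o (mem_chart_source Plane c')) with h0 | h0
    · exact ⟨-1, by simp, by linarith⟩
    · exact ⟨1, by simp, by linarith⟩
  -- a neighbourhood of `c` on which the Jacobian determinant has constant sign
  set U1 : Set M := (chartAt Plane c).source ∩ (fun x => s * areaCoeff o c x) ⁻¹' Ioi 0 with hU1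
  set U2 : Set M := (chartAt Plane c').source ∩ (fun x => s' * areaCoeff o c' x) ⁻¹' Ioi 0 with hU2
  have hU1o : IsOpen U1 := (continuousOn_const.mul (continuousOn_areaCoeff o c)).isOpen_inter_preimage
    (chartAt Plane c).open_source isOpen_Ioi
  have hU2o : IsOpen U2 :=
    (continuousOn_const.mul (continuousOn_areaCoeff o c')).isOpen_inter_preimage
      (chartAt Plane c').open_source isOpen_Ioi
  set U : Set M := U1 ∩ (fun x => γ • x) ⁻¹' U2 with hU
  have hUo : IsOpen U := hU1o.inter (hU2o.preimage (continuous_const_smul γ))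
  refine ⟨U, hUo, ⟨⟨mem_chart_source Plane c, hsc⟩, mem_chart_source Plane c', hsc'⟩, ?_⟩
  set S := chartSet c U with hS
  have hSo : IsOpen S := isOpen_chartSet c hUo
  set e : OpenPartialHomeomorph Plane Plane := ((chartAt Plane c).symm.trans
    ((Homeomorph.smul γ).toOpenPartialHomeomorph.trans (chartAt Plane c'))).restrOpen S hSo with he
  have hcoe : ∀ y, e y = chartMap (fun x : M => γ • x) c c' y := fun y => rfl
  have hcoe' : ∀ z, e.symm z = chartMap (fun x : M => γ⁻¹ • x) c' c z := fun z => rfl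
  have hsource : e.source = S := by
    rw [he, OpenPartialHomeomorph.restrOpen_source]
    refine inter_eq_right.2 fun y hy => ?_
    simp only [OpenPartialHomeomorph.trans_source, OpenPartialHomeomorph.symm_source, mem_inter_iff,
      mem_preimage]
    exact ⟨hy.1, mem_univ _, hy.2.2.1⟩
  have hfune : (e : Plane → Plane) = chartMap (fun x : M => γ • x) c c' := funext hcoe
  have hfune' : (e.symm : Plane → Plane) = chartMap (fun x : M => γ⁻¹ • x) c' c := funext hcoe'
  have hl : ∀ y ∈ S, (chartAt Plane c').symm (e y) = γ • (chartAt Plane c).symm y := fun y hy =>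
    (chartAt Plane c').left_inv hy.2.2.1
  have hsm : ContDiffOn ℝ ∞ e e.source := by
    rw [hsource, hfune]
    intro y hy
    have h1 := contDiffAt_chartMap (hΓ.contMDiff γ) (c := c) (c' := c') hy.2.1.1 hy.2.2.1
    rw [(chartAt Plane c).right_inv hy.1] at h1
    exact h1.contDiffWithinAt
  have hpt : ∀ z ∈ e.target, ∃ x ∈ U, z = chartAt Plane c' (γ • x) := by
    intro z hz
    have h1 := e.map_target hz
    rw [hsource] at h1
    refine ⟨(chartAt Plane c).symm (e.symm z), h1.2, ?_⟩
    rw [← hl _ h1, e.right_inv hz, (chartAt Plane c').right_inv]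
    have h2 : e (e.symm z) ∈ (chartAt Plane c').target :=
      (chartAt Plane c').map_source h1.2.2.1
    rwa [e.right_inv hz] at h2
  have hsm' : ContDiffOn ℝ ∞ e.symm e.target := by
    rw [hfune']
    intro z hz
    obtain ⟨x, hx, rfl⟩ := hpt z hz
    refine (contDiffAt_chartMap (hΓ.contMDiff γ⁻¹) (c := c') (c' := c) hx.2.1 ?_).contDiffWithinAt
    rw [inv_smul_smul]
    exact hx.1.1
  have hsign : ∀ z ∈ e.target, |(fderiv ℝ e.symm z).det| = s * s' * (fderiv ℝ e.symm z).det := by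
    intro z hz
    obtain ⟨x, hx, rfl⟩ := hpt z hz
    rw [hfune']
    have h1 := areaCoeff_map o (hΓ.contMDiff γ⁻¹) (c := c') (c' := c) hx.2.1
      (by rw [inv_smul_smul]; exact hx.1.1) (hΓ.isometry γ⁻¹ _) (hΓ.oriented γ⁻¹ _)
    rw [inv_smul_smul] at h1
    set d := (fderiv ℝ (chartMap (fun x : M => γ⁻¹ • x) c' c) (chartAt Plane c' (γ • x))).det
    have h2 : 0 < s * areaCoeff o c x := hx.1.2
    have h3 : 0 < s' * areaCoeff o c' (γ • x) := hx.2.2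
    have hss : s * s = 1 := by rw [← abs_mul_abs_self, hs, one_mul]
    have h4 : 0 < s * s' * d := by
      rw [h1] at h3
      have h5 : (s * s' * d) * (s * areaCoeff o c x) = s' * (d * areaCoeff o c x) := by
        linear_combination (s' * d * areaCoeff o c x) * hss
      rw [← h5] at h3
      exact (mul_pos_iff_of_pos_right h2).1 h3
    rw [← abs_of_pos h4, abs_mul, abs_mul, hs, hs', one_mul, one_mul]
  have hκ : WeakGrad p e.target (fun z => f ((chartAt Plane c').symm z))
      (fun j z => df ((chartAt Plane c').symm z) (coordAt c' ((chartAt Plane c').symm z) j)) := by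
    refine (hf c').restrict fun z hz => ?_
    obtain ⟨x, hx, rfl⟩ := hpt z hz
    exact (chartAt Plane c').map_source hx.2.1
  have hw := WeakGrad.comp_diffeo hp hsm hsm' hsign hκ
  rw [hsource] at hw
  have hw2 := (hh c).restrict (U := S) inter_subset_left
  have key : ∀ i, ∀ᵐ y ∂volume.restrict S, _ := fun i =>
    hw2.grad_ae_eq hq le_rfl hw hSo (by
      filter_upwards [ae_restrict_mem hSo.measurableSet] with y hy
      rw [hfh, hl y hy]) i
  filter_upwards [ae_all_iff.2 key, ae_restrict_mem hSo.measurableSet] with y hy hyS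
  have hxs : (chartAt Plane c).symm y ∈ (chartAt Plane c).source := hyS.2.1.1
  refine ext_coordAt hxs fun i => ?_
  rw [hy i, LinearMap.comp_apply, ContinuousLinearMap.coe_coe,
    mfderiv_coordAt (hΓ.contMDiff γ) hxs hyS.2.2.1 i, (chartAt Plane c).right_inv hyS.1, map_add,
    map_smul, map_smul, Fin.sum_univ_two, hl y hyS, hfune]
  rfl

variable {V : Type*} [AddCommGroup V] [Module ℝ V]

/-- Weak differentials of sections are equivariant. -/
theorem HasWeakDiffV.ae_equivariant [Module.Finite ℝ V] (hΓ : IsDeckAction Γ g o)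
    {act : Γ → V →ₗ[ℝ] V} {p : ℝ≥0∞} (hp : 1 ≤ p) {ξ : M → V} {dξ : OneForm M V}
    (h : HasWeakDiffV p ξ dξ) (he : ∀ (γ : Γ) (x : M), ξ (γ • x) = act γ (ξ x)) (γ : Γ) :
    ∀ᵐ x ∂riemVol g, act γ ∘ₗ dξ x =
      dξ (γ • x) ∘ₗ (mfderiv (𝓡 2) (𝓡 2) (fun x : M => γ • x) x).toLinearMap := by
  have key := ae_eq_of_forall_dual (μ := riemVol g) (P := fun _ => True)
    (A := fun x => act γ ∘ₗ dξ x) (C := fun x => dξ (γ • x) ∘ₗ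
      (mfderiv (𝓡 2) (𝓡 2) (fun x : M => γ • x) x).toLinearMap) (fun l => by
    filter_upwards [(h l).ae_eq_comp_smul hΓ hp hp (h (l ∘ₗ act γ)) γ fun x => by
      rw [he, LinearMap.comp_apply]] with x hx _
    exact hx)
  filter_upwards [key] with x hx
  exact hx trivial

/-- Weak differentials are local: they vanish wherever the function vanishes on an open set. -/
theorem HasWeakDiffV.ae_eq_zero [Module.Finite ℝ V] (o : SurfaceOrientation g) {p : ℝ≥0∞}
    (hp : 1 ≤ p) {ξ : M → V} {dξ : OneForm M V} (h : HasWeakDiffV p ξ dξ) {U : Set M}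
    (hU : IsOpen U) (h0 : ∀ x ∈ U, ξ x = 0) : ∀ᵐ x ∂riemVol g, x ∈ U → dξ x = 0 := by
  refine ae_eq_of_forall_dual (C := fun _ => 0) fun l => ?_
  filter_upwards [(h l).ae_eq o hp hp (HasWeakDiff.zero _) hU fun x hx => by
    rw [h0 x hx, map_zero]] with x hx hxU
  rw [hx hxU, LinearMap.comp_zero]

end WeakDiff

/-! ### Integrals of wedge products on the surface -/

section Wedge

variable {M : Type*} [TopologicalSpace M] [ChartedSpace Plane M]

/-- The differential of a function at a point, as a linear functional. -/
def dAt (χ : M → ℝ) (x : M) : TangentSpace (𝓡 2) x →ₗ[ℝ] ℝ :=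
  (mfderiv (𝓡 2) 𝓘(ℝ, ℝ) χ x : TangentSpace (𝓡 2) x →L[ℝ] ℝ).toLinearMap

theorem dAt_eq_zero {χ : M → ℝ} {x : M} (hx : x ∉ tsupport χ) : dAt χ x = 0 := by
  have h : χ =ᶠ[𝓝 x] fun _ => 0 := notMem_tsupport_iff_eventuallyEq.1 hx
  ext v
  have h1 := h.mfderiv_eq (I := 𝓡 2) (I' := 𝓘(ℝ, ℝ))
  rw [mfderiv_const] at h1
  exact congrArg (fun L : Plane →L[ℝ] ℝ => L v) h1

/-- The differential `χ du + dχ ⊗ u` of `χ u`. -/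
def dMul (χ : M → ℝ) {V : Type*} [AddCommGroup V] [Module ℝ V] (u : M → V) (du : OneForm M V) :
    OneForm M V :=
  fun x => χ x • du x + (dAt χ x).smulRight (u x)

theorem dMul_eq_zero {χ : M → ℝ} {x : M} (hx : x ∉ tsupport χ) {V : Type*}
    [AddCommGroup V] [Module ℝ V] (u : M → V) (du : OneForm M V) :
    dMul χ u du x = 0 := by
  rw [dMul, dAt_eq_zero hx, image_eq_zero_of_notMem_tsupport hx]
  ext v
  simp

theorem bilin_eq_sum_basis {V W : Type*} [AddCommGroup V] [Module ℝ V] [Module.Finite ℝ V]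
    [AddCommGroup W] [Module ℝ W] [Module.Finite ℝ W] (B : V →ₗ[ℝ] W →ₗ[ℝ] ℝ) (v : V) (w : W) :
    B v w = ∑ i, ∑ j, B (Module.finBasis ℝ V i) (Module.finBasis ℝ W j) *
      ((Module.finBasis ℝ V).coord i v * (Module.finBasis ℝ W).coord j w) := by
  conv_lhs => rw [← (Module.finBasis ℝ V).sum_repr v, ← (Module.finBasis ℝ W).sum_repr w]
  simp only [map_sum, LinearMap.sum_apply, map_smul, LinearMap.smul_apply, smul_eq_mul,
    Module.Basis.coord_apply, Finset.mul_sum]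
  rw [Finset.sum_comm]
  exact Finset.sum_congr rfl fun i _ => Finset.sum_congr rfl fun j _ => by ring

variable [IsManifold (𝓡 2) ∞ M]
  {g : Metric M} {o : SurfaceOrientation g} {V : Type*} [AddCommGroup V] [Module ℝ V]

/-- The function `(*(d(χ u)); dη)^♯`, written with weak differentials. -/
def wedgeFun (o : SurfaceOrientation g) (B : LinearMap.BilinForm ℝ V) (χ : M → ℝ) (u : M → V)
    (du dη : OneForm M V) (x : M) : ℝ :=
  pairing g B x (starAt o (dMul χ u du x)) (dη x)

/-- The set of points of the domain of the chart at `c` at which the chart has orientation `s`. -/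
def orientedSource (o : SurfaceOrientation g) (c : M) (s : ℝ) : Set M :=
  (chartAt Plane c).source ∩ (fun x => s * areaCoeff o c x) ⁻¹' Ioi 0

theorem isOpen_orientedSource (c : M) (s : ℝ) : IsOpen (orientedSource o c s) :=
  (continuousOn_const.mul (continuousOn_areaCoeff o c)).isOpen_inter_preimage
    (chartAt Plane c).open_source isOpen_Ioi

theorem pairing_eq_sum_basis [Module.Finite ℝ V] (o : SurfaceOrientation g)
    (B : LinearMap.BilinForm ℝ V) (x : M)
    (A C : TangentSpace (𝓡 2) x →ₗ[ℝ] V) :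
    pairing g B x A C = ∑ i, ∑ j, B (Module.finBasis ℝ V i) (Module.finBasis ℝ V j) *
      pairing g (LinearMap.mul ℝ ℝ) x ((Module.finBasis ℝ V).coord i ∘ₗ A)
        ((Module.finBasis ℝ V).coord j ∘ₗ C) := by
  obtain ⟨v, hv⟩ := exists_unit g x
  simp only [pairing_frame o hv, mul_add, Finset.sum_add_distrib, LinearMap.mul_apply',
    LinearMap.comp_apply]
  rw [← bilin_eq_sum_basis, ← bilin_eq_sum_basis]

variable [MeasurableSpace M] [BorelSpace M]

theorem integral_wedgeFun_scalar {p q : ℝ≥0∞} [ENNReal.HolderConjugate p q] (hp : 1 ≤ p)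
    (hp' : p ≠ ⊤) (hq : 1 ≤ q) {f h : M → ℝ} {df dh : OneForm M ℝ} (hf : HasWeakDiff p f df)
    (hfc : Continuous f) (hh : HasWeakDiff q h dh) {χ : M → ℝ}
    (hχ : ContMDiff (𝓡 2) 𝓘(ℝ, ℝ) ∞ χ) (hχs : HasCompactSupport χ) {c : M} {s : ℝ} (hs : |s| = 1)
    (hχc : tsupport χ ⊆ orientedSource o c s) :
    Integrable (wedgeFun o (LinearMap.mul ℝ ℝ) χ f df dh) (riemVol g) ∧
      ∫ x, wedgeFun o (LinearMap.mul ℝ ℝ) χ f df dh x ∂riemVol g = 0 := by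
  set e := chartAt Plane c with he
  set Ω := chartSet c (orientedSource o c s) with hΩ
  have hΩo : IsOpen Ω := isOpen_chartSet c (isOpen_orientedSource c s)
  have hΩt : Ω ⊆ e.target := inter_subset_left
  set k := wedgeFun o (LinearMap.mul ℝ ℝ) χ f df dh with hk
  set C : Set Plane := e '' tsupport χ with hC
  have hCc : IsCompact C := IsCompact.image_of_continuousOn hχs
    (e.continuousOn.mono (hχc.trans inter_subset_left))
  have hCΩ : C ⊆ Ω := by
    rintro _ ⟨x, hx, rfl⟩
    have hxs := (hχc hx).1
    refine ⟨e.map_source hxs, ?_⟩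
    rw [mem_preimage, ← he, e.left_inv hxs]
    exact hχc hx
  have hsm : ContDiffOn ℝ ∞ (fun y => χ (e.symm y)) Ω :=
    (((hχ.contMDiffOn (s := univ)).comp (contMDiffOn_chart_symm (I := 𝓡 2) (n := ∞) (x := c))
      (fun _ _ => mem_univ _)).contDiffOn).mono hΩt
  have hz : ∀ y ∈ Ω, y ∉ C → χ (e.symm y) = 0 := fun y hy hyC =>
    image_eq_zero_of_notMem_tsupport fun h => hyC ⟨_, h, e.right_inv (hΩt hy)⟩
  obtain ⟨h1, h2, h3⟩ := contDiff_indicator_of_compact hΩo hCc hCΩ hsm hz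
  set χ' : Plane → ℝ := Ω.indicator fun y => χ (e.symm y) with hχ'
  have hfc' : ContinuousOn (fun y => f (e.symm y)) Ω :=
    hfc.comp_continuousOn (e.continuousOn_symm.mono hΩt)
  obtain ⟨hW1, hW2⟩ := integral_wedge_eq_zero hp hp' hq hΩo ((hf c).restrict hΩt) hfc'
    ((hh c).restrict hΩt) h1 h2 h3
  set W : Plane → ℝ := fun y =>
    (χ' y * df (e.symm y) (coordAt c (e.symm y) 0) + fderiv ℝ χ' y (stdVec 0) * f (e.symm y)) *
      dh (e.symm y) (coordAt c (e.symm y) 1) -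
    (χ' y * df (e.symm y) (coordAt c (e.symm y) 1) + fderiv ℝ χ' y (stdVec 1) * f (e.symm y)) *
      dh (e.symm y) (coordAt c (e.symm y) 0) with hW
  have hW0 : ∀ y, y ∉ Ω → W y = 0 := by
    intro y hy
    have hy' : y ∉ tsupport χ' := fun h => hy (h3 h)
    have e1 : fderiv ℝ χ' y = 0 := by
      by_contra h
      exact hy' (support_fderiv_subset ℝ h)
    simp only [hW, image_eq_zero_of_notMem_tsupport hy', e1]
    simp
  have hk0 : ∀ x, x ∉ tsupport χ → k x = 0 := by
    intro x hx
    rw [hk, wedgeFun, dMul_eq_zero hx]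
    simp [pairing, starAt]
  have key : ∀ y ∈ e.target, |areaCoeff o c (e.symm y)| * k (e.symm y) = s * W y := by
    intro y hy
    by_cases hyΩ : y ∈ Ω
    · have hpos : 0 < s * areaCoeff o c (e.symm y) := hyΩ.2.2
      have hab : |areaCoeff o c (e.symm y)| = s * areaCoeff o c (e.symm y) := by
        rw [← abs_of_pos hpos, abs_mul, hs, one_mul]
      have hpair := pairing_starAt_mul (B := LinearMap.mul ℝ ℝ) o (coordAt c (e.symm y))
        (dMul χ f df (e.symm y)) (dh (e.symm y))
      have e1 : χ' y = χ (e.symm y) := indicator_of_mem hyΩ _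
      have e2 : ∀ i, fderiv ℝ χ' y (stdVec i) = dAt χ (e.symm y) (coordAt c (e.symm y) i) := by
        intro i
        have e3 : χ' =ᶠ[𝓝 y] χ ∘ e.symm := by
          filter_upwards [hΩo.mem_nhds hyΩ] with z hz
          exact indicator_of_mem hz _
        have e4 := fderiv_comp_chart_symm (c := c) (e.map_target hy)
          (hχ.mdifferentiable (by simp) (e.symm y)) i
        rw [← he, e.right_inv hy] at e4
        rw [e3.fderiv_eq, e4]
        rfl
      have e5 : ∀ i, dMul χ f df (e.symm y) (coordAt c (e.symm y) i) =
          χ' y * df (e.symm y) (coordAt c (e.symm y) i) +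
            fderiv ℝ χ' y (stdVec i) * f (e.symm y) := by
        intro i
        rw [e1, e2]
        simp [dMul]
      rw [LinearMap.mul_apply', LinearMap.mul_apply', e5, e5] at hpair
      have e6 : W y = k (e.symm y) * areaCoeff o c (e.symm y) := hpair.symm
      rw [hab, e6]
      ring
    · rw [hW0 y hyΩ, hk0, mul_zero, mul_zero]
      intro h
      exact hyΩ ⟨hy, hχc h⟩
  have hmeas : AEStronglyMeasurable k ((riemVol g).restrict e.source) := by
    rw [aestronglyMeasurable_restrict_source_iff o c]
    have hinv : AEStronglyMeasurable (fun y => |areaCoeff o c (e.symm y)|⁻¹)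
        (volume.restrict e.target) :=
      ((continuousOn_areaCoeff_symm o c).abs.aemeasurable
        (measurableSet_target c)).inv.aestronglyMeasurable
    refine (hinv.mul (hW1.aestronglyMeasurable.const_mul s).restrict).congr ?_
    filter_upwards [ae_restrict_mem (measurableSet_target c)] with y hy
    have hne : |areaCoeff o c (e.symm y)| ≠ 0 :=
      abs_ne_zero.2 (areaCoeff_ne_zero o (e.map_target hy))
    simp only [Pi.mul_apply]
    rw [← key y hy, inv_mul_cancel_left₀ hne]
  have hint : IntegrableOn k e.source (riemVol g) := by
    rw [integrableOn_source_iff o c hmeas]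
    refine ((hW1.const_mul s).integrableOn (s := e.target)).congr_fun (fun y hy => (key y hy).symm)
      (measurableSet_target c)
  have hsupp : ∀ x, x ∉ e.source → k x = 0 := fun x hx => hk0 x fun h => hx (hχc h).1
  constructor
  · rwa [integrableOn_iff_integrable_of_support_subset] at hint
    intro x hx
    by_contra h
    exact hx (hsupp x h)
  · rw [← setIntegral_eq_integral_of_forall_compl_eq_zero hsupp, setIntegral_source_chart o c hmeas,
      setIntegral_congr_fun (measurableSet_target c) key, integral_const_mul,
      setIntegral_eq_integral_of_forall_compl_eq_zero, hW2, mul_zero]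
    intro y hy
    exact hW0 y fun h => hy (hΩt h)

/-- The integral of `d(χ u) ∧ dη` vanishes. -/
theorem integral_wedgeFun [Module.Finite ℝ V] (B : LinearMap.BilinForm ℝ V) {p q : ℝ≥0∞}
    [ENNReal.HolderConjugate p q] (hp : 1 ≤ p) (hp' : p ≠ ⊤) (hq : 1 ≤ q) {u η : M → V}
    {du dη : OneForm M V} (hu : HasWeakDiffV p u du)
    (huc : ∀ l : V →ₗ[ℝ] ℝ, Continuous fun x => l (u x)) (hη : HasWeakDiffV q η dη) {χ : M → ℝ}
    (hχ : ContMDiff (𝓡 2) 𝓘(ℝ, ℝ) ∞ χ) (hχs : HasCompactSupport χ) {c : M} {s : ℝ} (hs : |s| = 1)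
    (hχc : tsupport χ ⊆ orientedSource o c s) :
    Integrable (wedgeFun o B χ u du dη) (riemVol g) ∧
      ∫ x, wedgeFun o B χ u du dη x ∂riemVol g = 0 := by
  set b := Module.finBasis ℝ V with hb
  have h := fun i j => integral_wedgeFun_scalar (o := o) hp hp' hq (hu (b.coord i)) (huc _)
    (hη (b.coord j)) hχ hχs hs hχc
  have e : wedgeFun o B χ u du dη = fun x => ∑ i, ∑ j, B (b i) (b j) *
      wedgeFun o (LinearMap.mul ℝ ℝ) χ (fun x => b.coord i (u x)) (fun x => b.coord i ∘ₗ du x)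
        (fun x => b.coord j ∘ₗ dη x) x := by
    funext x
    rw [wedgeFun, pairing_eq_sum_basis o]
    refine Finset.sum_congr rfl fun i _ => Finset.sum_congr rfl fun j _ => ?_
    rw [wedgeFun]
    congr 2
    ext v
    simp [dMul, starAt_apply, hb]
  have hi : ∀ i j, Integrable (fun x => B (b i) (b j) *
      wedgeFun o (LinearMap.mul ℝ ℝ) χ (fun x => b.coord i (u x)) (fun x => b.coord i ∘ₗ du x)
        (fun x => b.coord j ∘ₗ dη x) x) (riemVol g) := fun i j => (h i j).1.const_mul _
  rw [e]
  refine ⟨integrable_finsetSum _ fun i _ => integrable_finsetSum _ fun j _ => hi i j, ?_⟩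
  rw [integral_finsetSum _ fun i _ => integrable_finsetSum _ fun j _ => hi i j]
  refine Finset.sum_eq_zero fun i _ => ?_
  rw [integral_finsetSum _ fun j _ => hi i j]
  refine Finset.sum_eq_zero fun j _ => ?_
  rw [integral_const_mul, (h i j).2, mul_zero]

end Wedge

/-! ### Partitions of unity over the deck group -/

section Partition

variable {M : Type*} [TopologicalSpace M] [ChartedSpace Plane M]
  {Γ : Type*} [Group Γ] [MulAction Γ M] [ProperlyDiscontinuousSMul Γ M]

/-- The translates of a compact set are locally finite. -/
theorem locallyFinite_smul_preimage {K : Set M} (hK : IsCompact K) :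
    LocallyFinite fun γ : Γ => {x : M | γ • x ∈ K} := by
  have : LocallyCompactSpace M := ChartedSpace.locallyCompactSpace Plane M
  intro x
  obtain ⟨N, hN, hxN⟩ := exists_compact_mem_nhds x
  refine ⟨N, hxN, (finite_disjoint_inter_image (Γ := Γ) hN hK).subset ?_⟩
  rintro γ ⟨y, hy, hyN⟩
  exact ⟨γ • y, ⟨y, hyN, rfl⟩, hy⟩

variable [ContinuousConstSMul Γ M]

theorem isOpen_forall_smul_notMem [T2Space M] {K : Set M} (hK : IsCompact K) :
    IsOpen {x : M | ∀ γ : Γ, γ • x ∉ K} := by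
  have h := (locallyFinite_smul_preimage (Γ := Γ) hK).isClosed_iUnion fun γ =>
    hK.isClosed.preimage (continuous_const_smul γ)
  rw [← isOpen_compl_iff] at h
  convert h using 1
  ext x
  simp

variable [IsManifold (𝓡 2) ∞ M]

/-- With `S` the smooth transition from `0` to `1`, the function `t ↦ 1 / (t + 1 - S t)` is smooth
on `[0, ∞)` by this positivity, and agrees with `1 / t` for `t ≥ 1`. -/
theorem smoothTransition_denom_pos {t : ℝ} (ht : 0 ≤ t) : 0 < t + 1 - Real.smoothTransition t := by
  rcases ht.eq_or_lt with rfl | h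
  · rw [Real.smoothTransition.zero]
    norm_num
  · have := Real.smoothTransition.le_one t
    linarith

variable [T2Space M] {g : Metric M}

theorem exists_bump_orientedSource (o : SurfaceOrientation g) (c : M) :
    ∃ (b : M → ℝ) (s : ℝ), |s| = 1 ∧ ContMDiff (𝓡 2) 𝓘(ℝ, ℝ) ∞ b ∧ HasCompactSupport b ∧
      tsupport b ⊆ orientedSource o c s ∧ (∀ x, 0 ≤ b x) ∧ ∀ᶠ x in 𝓝 c, b x = 1 := by
  obtain ⟨s, hs, hsc⟩ : ∃ s : ℝ, |s| = 1 ∧ 0 < s * areaCoeff o c c := by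
    rcases lt_or_gt_of_ne (areaCoeff_ne_zero o (mem_chart_source Plane c)) with h0 | h0
    · exact ⟨-1, by simp, by linarith⟩
    · exact ⟨1, by simp, by linarith⟩
  have hU : orientedSource o c s ∈ 𝓝 c :=
    (isOpen_orientedSource c s).mem_nhds ⟨mem_chart_source Plane c, hsc⟩
  obtain ⟨f, -, hf⟩ := (SmoothBumpFunction.nhds_basis_tsupport (I := 𝓡 2) c).mem_iff.1 hU
  exact ⟨f, s, hs, f.contMDiff, f.hasCompactSupport, hf, fun x => f.nonneg, f.eventuallyEq_one⟩

/-- A family of smooth functions supported in charts whose translates add up to one near the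
translates of a given compact set. -/
theorem exists_partition (o : SurfaceOrientation g)
    (hsm : ∀ γ : Γ, ContMDiff (𝓡 2) (𝓡 2) ∞ (fun x : M => γ • x)) {K : Set M}
    (hK : IsCompact K) :
    ∃ (t : Finset M) (χ : M → M → ℝ) (s : M → ℝ) (W : Set M), IsOpen W ∧
      (∀ x ∉ W, ∀ γ : Γ, γ • x ∉ K) ∧
      (∀ c ∈ t, |s c| = 1 ∧ ContMDiff (𝓡 2) 𝓘(ℝ, ℝ) ∞ (χ c) ∧ HasCompactSupport (χ c) ∧
        tsupport (χ c) ⊆ orientedSource o c (s c)) ∧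
      ∀ x ∈ W, ∑ᶠ γ : Γ, ∑ c ∈ t, χ c (γ • x) = 1 := by
  choose b s hs hb hbs hbt hb0 hb1 using exists_bump_orientedSource o
  obtain ⟨t, htK⟩ := hK.elim_nhds_subcover (fun c => interior {x | b c x = 1})
    (fun c _ => interior_mem_nhds.2 (hb1 c))
  set β : M → ℝ := fun x => ∑ c ∈ t, b c x with hβ
  have hβ0 : ∀ x, 0 ≤ β x := fun x => Finset.sum_nonneg fun c _ => hb0 c x
  have hβsm : ContMDiff (𝓡 2) 𝓘(ℝ, ℝ) ∞ β := contMDiff_finsetSum fun c _ => hb c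
  set C : Set M := ⋃ c ∈ t, tsupport (b c) with hC
  have hCc : IsCompact C := t.isCompact_biUnion fun c _ => hbs c
  have hβC : ∀ x ∉ C, β x = 0 := fun x hx => Finset.sum_eq_zero fun c hc =>
    image_eq_zero_of_notMem_tsupport fun h => hx (mem_biUnion hc h)
  have hlf : LocallyFinite fun γ : Γ => Function.support fun x => β (γ • x) :=
    (locallyFinite_smul_preimage hCc).subset fun γ x hx => by_contra fun h => hx (hβC _ h)
  set F : M → ℝ := fun x => ∑ᶠ γ : Γ, β (γ • x) with hF
  have hFsm : ContMDiff (𝓡 2) 𝓘(ℝ, ℝ) ∞ F := contMDiff_finsum (fun γ => hβsm.comp (hsm γ)) hlf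
  have hF0 : ∀ x, 0 ≤ F x := fun x => finsum_nonneg fun γ => hβ0 _
  have hFinv : ∀ (γ : Γ) x, F (γ • x) = F x := by
    intro γ x
    simp only [hF, ← mul_smul]
    exact finsum_comp_equiv (Equiv.mulRight γ) (f := fun γ' : Γ => β (γ' • x))
  set r : ℝ → ℝ := fun τ => (τ + 1 - Real.smoothTransition τ)⁻¹ with hr
  have hrF : ContMDiff (𝓡 2) 𝓘(ℝ, ℝ) ∞ fun x => r (F x) := by
    intro x
    have h1 : ContDiffAt ℝ ∞ r (F x) := ((contDiffAt_id.add contDiffAt_const).sub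
      Real.smoothTransition.contDiffAt).inv (smoothTransition_denom_pos (hF0 x)).ne'
    exact h1.contMDiffAt.comp x (hFsm x)
  set O : Set M := ⋃ c ∈ t, interior {x | b c x = 1} with hO
  have hOo : IsOpen O := isOpen_biUnion fun c _ => isOpen_interior
  refine ⟨t, fun c x => b c x * r (F x), s, ⋃ γ : Γ, (fun x => γ • x) ⁻¹' O,
    isOpen_iUnion fun γ => hOo.preimage (continuous_const_smul γ), ?_, ?_, ?_⟩
  · intro x hx γ hγ
    exact hx (mem_iUnion.2 ⟨γ, htK.2 hγ⟩)
  · intro c _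
    have hsub : tsupport (fun x => b c x * r (F x)) ⊆ tsupport (b c) := tsupport_mul_subset_left
    exact ⟨hs c, (hb c).mul hrF, (hbs c).mul_right, hsub.trans (hbt c)⟩
  · intro x hx
    obtain ⟨γ, hγ⟩ := mem_iUnion.1 hx
    obtain ⟨c, hc, hcγ⟩ := mem_iUnion₂.1 hγ
    have hfin : (Function.support fun γ : Γ => β (γ • x)).Finite := hlf.point_finite x
    have h1 : 1 ≤ F x := by
      have e1 : b c (γ • x) = 1 := interior_subset (s := {x | b c x = 1}) hcγ
      calc (1 : ℝ) = b c (γ • x) := e1.symm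
        _ ≤ β (γ • x) := Finset.single_le_sum (f := fun c => b c (γ • x)) (fun c _ => hb0 c _) hc
        _ ≤ F x := single_le_finsum γ hfin fun γ => hβ0 _
    have h2 : ∀ γ : Γ, ∑ c ∈ t, b c (γ • x) * r (F (γ • x)) = β (γ • x) * r (F x) := by
      intro γ
      rw [hFinv, ← Finset.sum_mul]
    simp only [h2]
    rw [← finsum_mul]
    change F x * r (F x) = 1
    rw [hr]
    simp only
    rw [Real.smoothTransition.one_of_one_le h1, add_sub_cancel_right,
      mul_inv_cancel₀ (by linarith)]

end Partition

/-! ### Folding integrals onto a fundamental domain -/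

section Fold

/-- If the translates of an integrable function add up to `h`, then the integral of `h` over a
fundamental domain is that of the function over the whole space. -/
theorem integral_fold {X Γ : Type*} [MeasurableSpace X] [Group Γ] [Countable Γ] [MulAction Γ X]
    [MeasurableConstSMul Γ X] {μ : Measure X} [SMulInvariantMeasure Γ X μ] {D : Set X}
    (hD : IsFundamentalDomain Γ D μ) {k h : X → ℝ} (hk : Integrable k μ)
    (hh : ∀ᵐ x ∂μ, HasSum (fun γ : Γ => k (γ • x)) (h x)) :
    IntegrableOn h D μ ∧ ∫ x in D, h x ∂μ = ∫ x, k x ∂μ := by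
  have hm : ∀ γ : Γ, AEStronglyMeasurable (fun x => k (γ • x)) (μ.restrict D) := fun γ =>
    ((measurePreserving_smul γ μ).integrable_comp_of_integrable hk).aestronglyMeasurable.restrict
  have hh' : ∀ᵐ x ∂μ.restrict D, HasSum (fun γ : Γ => k (γ • x)) (h x) := ae_restrict_of_ae hh
  have hfin : ∑' γ : Γ, ∫⁻ x in D, ‖k (γ • x)‖ₑ ∂μ ≠ ⊤ := by
    rw [← hD.lintegral_eq_tsum'' fun x => ‖k x‖ₑ]
    exact hk.2.ne
  refine ⟨⟨aestronglyMeasurable_of_tendsto_ae atTop (fun s : Finset Γ =>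
    Finset.aestronglyMeasurable_fun_sum s fun γ _ => hm γ) hh', ?_⟩, ?_⟩
  · refine lt_of_le_of_lt ?_ hfin.lt_top
    rw [← lintegral_tsum fun γ => (hm γ).enorm]
    refine lintegral_mono_ae ?_
    filter_upwards [hh'] with x hx
    rw [← hx.tsum_eq]
    exact enorm_tsum_le_tsum_enorm
  · rw [hD.integral_eq_tsum'' k hk, ← integral_tsum hm hfin]
    refine integral_congr_ae ?_
    filter_upwards [hh'] with x hx
    exact hx.tsum_eq.symm

variable {M : Type*} [TopologicalSpace M] [ChartedSpace Plane M]

theorem dAt_sum {ι : Type*} (s : Finset ι) {χ : ι → M → ℝ} {x : M}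
    (h : ∀ i ∈ s, MDifferentiableAt (𝓡 2) 𝓘(ℝ, ℝ) (χ i) x) :
    dAt (fun y => ∑ i ∈ s, χ i y) x = ∑ i ∈ s, dAt (χ i) x := by
  classical
  suffices H : MDifferentiableAt (𝓡 2) 𝓘(ℝ, ℝ) (fun y => ∑ i ∈ s, χ i y) x ∧
      dAt (fun y => ∑ i ∈ s, χ i y) x = ∑ i ∈ s, dAt (χ i) x from H.2
  induction s using Finset.induction_on with
  | empty =>
    refine ⟨mdifferentiableAt_const, ?_⟩
    rw [Finset.sum_empty]
    ext v
    exact congrArg (fun L : Plane →L[ℝ] ℝ => L v)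
      (mfderiv_const (I := 𝓡 2) (I' := 𝓘(ℝ, ℝ)) (c := (0 : ℝ)) (x := x))
  | insert a s ha ih =>
    obtain ⟨h1, h2⟩ := ih fun i hi => h i (by simp [hi])
    have ha' := h a (by simp)
    have e : (fun y => ∑ i ∈ insert a s, χ i y) = χ a + fun y => ∑ i ∈ s, χ i y := by
      ext y
      simp [Finset.sum_insert ha]
    rw [Finset.sum_insert ha, ← h2, e]
    refine ⟨ha'.add h1, ?_⟩
    ext v
    exact congrArg (fun L : Plane →L[ℝ] ℝ => L v) (mfderiv_add ha' h1)

variable {V : Type*} [AddCommGroup V] [Module ℝ V]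

theorem dMul_sum {ι : Type*} (s : Finset ι) {χ : ι → M → ℝ} {x : M}
    (h : ∀ i ∈ s, MDifferentiableAt (𝓡 2) 𝓘(ℝ, ℝ) (χ i) x) (u : M → V) (du : OneForm M V) :
    dMul (fun y => ∑ i ∈ s, χ i y) u du x = ∑ i ∈ s, dMul (χ i) u du x := by
  ext v
  simp only [dMul, dAt_sum s h, LinearMap.add_apply, LinearMap.smul_apply,
    LinearMap.smulRight_apply, LinearMap.sum_apply, Finset.sum_add_distrib, Finset.sum_smul]

theorem dMul_of_eventuallyEq_one {χ : M → ℝ} {x : M} (h : χ =ᶠ[𝓝 x] fun _ => 1) (u : M → V)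
    (du : OneForm M V) : dMul χ u du x = du x := by
  have h1 : dAt χ x = 0 := by
    have h2 := h.mfderiv_eq (I := 𝓡 2) (I' := 𝓘(ℝ, ℝ))
    rw [mfderiv_const] at h2
    ext v
    exact congrArg (fun L : Plane →L[ℝ] ℝ => L v) h2
  rw [dMul, h1, h.eq_of_nhds]
  ext v
  simp

variable [IsManifold (𝓡 2) ∞ M] {g : Metric M} {o : SurfaceOrientation g}
  {B : LinearMap.BilinForm ℝ V}

theorem starAt_sum {x : M} {ι : Type*} (s : Finset ι)
    (W : ι → TangentSpace (𝓡 2) x →ₗ[ℝ] V) :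
    starAt o (∑ i ∈ s, W i) = ∑ i ∈ s, starAt o (W i) := by
  ext v
  simp [starAt_apply, LinearMap.sum_apply]

theorem pairing_sum_left {x : M} {ι : Type*} (s : Finset ι)
    (W : ι → TangentSpace (𝓡 2) x →ₗ[ℝ] V) (C : TangentSpace (𝓡 2) x →ₗ[ℝ] V) :
    pairing g B x (∑ i ∈ s, W i) C = ∑ i ∈ s, pairing g B x (W i) C := by
  classical
  induction s using Finset.induction_on with
  | empty => simp [pairing]
  | insert a s ha ih => rw [Finset.sum_insert ha, Finset.sum_insert ha, pairing_add_left, ih]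

theorem pairing_zero_right {x : M} (A : TangentSpace (𝓡 2) x →ₗ[ℝ] V) : pairing g B x A 0 = 0 := by
  simp [pairing]

theorem starAt_zero {x : M} : starAt o (0 : TangentSpace (𝓡 2) x →ₗ[ℝ] V) = 0 := by
  ext v
  simp [starAt_apply]

theorem pairing_zero_left {x : M} (C : TangentSpace (𝓡 2) x →ₗ[ℝ] V) : pairing g B x 0 C = 0 := by
  simp [pairing]

variable {Γ : Type*} [Group Γ] [MulAction Γ M]

/-- The differential of the action of `γ`. -/
def dSmul (γ : Γ) (x : M) : TangentSpace (𝓡 2) x →ₗ[ℝ] TangentSpace (𝓡 2) (γ • x) :=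
  (mfderiv (𝓡 2) (𝓡 2) (fun x : M => γ • x) x).toLinearMap

theorem IsDeckAction.pairing_smul (hΓ : IsDeckAction Γ g o) (γ : Γ) (x : M)
    (A C : TangentSpace (𝓡 2) (γ • x) →ₗ[ℝ] V) :
    pairing g B (γ • x) A C = pairing g B x (A ∘ₗ dSmul γ x) (C ∘ₗ dSmul γ x) := by
  obtain ⟨v, hv⟩ := exists_unit g x
  have h1 : g.inner (γ • x) (dSmul γ x v) (dSmul γ x v) = 1 := (hΓ.isometry γ x v v).trans hv
  have h2 : dSmul γ x (o.rot x v) = o.rot (γ • x) (dSmul γ x v) := hΓ.oriented γ x v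
  rw [pairing_frame o hv, pairing_frame o h1]
  simp only [LinearMap.comp_apply, h2]

theorem IsDeckAction.starAt_comp (hΓ : IsDeckAction Γ g o) (γ : Γ) (x : M)
    (A : TangentSpace (𝓡 2) (γ • x) →ₗ[ℝ] V) :
    starAt o A ∘ₗ dSmul γ x = starAt o (A ∘ₗ dSmul γ x) := by
  ext v
  have h2 : dSmul γ x (o.rot x v) = o.rot (γ • x) (dSmul γ x v) := hΓ.oriented γ x v
  simp only [LinearMap.comp_apply, starAt_apply, h2]

theorem dAt_comp_smul (hΓ : IsDeckAction Γ g o) (γ : Γ) {x : M} {χ : M → ℝ}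
    (hχ : MDifferentiableAt (𝓡 2) 𝓘(ℝ, ℝ) χ (γ • x)) :
    dAt χ (γ • x) ∘ₗ dSmul γ x = dAt (fun y => χ (γ • y)) x := by
  have h := mfderiv_comp x (g := χ) (f := fun y : M => γ • y) hχ
    ((hΓ.contMDiff γ).mdifferentiable (by simp) x)
  ext v
  exact (congrArg (fun L : Plane →L[ℝ] ℝ => L v) h).symm

/-- Translation of the wedge product of equivariant forms. -/
theorem IsDeckAction.wedgeFun_smul (hΓ : IsDeckAction Γ g o) {act : V →ₗ[ℝ] V}
    (hB : ∀ v w, B (act v) (act w) = B v w) (γ : Γ) {x : M} {χ : M → ℝ}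
    (hχ : MDifferentiableAt (𝓡 2) 𝓘(ℝ, ℝ) χ (γ • x)) {u : M → V} {du dη : OneForm M V}
    (hu : u (γ • x) = act (u x)) (hdu : act ∘ₗ du x = du (γ • x) ∘ₗ dSmul γ x)
    (hdη : act ∘ₗ dη x = dη (γ • x) ∘ₗ dSmul γ x) :
    wedgeFun o B χ u du dη (γ • x) = wedgeFun o B (fun y => χ (γ • y)) u du dη x := by
  rw [wedgeFun, hΓ.pairing_smul, hΓ.starAt_comp, ← hdη]
  have e : dMul χ u du (γ • x) ∘ₗ dSmul γ x = act ∘ₗ dMul (fun y => χ (γ • y)) u du x := by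
    ext v
    have h1 := congrArg (fun L => L v) hdu
    have h2 := congrArg (fun L => L v) (dAt_comp_smul hΓ γ hχ)
    simp only [LinearMap.comp_apply] at h1 h2
    simp only [dMul, LinearMap.comp_apply, LinearMap.add_apply, LinearMap.smul_apply,
      LinearMap.smulRight_apply, map_add, map_smul, h1, h2, hu]
  rw [e, wedgeFun]
  obtain ⟨v, hv⟩ := exists_unit g x
  rw [pairing_frame o hv, pairing_frame o hv]
  simp only [starAt_apply, LinearMap.comp_apply, map_neg, LinearMap.neg_apply, hB]

variable [T2Space M] [SecondCountableTopology M] [MeasurableSpace M] [BorelSpace M] [Countable Γ]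
  [ProperlyDiscontinuousSMul Γ M] [Module.Finite ℝ V]

/-- `∫ (*du; dη)^♯ = 0` over a fundamental domain, for a continuous section `u` of class `W^{1,p}`
and a compactly supported section `η` of class `W^{1,q}`. -/
theorem pairsToZero_starAt (hΓ : IsDeckAction Γ g o) {D : Set M}
    (hD : IsFundamentalDomain Γ D (riemVol g)) {act : Γ → V →ₗ[ℝ] V}
    (hB : ∀ γ v w, B (act γ v) (act γ w) = B v w) {p q : ℝ≥0∞} [ENNReal.HolderConjugate p q]
    (hp : 1 ≤ p) (hp' : p ≠ ⊤) (hq : 1 ≤ q) {u η : M → V} {du dη : OneForm M V}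
    (hu : HasWeakDiffV p u du) (huc : ∀ l : V →ₗ[ℝ] ℝ, Continuous fun x => l (u x))
    (hue : ∀ (γ : Γ) x, u (γ • x) = act γ (u x)) (hη : HasWeakDiffV q η dη)
    (hηe : ∀ (γ : Γ) x, η (γ • x) = act γ (η x)) (hηs : CompactSupportMod Γ η) :
    PairsToZero g B D (fun x => starAt o (du x)) dη := by
  have := hΓ.continuousConstSMul
  have := hΓ.smulInvariantMeasure
  obtain ⟨K, hK, hηK⟩ := hηs
  obtain ⟨t, χ, s, W, hWo, hWK, hχ, hsum⟩ := exists_partition (Γ := Γ) o hΓ.contMDiff hK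
  set χt : M → ℝ := fun x => ∑ c ∈ t, χ c x with hχt
  have hχtsm : ContMDiff (𝓡 2) 𝓘(ℝ, ℝ) ∞ χt := contMDiff_finsetSum fun c hc => (hχ c hc).2.1
  set C : Set M := ⋃ c ∈ t, tsupport (χ c) with hC
  have hCc : IsCompact C := t.isCompact_biUnion fun c hc => (hχ c hc).2.2.1
  have hχtC : tsupport χt ⊆ C := closure_minimal (fun x hx => by
    by_contra h
    refine hx (Finset.sum_eq_zero fun c hc => ?_)
    exact image_eq_zero_of_notMem_tsupport fun h' => h (mem_biUnion hc h')) hCc.isClosed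
  set k : M → ℝ := wedgeFun o B χt u du dη with hk
  have hk1 : k = fun x => ∑ c ∈ t, wedgeFun o B (χ c) u du dη x := by
    funext x
    rw [hk, wedgeFun, hχt, dMul_sum t fun c hc => (hχ c hc).2.1.mdifferentiable (by simp) x,
      starAt_sum, pairing_sum_left]
    rfl
  have hint := fun c (hc : c ∈ t) => integral_wedgeFun B hp hp' hq hu huc hη (hχ c hc).2.1
    (hχ c hc).2.2.1 (hχ c hc).1 (hχ c hc).2.2.2
  have hki : Integrable k (riemVol g) := by
    rw [hk1]
    exact integrable_finsetSum _ fun c hc => (hint c hc).1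
  have hk0 : ∫ x, k x ∂riemVol g = 0 := by
    rw [hk1, integral_finsetSum _ fun c hc => (hint c hc).1]
    exact Finset.sum_eq_zero fun c hc => (hint c hc).2
  have hfold : ∀ᵐ x ∂riemVol g, HasSum (fun γ : Γ => k (γ • x))
      (pairing g B x (starAt o (du x)) (dη x)) := by
    have a1 := ae_all_iff.2 fun γ => hu.ae_equivariant hΓ hp hue γ
    have a2 := ae_all_iff.2 fun γ => hη.ae_equivariant hΓ hq hηe γ
    have a3 := hη.ae_eq_zero o hq (isOpen_forall_smul_notMem (Γ := Γ) hK) hηK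
    filter_upwards [a1, a2, a3] with x h1 h2 h3
    have hkx : ∀ γ : Γ, k (γ • x) = wedgeFun o B (fun y => χt (γ • y)) u du dη x := fun γ =>
      hΓ.wedgeFun_smul (hB γ) γ (hχtsm.mdifferentiable (by simp) _) (hue γ x) (h1 γ) (h2 γ)
    by_cases hxW : x ∈ W
    · -- near `x`, finitely many translates of `χt` add up to one
      obtain ⟨N, hN, hfin⟩ := locallyFinite_smul_preimage (Γ := Γ) hCc x
      set S := hfin.toFinset with hS
      have hout : ∀ γ ∉ S, ∀ y ∈ N, χt (γ • y) = 0 := by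
        intro γ hγ y hy
        by_contra h
        exact hγ (hfin.mem_toFinset.2 ⟨y, hχtC (subset_tsupport _ h), hy⟩)
      have hone : (fun y => ∑ γ ∈ S, χt (γ • y)) =ᶠ[𝓝 x] fun _ => 1 := by
        filter_upwards [hN, hWo.mem_nhds hxW] with y hyN hyW
        rw [← hsum y hyW, finsum_eq_sum_of_support_subset]
        intro γ hγ
        by_contra h
        exact hγ (hout γ h y hyN)
      have hd : ∀ γ ∈ S, MDifferentiableAt (𝓡 2) 𝓘(ℝ, ℝ) (fun y => χt (γ • y)) x := fun γ _ =>
        (hχtsm.comp (hΓ.contMDiff γ)).mdifferentiable (by simp) x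
      have e1 : du x = ∑ γ ∈ S, dMul (fun y => χt (γ • y)) u du x := by
        rw [← dMul_sum S hd, dMul_of_eventuallyEq_one hone]
      have e2 : pairing g B x (starAt o (du x)) (dη x) = ∑ γ ∈ S, k (γ • x) := by
        conv_lhs => rw [e1]
        rw [starAt_sum, pairing_sum_left]
        exact Finset.sum_congr rfl fun γ _ => (hkx γ).symm
      rw [e2]
      refine hasSum_sum_of_ne_finset_zero fun γ hγ => ?_
      have : γ • x ∉ tsupport χt := fun h =>
        hγ (hfin.mem_toFinset.2 ⟨x, hχtC h, mem_of_mem_nhds hN⟩)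
      rw [hk, wedgeFun, dMul_eq_zero this, starAt_zero, pairing_zero_left]
    · have h0 := h3 (hWK x hxW)
      simp only [hkx, wedgeFun, h0, pairing_zero_right]
      exact hasSum_zero
  obtain ⟨h1, h2⟩ := integral_fold hD hki hfold
  exact ⟨h1, h2.trans hk0⟩

end Fold

/-! ### Measurability of pairings -/

section FormMeasurable

variable {M : Type*} [TopologicalSpace M] [ChartedSpace Plane M]

/-- The components of the 1-form `W` in all charts are measurable. -/
def FormMeasurable {V : Type*} [AddCommGroup V] [Module ℝ V] (W : OneForm M V) : Prop :=
  ∀ (l : V →ₗ[ℝ] ℝ) (c : M) (i : Fin 2), AEStronglyMeasurable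
    (fun y => l (W ((chartAt Plane c).symm y) (coordAt c ((chartAt Plane c).symm y) i)))
    (volume.restrict (chartAt Plane c).target)

/-- A function in `L^p` on all compact subsets of an open set is measurable there. -/
theorem aestronglyMeasurable_of_memLp_compact {Ω : Set Plane} (hΩ : IsOpen Ω) {p : ℝ≥0∞}
    {f : Plane → ℝ} (h : ∀ K : Set Plane, IsCompact K → K ⊆ Ω → MemLp f p (volume.restrict K)) :
    AEStronglyMeasurable f (volume.restrict Ω) := by
  have hloc : LocallyCompactSpace Ω := hΩ.locallyCompactSpace
  have hU : ⋃ n, (Subtype.val '' compactCovering Ω n) = Ω := by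
    rw [← image_iUnion, iUnion_compactCovering, image_univ, Subtype.range_coe]
  rw [← hU, aestronglyMeasurable_iUnion_iff]
  intro n
  refine (h _ ((isCompact_compactCovering Ω n).image continuous_subtype_val) ?_).1
  rintro _ ⟨y, _, rfl⟩
  exact y.2

variable {V : Type*} [AddCommGroup V] [Module ℝ V]

theorem HasWeakDiffV.formMeasurable {p : ℝ≥0∞} {ξ : M → V} {dξ : OneForm M V}
    (h : HasWeakDiffV p ξ dξ) : FormMeasurable dξ := fun l c i =>
  aestronglyMeasurable_of_memLp_compact (chartAt Plane c).open_target
    fun K hK hKc => (h l c).memLp_grad K hK hKc i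

theorem FormMeasurable.sub {W W' : OneForm M V} (h : FormMeasurable W) (h' : FormMeasurable W') :
    FormMeasurable (fun x => W x - W' x) := fun l c i => by
  simp only [LinearMap.sub_apply, map_sub]
  exact (h l c i).sub (h' l c i)

theorem FormMeasurable.comp [Module.Finite ℝ V] {V' : Type*} [AddCommGroup V'] [Module ℝ V']
    {W : OneForm M V} (h : FormMeasurable W) {T : M → V →ₗ[ℝ] V'}
    (hT : ∀ (l : V' →ₗ[ℝ] ℝ) (v : V), Continuous fun x => l (T x v)) :
    FormMeasurable (fun x => T x ∘ₗ W x) := fun l c i => by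
  have e : ∀ x (v : V), l (T x v) = ∑ j, (Module.finBasis ℝ V).coord j v *
      l (T x (Module.finBasis ℝ V j)) := by
    intro x v
    conv_lhs => rw [← (Module.finBasis ℝ V).sum_repr v]
    simp only [map_sum, map_smul, smul_eq_mul, Module.Basis.coord_apply]
  refine (Finset.aestronglyMeasurable_fun_sum Finset.univ fun j _ =>
    (h ((Module.finBasis ℝ V).coord j) c i).mul ?_).congr (ae_of_all _ fun y => (e _ _).symm)
  exact ((hT l _).comp_continuousOn (chartAt Plane c).continuousOn_symm).aestronglyMeasurable
    (measurableSet_target c)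

variable [IsManifold (𝓡 2) ∞ M] {g : Metric M}

theorem pairing_coordAt (o : SurfaceOrientation g) {B : LinearMap.BilinForm ℝ V} {c x : M}
    (hx : x ∈ (chartAt Plane c).source) (A C : TangentSpace (𝓡 2) x →ₗ[ℝ] V) :
    pairing g B x A C = (areaCoeff o c x ^ 2)⁻¹ *
      (g.inner x (coordAt c x 1) (coordAt c x 1) * B (A (coordAt c x 0)) (C (coordAt c x 0)) -
        g.inner x (coordAt c x 0) (coordAt c x 1) * B (A (coordAt c x 0)) (C (coordAt c x 1)) -
        g.inner x (coordAt c x 1) (coordAt c x 0) * B (A (coordAt c x 1)) (C (coordAt c x 0)) +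
        g.inner x (coordAt c x 0) (coordAt c x 0) * B (A (coordAt c x 1)) (C (coordAt c x 1))) := by
  have hdet : (gram g x (coordAt c x)).det = areaCoeff o c x ^ 2 := gram_det_eq o _
  have hne : (gram g x (coordAt c x)).det ≠ 0 := by
    rw [hdet]
    exact pow_ne_zero 2 (areaCoeff_ne_zero o hx)
  have hinv : ∀ i j, (gram g x (coordAt c x))⁻¹ i j =
      (areaCoeff o c x ^ 2)⁻¹ * (gram g x (coordAt c x)).adjugate i j := by
    intro i j
    rw [Matrix.inv_def, hdet, Ring.inverse_eq_inv', Matrix.smul_apply, smul_eq_mul]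
  have h00 : (gram g x (coordAt c x)).adjugate 0 0 =
      g.inner x (coordAt c x 1) (coordAt c x 1) := by
    rw [Matrix.adjugate_fin_two]; rfl
  have h01 : (gram g x (coordAt c x)).adjugate 0 1 =
      -g.inner x (coordAt c x 0) (coordAt c x 1) := by
    rw [Matrix.adjugate_fin_two]; rfl
  have h10 : (gram g x (coordAt c x)).adjugate 1 0 =
      -g.inner x (coordAt c x 1) (coordAt c x 0) := by
    rw [Matrix.adjugate_fin_two]; rfl
  have h11 : (gram g x (coordAt c x)).adjugate 1 1 =
      g.inner x (coordAt c x 0) (coordAt c x 0) := by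
    rw [Matrix.adjugate_fin_two]; rfl
  rw [pairing_basis (coordAt c x) hne, Fin.sum_univ_two, Fin.sum_univ_two, Fin.sum_univ_two,
    hinv, hinv, hinv, hinv, h00, h01, h10, h11]
  ring

variable [MeasurableSpace M] [BorelSpace M] [SecondCountableTopology M]

theorem FormMeasurable.aestronglyMeasurable_pairing [Module.Finite ℝ V] (o : SurfaceOrientation g)
    (B : LinearMap.BilinForm ℝ V) {A C : OneForm M V} (hA : FormMeasurable A)
    (hC : FormMeasurable C) :
    AEStronglyMeasurable (fun x => pairing g B x (A x) (C x)) (riemVol g) := by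
  rw [aestronglyMeasurable_iff_forall_chart o]
  intro c
  have hB : ∀ i j, AEStronglyMeasurable (fun y => B
      (A ((chartAt Plane c).symm y) (coordAt c ((chartAt Plane c).symm y) i))
      (C ((chartAt Plane c).symm y) (coordAt c ((chartAt Plane c).symm y) j)))
      (volume.restrict (chartAt Plane c).target) := by
    intro i j
    exact (Finset.aestronglyMeasurable_fun_sum Finset.univ fun a _ =>
      Finset.aestronglyMeasurable_fun_sum Finset.univ fun b _ =>
        ((hA ((Module.finBasis ℝ V).coord a) c i).mul
          (hC ((Module.finBasis ℝ V).coord b) c j)).const_mul _).congr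
            (ae_of_all _ fun y => (bilin_eq_sum_basis B _ _).symm)
  have hg : ∀ i j, AEStronglyMeasurable (fun y => g.inner ((chartAt Plane c).symm y)
      (coordAt c ((chartAt Plane c).symm y) i) (coordAt c ((chartAt Plane c).symm y) j))
      (volume.restrict (chartAt Plane c).target) := fun i j =>
    ((continuousOn_gram g c i j).comp (chartAt Plane c).continuousOn_symm
      fun _ hy => (chartAt Plane c).map_target hy).aestronglyMeasurable (measurableSet_target c)
  have hω : AEStronglyMeasurable (fun y => (areaCoeff o c ((chartAt Plane c).symm y) ^ 2)⁻¹)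
      (volume.restrict (chartAt Plane c).target) :=
    (((continuousOn_areaCoeff_symm o c).pow 2).aemeasurable
      (measurableSet_target c)).inv.aestronglyMeasurable
  refine (hω.mul (((((hg 1 1).mul (hB 0 0)).sub ((hg 0 1).mul (hB 0 1))).sub
    ((hg 1 0).mul (hB 1 0))).add ((hg 0 0).mul (hB 1 1)))).congr ?_
  filter_upwards [ae_restrict_mem (measurableSet_target c)] with y hy
  exact (pairing_coordAt o ((chartAt Plane c).map_target hy) _ _).symm

end FormMeasurable

/-! ### The convex variational problem -/

/-- If `A + m ≤ C + G + H` with `∫ m = 0`, then `∫ A ≤ ∫ C + ∫ G + ∫ H`. The functions `A` and `C`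
need not be measurable. -/
theorem lintegral_le_of_add_le {X : Type*} [MeasurableSpace X] {μ : Measure X} {A C m : X → ℝ}
    {G H : X → ℝ≥0∞} (hm : Integrable m μ) (hm0 : ∫ x, m x ∂μ = 0) (hG : AEMeasurable G μ)
    (hH : AEMeasurable H μ) (hA : ∀ᵐ x ∂μ, 0 ≤ A x)
    (h : ∀ᵐ x ∂μ, ENNReal.ofReal (A x + m x) ≤ ENNReal.ofReal (C x) + G x + H x) :
    ∫⁻ x, ENNReal.ofReal (A x) ∂μ ≤
      ∫⁻ x, ENNReal.ofReal (C x) ∂μ + ∫⁻ x, G x ∂μ + ∫⁻ x, H x ∂μ := by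
  obtain ⟨A', hA'm, hA'le, hA'⟩ := exists_measurable_le_lintegral_eq μ fun x => ENNReal.ofReal (A x)
  have hmp : AEMeasurable (fun x => ENNReal.ofReal (m x)) μ := hm.1.aemeasurable.ennreal_ofReal
  have hmn : AEMeasurable (fun x => ENNReal.ofReal (-m x)) μ :=
    hm.1.aemeasurable.neg.ennreal_ofReal
  have hfp : ∫⁻ x, ENNReal.ofReal (m x) ∂μ ≠ ⊤ := hm.lintegral_lt_top.ne
  have hfn : ∫⁻ x, ENNReal.ofReal (-m x) ∂μ ≠ ⊤ := hm.neg.lintegral_lt_top.ne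
  have heq : ∫⁻ x, ENNReal.ofReal (m x) ∂μ = ∫⁻ x, ENNReal.ofReal (-m x) ∂μ := by
    have := integral_eq_lintegral_pos_part_sub_lintegral_neg_part hm
    rw [hm0] at this
    exact (ENNReal.toReal_eq_toReal_iff' hfp hfn).1 (by linarith)
  have hpt : ∀ᵐ x ∂μ, A' x + ENNReal.ofReal (m x) ≤
      ENNReal.ofReal (C x) + G x + H x + ENNReal.ofReal (-m x) := by
    filter_upwards [h, hA] with x hx hx0
    refine (add_le_add_left (hA'le x) _).trans (le_trans ?_ (add_le_add_left hx _))
    rcases le_total 0 (m x) with h0 | h0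
    · rw [← ENNReal.ofReal_add hx0 h0]
      exact le_self_add
    · rw [ENNReal.ofReal_of_nonpos h0, add_zero]
      refine le_trans (ENNReal.ofReal_le_ofReal (le_of_eq ?_)) ENNReal.ofReal_add_le
      ring
  have hint := lintegral_mono_ae hpt
  rw [lintegral_add_left hA'm, lintegral_add_right' _ hmn, lintegral_add_right' _ hH,
    lintegral_add_right' _ hG, ← hA', heq] at hint
  exact (ENNReal.add_le_add_iff_right hfn).1 hint

section Minimum

variable {M : Type*} [TopologicalSpace M] [ChartedSpace Plane M] [IsManifold (𝓡 2) ∞ M]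
  {g : Metric M} {V : Type*} [AddCommGroup V] [Module ℝ V] [Module.Finite ℝ V]
  {B : LinearMap.BilinForm ℝ V}

/-- Young's inequality with a parameter. -/
theorem neg_pairing_le_svPow {x : M} {N : Submodule ℝ V} (o : SurfaceOrientation g)
    (hN : PosDefOn B N) {p q : ℝ} (hpq : p.HolderConjugate q) {A Y : TangentSpace (𝓡 2) x →ₗ[ℝ] V}
    (hA : ∀ z, A z ∈ N) (hY : ∀ z, Y z ∈ N) {τ : ℝ} (hτ : 0 < τ) :
    -pairing g B x A Y ≤ τ ^ p / p * svPow g B p x A + (τ⁻¹) ^ q / q * svPow g B q x Y := by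
  have h := abs_pairing_le_svPow o hN hpq (A := τ • A) (Y := τ⁻¹ • Y)
    (fun z => N.smul_mem _ (hA z)) (fun z => N.smul_mem _ (hY z))
  rw [pairing_smul_left, pairing_smul_right, mul_inv_cancel_left₀ hτ.ne',
    svPow_smul o hN hA hpq.pos.ne' hτ.le, svPow_smul o hN hY hpq.symm.pos.ne' (inv_pos.2 hτ).le] at h
  have h2 := (neg_le_abs _).trans h
  calc _ ≤ _ := h2
    _ = _ := by ring

theorem dualEnergy_zero_eq [MeasurableSpace M] (D : Set M) (P : M → V →ₗ[ℝ] V) (q : ℝ)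
    (Z : OneForm M V) :
    dualEnergy g B D P q Z 0 = ∫⁻ x in D, ENNReal.ofReal (svPow g B q x (Z x)) ∂riemVol g := by
  rw [dualEnergy]
  congr 1
  funext x
  rw [Pi.zero_apply, LinearMap.comp_zero, add_zero]

variable [MeasurableSpace M] [BorelSpace M] [SecondCountableTopology M] {Γ : Type*} [Group Γ]
  [MulAction Γ M]

/-- The minimality of `Z`, when `S_{q-1}(Z)` annihilates the differentials of all tangential test
sections. By convexity the energy at `ξ` is at least that at `0` plus `q ∫ (S_{q-1}(Z); dξ)`, and
the last integral vanishes by approximation of `ξ`. As `ξ` need not have a finite energy, and the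
integrand need not be measurable, the error terms are estimated pointwise, by Young's inequality
with a parameter `τ`, before passing to the limit. -/
theorem dualEnergy_zero_le (o : SurfaceOrientation g) {D : Set M} {N : M → Submodule ℝ V}
    {P : M → V →ₗ[ℝ] V} (hN : ∀ x, PosDefOn B (N x)) (hPN : ∀ x v, P x v ∈ N x)
    (hPB : ∀ x, ∀ a ∈ N x, ∀ v, B a (P x v) = B a v)
    (hPm : ∀ (l : V →ₗ[ℝ] ℝ) (v : V), Continuous fun x => l (P x v)) {p q : ℝ}
    (hpq : p.HolderConjugate q) {Z : OneForm M V} (hZ : ∀ᵐ x ∂riemVol g, ∀ v, Z x v ∈ N x)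
    (hS : AEStronglyMeasurable (fun x => pairing g B x (Sform g B q Z x) (Sform g B q Z x))
      (riemVol g)) (hE : dualEnergy g B D P q Z 0 < ⊤) {act : Γ → V →ₗ[ℝ] V}
    (hpair : ∀ (η : M → V) (dη : OneForm M V), IsTangentTest act g P q η dη →
      PairsToZero g B D (Sform g B q Z) dη) {ξ : M → V} {dξ : OneForm M V}
    (hξ : IsTangentW0 act g B D P q ξ dξ) :
    dualEnergy g B D P q Z 0 ≤ dualEnergy g B D P q Z dξ := by
  obtain ⟨η, dη, hη, hlim⟩ := hξ.approx
  have hp0 := hpq.pos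
  have hq0 := hpq.symm.pos
  set A : M → ℝ := fun x => svPow g B q x (Z x) with hA
  set C : M → ℝ := fun x => svPow g B q x (Z x + P x ∘ₗ dξ x) with hC
  set s : M → ℝ := fun x => pairing g B x (Sform g B q Z x) (Sform g B q Z x) with hs
  set Y : ℕ → OneForm M V := fun k x => P x ∘ₗ (dξ x - dη k x) with hY
  set r : ℕ → M → ℝ := fun k x => pairing g B x (Y k x) (Y k x) with hr
  set a : ℕ → ℝ≥0∞ := fun k => ∫⁻ x in D,
      (ENNReal.ofReal (B (ξ x - η k x) (ξ x - η k x) ^ (q / 2)) +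
        ENNReal.ofReal (svPow g B q x (P x ∘ₗ (dξ x - dη k x)))) ∂(riemVol g) with ha
  have hE0 : dualEnergy g B D P q Z 0 = ∫⁻ x in D, ENNReal.ofReal (A x) ∂riemVol g :=
    dualEnergy_zero_eq D P q Z
  have hZD : ∀ᵐ x ∂(riemVol g).restrict D, ∀ v, Z x v ∈ N x := ae_restrict_of_ae hZ
  have hYN : ∀ k x v, Y k x v ∈ N x := fun k x v => hPN x _
  have hrm : ∀ k, AEStronglyMeasurable (r k) (riemVol g) := fun k => by
    have h1 := (hξ.isSection.isW1loc.hasWeakDiffV.formMeasurable.sub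
      (hη k).isSection.isW1loc.hasWeakDiffV.formMeasurable).comp hPm
    exact h1.aestronglyMeasurable_pairing o B h1
  set E := dualEnergy g B D P q Z 0 with hEdef
  have hSint : ∫⁻ x in D, ENNReal.ofReal (s x ^ (p / 2)) ∂riemVol g ≤
      ENNReal.ofReal (2 ^ (p / 2)) * E := by
    rw [hE0, ← lintegral_const_mul' _ _ ENNReal.ofReal_ne_top]
    refine lintegral_mono_ae ?_
    filter_upwards [hZD] with x hx
    rw [← ENNReal.ofReal_mul (by positivity)]
    refine ENNReal.ofReal_le_ofReal ?_
    have h := (svPow_le_pairing_rpow o (hN x) (Spow_mem o (hN x) hx q) hp0).2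
    rwa [svPow_Spow o (hN x) hx hpq] at h
  have hYint : ∀ k, ∫⁻ x in D, ENNReal.ofReal (r k x ^ (q / 2)) ∂riemVol g ≤
      ENNReal.ofReal (2 ^ (q / 2)) * a k := by
    intro k
    rw [ha, ← lintegral_const_mul' _ _ ENNReal.ofReal_ne_top]
    refine lintegral_mono fun x => ?_
    refine le_trans ?_ (mul_le_mul_right le_add_self _)
    rw [← ENNReal.ofReal_mul (by positivity)]
    exact ENNReal.ofReal_le_ofReal (svPow_le_pairing_rpow o (hN x) (hYN k x) hq0).2
  have key : ∀ τ : ℝ, 0 < τ → ∀ k, E ≤ dualEnergy g B D P q Z dξ +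
      ENNReal.ofReal (2 * q / p * τ ^ p) * (ENNReal.ofReal (2 ^ (p / 2)) * E) +
      ENNReal.ofReal (2 * τ⁻¹ ^ q) * (ENNReal.ofReal (2 ^ (q / 2)) * a k) := by
    intro τ hτ k
    have hc1 : 0 ≤ 2 * q / p * τ ^ p := by positivity
    have hc2 : 0 ≤ 2 * τ⁻¹ ^ q := by positivity
    obtain ⟨hm1, hm2⟩ := hpair (η k) (dη k) (hη k)
    have h := lintegral_le_of_add_le (μ := (riemVol g).restrict D) (A := A) (C := C)
      (m := fun x => q * pairing g B x (Sform g B q Z x) (dη k x))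
      (G := fun x => ENNReal.ofReal (2 * q / p * τ ^ p) * ENNReal.ofReal (s x ^ (p / 2)))
      (H := fun x => ENNReal.ofReal (2 * τ⁻¹ ^ q) * ENNReal.ofReal (r k x ^ (q / 2)))
      (hm1.const_mul q) (by rw [integral_const_mul, hm2, mul_zero])
      ((hS.restrict.aemeasurable.pow_const _).ennreal_ofReal.const_mul _)
      (((hrm k).restrict.aemeasurable.pow_const _).ennreal_ofReal.const_mul _)
      (hZD.mono fun x hx => svPow_nonneg o (hN x) hx hq0.ne') (by
        filter_upwards [hZD] with x hx
        have hSx := Spow_mem o (hN x) hx q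
        have e1 := svPow_add_le o (hN x) hpq hx (X := P x ∘ₗ dξ x) fun v => hPN x _
        have e2 := neg_pairing_le_svPow o (hN x) hpq hSx (hYN k x) hτ
        have e3 : svPow g B p x (Spow g B q x (Z x)) ≤ 2 * s x ^ (p / 2) :=
          (svPow_le_pairing_rpow o (hN x) hSx hp0).1
        have e4 : svPow g B q x (Y k x) ≤ 2 * r k x ^ (q / 2) :=
          (svPow_le_pairing_rpow o (hN x) (hYN k x) hq0).1
        have eP : ∀ W : TangentSpace (𝓡 2) x →ₗ[ℝ] V,
            pairing g B x (Spow g B q x (Z x)) (P x ∘ₗ W) =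
              pairing g B x (Spow g B q x (Z x)) W := by
          intro W
          obtain ⟨v, hv⟩ := exists_unit g x
          rw [pairing_frame o hv, pairing_frame o hv]
          simp only [LinearMap.comp_apply, hPB x _ (hSx _)]
        have e5 : pairing g B x (Spow g B q x (Z x)) (P x ∘ₗ dξ x) =
            pairing g B x (Spow g B q x (Z x)) (dη k x) +
              pairing g B x (Spow g B q x (Z x)) (Y k x) := by
          rw [hY, eP, eP, pairing_sub_right]
          ring
        rw [← ENNReal.ofReal_mul hc1, ← ENNReal.ofReal_mul hc2]
        have hC0 : 0 ≤ C x := svPow_nonneg o (hN x)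
          (fun z => (N x).add_mem (hx z) (hPN x _)) hq0.ne'
        have hs0 : 0 ≤ s x ^ (p / 2) := by
          have := svPow_nonneg o (hN x) hSx hp0.ne'
          linarith
        have hr0 : 0 ≤ r k x ^ (q / 2) := by
          have := svPow_nonneg o (hN x) (hYN k x) hq0.ne'
          linarith
        rw [← ENNReal.ofReal_add hC0 (mul_nonneg hc1 hs0),
          ← ENNReal.ofReal_add (add_nonneg hC0 (mul_nonneg hc1 hs0)) (mul_nonneg hc2 hr0)]
        refine ENNReal.ofReal_le_ofReal ?_
        have e6 : τ ^ p / p * svPow g B p x (Spow g B q x (Z x)) ≤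
            τ ^ p / p * (2 * s x ^ (p / 2)) := mul_le_mul_of_nonneg_left e3 (by positivity)
        have e7 : τ⁻¹ ^ q / q * svPow g B q x (Y k x) ≤
            τ⁻¹ ^ q / q * (2 * r k x ^ (q / 2)) := mul_le_mul_of_nonneg_left e4 (by positivity)
        have e8 := mul_le_mul_of_nonneg_left (e2.trans (add_le_add e6 e7)) hq0.le
        have e9 : q * (τ ^ p / p * (2 * s x ^ (p / 2)) + τ⁻¹ ^ q / q * (2 * r k x ^ (q / 2))) =
            2 * q / p * τ ^ p * s x ^ (p / 2) + 2 * τ⁻¹ ^ q * r k x ^ (q / 2) := by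
          field_simp
        rw [e9] at e8
        rw [e5] at e1
        have e10 : A x + q * pairing g B x (Spow g B q x (Z x)) (dη k x) ≤
            C x + 2 * q / p * τ ^ p * s x ^ (p / 2) + 2 * τ⁻¹ ^ q * r k x ^ (q / 2) := by
          simp only [hA, hC]
          linarith
        exact e10)
    rw [lintegral_const_mul' _ _ ENNReal.ofReal_ne_top,
      lintegral_const_mul' _ _ ENNReal.ofReal_ne_top, ← hE0] at h
    refine h.trans ?_
    gcongr
    · exact le_rfl
    · exact hYint k
  have key2 : ∀ τ : ℝ, 0 < τ → E ≤ dualEnergy g B D P q Z dξ +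
      ENNReal.ofReal (2 * q / p * τ ^ p) * (ENNReal.ofReal (2 ^ (p / 2)) * E) := by
    intro τ hτ
    have h1 : Tendsto (fun k => ENNReal.ofReal (2 * τ⁻¹ ^ q) *
        (ENNReal.ofReal (2 ^ (q / 2)) * a k)) atTop (𝓝 0) := by
      have := ENNReal.Tendsto.const_mul (a := ENNReal.ofReal (2 * τ⁻¹ ^ q))
        (ENNReal.Tendsto.const_mul (a := ENNReal.ofReal (2 ^ (q / 2))) hlim
          (Or.inr ENNReal.ofReal_ne_top)) (Or.inr ENNReal.ofReal_ne_top)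
      simpa using this
    have h2 := h1.const_add (dualEnergy g B D P q Z dξ +
      ENNReal.ofReal (2 * q / p * τ ^ p) * (ENNReal.ofReal (2 ^ (p / 2)) * E))
    rw [add_zero] at h2
    exact ge_of_tendsto' h2 (key τ hτ)
  have hτ : Tendsto (fun τ : ℝ => ENNReal.ofReal (2 * q / p * τ ^ p) *
      (ENNReal.ofReal (2 ^ (p / 2)) * E)) (𝓝[>] 0) (𝓝 0) := by
    have h1 : Tendsto (fun τ : ℝ => 2 * q / p * τ ^ p) (𝓝[>] 0) (𝓝 0) := by
      have : ContinuousAt (fun τ : ℝ => 2 * q / p * τ ^ p) 0 :=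
        (Real.continuousAt_rpow_const 0 p (Or.inr hp0.le)).const_mul _
      have h2 := this.tendsto
      simp only [Real.zero_rpow hp0.ne', mul_zero] at h2
      exact h2.mono_left nhdsWithin_le_nhds
    have h2 := ENNReal.tendsto_ofReal h1
    rw [ENNReal.ofReal_zero] at h2
    have := ENNReal.Tendsto.mul_const (b := ENNReal.ofReal (2 ^ (p / 2)) * E) h2
      (Or.inr (ENNReal.mul_ne_top ENNReal.ofReal_ne_top hE.ne))
    simpa using this
  have h3 := hτ.const_add (dualEnergy g B D P q Z dξ)
  rw [add_zero] at h3
  exact ge_of_tendsto h3 (by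
    filter_upwards [self_mem_nhdsWithin] with τ hτ
    exact key2 τ hτ)

end Minimum

/-! ### Product rules -/

section ProductRule

theorem WeakGrad.const (p : ℝ≥0∞) (Ω : Set Plane) (c : ℝ) :
    WeakGrad p Ω (fun _ => c) (fun _ _ => 0) :=
  WeakGrad.of_parts
    (fun K hK _ => by
      have : IsFiniteMeasure (volume.restrict K) := ⟨by simpa using hK.measure_lt_top⟩
      exact memLp_const c)
    (fun _ _ _ _ => MemLp.zero)
    (fun φ hφ hφs _ i => by
      rw [integral_const_mul, integral_fderiv_eq_zero hφ hφs]
      simp)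

variable {M : Type*} [TopologicalSpace M] [ChartedSpace Plane M]

/-- The product rule for a continuous function of class `W^{1,p}` and one of class `W^{1,q}`, where
`p > 2`. The product is of class `W^{1,q}`: by the Sobolev inequality, `h` is in `L^r_loc` for
`1/r = 1/2 - 1/p`, hence `h df` is in `L^2_loc`. -/
theorem HasWeakDiff.mul {p q : ℝ} (hp : 2 < p) (hpq : p.HolderConjugate q) {f h : M → ℝ}
    {df dh : OneForm M ℝ} (hf : HasWeakDiff (ENNReal.ofReal p) f df) (hfc : Continuous f)
    (hh : HasWeakDiff (ENNReal.ofReal q) h dh) :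
    HasWeakDiff (ENNReal.ofReal q) (fun x => f x * h x) (fun x => h x • df x + f x • dh x) := by
  have : ENNReal.HolderConjugate (ENNReal.ofReal p) (ENNReal.ofReal q) := hpq.ennrealOfReal
  intro c
  have hq1 := hpq.symm.lt
  have hq2 : q < 2 := by
    have h1 := hpq.mul_eq_add
    nlinarith
  have hr : 0 < (2⁻¹ - p⁻¹)⁻¹ := by
    rw [inv_pos, sub_pos]
    exact inv_strictAnti₀ two_pos hp
  have hsum := hpq.inv_add_inv_eq_one
  have ht : ENNReal.HolderTriple (ENNReal.ofReal (2⁻¹ - p⁻¹)⁻¹) (ENNReal.ofReal p) 2 := by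
    have := (Real.HolderTriple.mk (p := (2⁻¹ - p⁻¹)⁻¹) (q := p) (r := 2)
      (by rw [inv_inv]; ring) hr hpq.pos).ennrealOfReal
    simpa using this
  have hm := (hf c).mul (ENNReal.one_le_ofReal.2 hpq.lt.le) ENNReal.ofReal_ne_top
    (ENNReal.one_le_ofReal.2 hq1.le) (chartAt Plane c).open_target
    (hfc.comp_continuousOn (chartAt Plane c).continuousOn_symm) (hh c) (fun K hK hKc i => by
      have : IsFiniteMeasure (volume.restrict K) := ⟨by simpa using hK.measure_lt_top⟩
      have h1 := (hh c).memLp_sobolev hq1.le hq2 hr (by rw [inv_inv]; linarith)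
        (chartAt Plane c).open_target K hK hKc
      have h2 : MemLp _ 2 _ := h1.mul' ((hf c).memLp_grad K hK hKc i)
      refine h2.mono_exponent ?_
      exact (ENNReal.ofReal_le_ofReal hq2.le).trans (by simp))
  convert hm using 3
  simp [mul_comm]

/-- The product rule for a bilinear map `T`. -/
theorem HasWeakDiffV.bilin {V W X : Type*} [AddCommGroup V] [Module ℝ V] [Module.Finite ℝ V]
    [AddCommGroup W] [Module ℝ W] [Module.Finite ℝ W] [AddCommGroup X] [Module ℝ X] {p q : ℝ}
    (hp : 2 < p) (hpq : p.HolderConjugate q) {u : M → V} {du : OneForm M V}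
    (hu : HasWeakDiffV (ENNReal.ofReal p) u du)
    (huc : ∀ l : V →ₗ[ℝ] ℝ, Continuous fun x => l (u x)) {ψ : M → W} {dψ : OneForm M W}
    (hψ : HasWeakDiffV (ENNReal.ofReal q) ψ dψ) (T : V →ₗ[ℝ] W →ₗ[ℝ] X) :
    HasWeakDiffV (ENNReal.ofReal q) (fun x => T (u x) (ψ x))
      (fun x => T.flip (ψ x) ∘ₗ du x + T (u x) ∘ₗ dψ x) := by
  intro l c
  set b := Module.finBasis ℝ V
  set b' := Module.finBasis ℝ W
  have h := WeakGrad.sum (ENNReal.one_le_ofReal.2 hpq.symm.lt.le) Finset.univ fun i _ =>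
    WeakGrad.sum (ENNReal.one_le_ofReal.2 hpq.symm.lt.le) Finset.univ fun j _ =>
      (HasWeakDiff.mul hp hpq (hu (b.coord i)) (huc _) (hψ (b'.coord j)) c).const_mul
        (l (T (b i) (b' j)))
  have e : ∀ v w, l (T v w) = ∑ i, ∑ j, l (T (b i) (b' j)) * (b.coord i v * b'.coord j w) :=
    fun v w => bilin_eq_sum_basis (T.compr₂ l) v w
  convert h using 2 with y i y
  · exact e _ _
  · funext y
    beta_reduce
    rw [LinearMap.comp_apply, LinearMap.add_apply, map_add, LinearMap.comp_apply,
      LinearMap.comp_apply, LinearMap.flip_apply, e, e]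
    simp only [LinearMap.comp_apply, LinearMap.add_apply, ← Finset.sum_add_distrib,
      LinearMap.smul_apply, smul_eq_mul]
    exact Finset.sum_congr rfl fun i _ => Finset.sum_congr rfl fun j _ => by ring

/-- Bilinear maps preserve continuity, expressed by linear functionals. -/
theorem continuous_bilin {V W X Y : Type*} [AddCommGroup V] [Module ℝ V] [Module.Finite ℝ V]
    [AddCommGroup W] [Module ℝ W] [Module.Finite ℝ W] [AddCommGroup X] [Module ℝ X]
    [TopologicalSpace Y] {f : Y → V} {h : Y → W} (hf : ∀ l : V →ₗ[ℝ] ℝ, Continuous fun x => l (f x))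
    (hh : ∀ l : W →ₗ[ℝ] ℝ, Continuous fun x => l (h x)) (T : V →ₗ[ℝ] W →ₗ[ℝ] X)
    (l : X →ₗ[ℝ] ℝ) : Continuous fun x => l (T (f x) (h x)) := by
  have e : ∀ x, l (T (f x) (h x)) = _ := fun x => bilin_eq_sum_basis (T.compr₂ l) (f x) (h x)
  rw [funext e]
  exact continuous_finsetSum _ fun i _ => continuous_finsetSum _ fun j _ =>
    ((hf _).mul (hh _)).const_mul _

end ProductRule

/-! ### Minkowski space and its Lie algebra -/

section Minkowski

open Matrix

variable {n : ℕ}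

theorem mform_eq_dotProduct (X Y : Mink n) : mform n X Y = X ⬝ᵥ eSharp n *ᵥ Y := by
  rw [mform, Matrix.toBilin'_apply']

theorem mform_apply (X Y : Mink n) : mform n X Y =
    ∑ i, X (Sum.inl i) * Y (Sum.inl i) - X (Sum.inr ()) * Y (Sum.inr ()) := by
  rw [mform_eq_dotProduct, dotProduct, Fintype.sum_sum_type]
  simp [eSharp, LieAlgebra.Orthogonal.indefiniteDiagonal, mulVec_diagonal, sub_eq_add_neg]

theorem mform_comm (X Y : Mink n) : mform n X Y = mform n Y X := by
  simp only [mform_apply, mul_comm]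

theorem mform_vecAct (A : SOPlus n) (X Y : Mink n) :
    mform n (vecAct A X) (vecAct A Y) = mform n X Y := by
  have hA : A.1.1.transpose * eSharp n * A.1.1 = eSharp n := A.2.1
  rw [mform_eq_dotProduct, mform_eq_dotProduct, vecAct, toLin'_apply, toLin'_apply]
  conv_rhs => rw [← hA, ← mulVec_mulVec, ← mulVec_mulVec, dotProduct_mulVec, vecMul_transpose]

/-- The tangent space `T_uℍ = u^⊥` of the hyperboloid at `u`. -/
def hypTangent (u : Mink n) : Submodule ℝ (Mink n) := LinearMap.ker (mform n u)

theorem mem_hypTangent {u v : Mink n} : v ∈ hypTangent u ↔ mform n u v = 0 := Iff.rfl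

/-- The metric of hyperbolic space is Riemannian, by the Cauchy-Schwarz inequality for the
space-like components. -/
theorem posDefOn_hypTangent {u : Mink n} (hu : u ∈ hyperboloid n) :
    PosDefOn (mform n) (hypTangent u) := by
  have h1 : mform n u u = -1 := hu.1
  rw [mform_apply] at h1
  have key : ∀ v ∈ hypTangent u, v (Sum.inr ()) ^ 2 * u (Sum.inr ()) ^ 2 ≤
      (∑ i, v (Sum.inl i) * v (Sum.inl i)) * (u (Sum.inr ()) ^ 2 - 1) := by
    intro v hv
    rw [mem_hypTangent, mform_apply] at hv
    have hcs := Finset.sum_mul_sq_le_sq_mul_sq Finset.univ (fun i => v (Sum.inl i))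
      fun i => u (Sum.inl i)
    have e1 : ∑ i, v (Sum.inl i) * u (Sum.inl i) = v (Sum.inr ()) * u (Sum.inr ()) := by
      simp only [mul_comm (v _)]
      linarith
    have e2 : ∑ i, u (Sum.inl i) ^ 2 = u (Sum.inr ()) ^ 2 - 1 := by
      simp only [pow_two]
      linarith
    simp only [e1, e2, mul_pow] at hcs
    simpa only [pow_two] using hcs
  refine ⟨mform_comm, fun v hv => ?_, fun v hv h0 => ?_⟩
  · have h := key v hv
    rw [mform_apply]
    by_contra! hneg
    have hS : 0 ≤ ∑ i, v (Sum.inl i) * v (Sum.inl i) :=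
      Finset.sum_nonneg fun i _ => mul_self_nonneg _
    have hU : 0 ≤ u (Sum.inr ()) ^ 2 - 1 := by nlinarith [hu.2]
    have := mul_le_mul_of_nonneg_right hneg.le hU
    nlinarith
  · have h := key v hv
    rw [mform_apply] at h0
    have ht : v (Sum.inr ()) = 0 := by
      have : v (Sum.inr ()) ^ 2 ≤ 0 := by nlinarith
      exact pow_eq_zero_iff two_ne_zero |>.1 (le_antisymm this (sq_nonneg _))
    have hs : ∑ i, v (Sum.inl i) * v (Sum.inl i) = 0 := by
      rw [ht] at h0
      linarith
    rw [Finset.sum_eq_zero_iff_of_nonneg fun i _ => mul_self_nonneg _] at hs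
    funext i
    rcases i with i | i
    · exact mul_self_eq_zero.1 (hs i (Finset.mem_univ i))
    · exact ht

theorem projVec_apply (u v : Mink n) : projVec u v = v + mform n v u • u := rfl

theorem projVec_mem {u : Mink n} (hu : u ∈ hyperboloid n) (v : Mink n) :
    projVec u v ∈ hypTangent u := by
  have h1 : mform n u u = -1 := hu.1
  rw [mem_hypTangent, projVec_apply, map_add, map_smul, h1, mform_comm v u, smul_eq_mul]
  ring

theorem mform_projVec {u a : Mink n} (ha : a ∈ hypTangent u) (v : Mink n) :
    mform n a (projVec u v) = mform n a v := by
  rw [projVec_apply, map_add, map_smul, mform_comm a u, mem_hypTangent.1 ha, smul_zero, add_zero]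

theorem mform_alpha (A : soLie n) (X Y : Mink n) :
    mform n (alpha X A) Y = -mform n X (alpha Y A) := by
  have hA := (mem_soLie_iff A.1).1 A.2
  rw [mform_eq_dotProduct, mform_eq_dotProduct]
  change A.1 *ᵥ X ⬝ᵥ _ = -(X ⬝ᵥ _ *ᵥ (A.1 *ᵥ Y))
  rw [← vecMul_transpose, ← dotProduct_mulVec, mulVec_mulVec, hA, mulVec_mulVec, Matrix.mul_neg,
    neg_mulVec, dotProduct_neg]

theorem alpha_mem (u : Mink n) (A : soLie n) : alpha u A ∈ hypTangent u := by
  have h := mform_alpha A u u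
  rw [mform_comm] at h
  rw [mem_hypTangent]
  linarith

theorem vecMulVec_rowSharp_mulVec (a b X : Mink n) :
    vecMulVec a (rowSharp b) *ᵥ X = mform n X b • a := by
  rw [vecMulVec_mulVec, mform_eq_dotProduct, rowSharp, dotProduct_comm]
  ext i
  simp [mul_comm]

theorem alpha_beta_apply (u w X : Mink n) :
    alpha X (beta u w) = mform n X w • u - mform n X u • w := by
  change (vecMulVec u (rowSharp w) - vecMulVec w (rowSharp u)) *ᵥ X = _
  rw [sub_mulVec, vecMulVec_rowSharp_mulVec, vecMulVec_rowSharp_mulVec]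

theorem alpha_beta {u : Mink n} (hu : u ∈ hyperboloid n) (w : Mink n) :
    alpha u (beta u w) = projVec u w := by
  have h1 : mform n u u = -1 := hu.1
  rw [alpha_beta_apply, h1, projVec_apply, mform_comm u w]
  module

theorem killing_comm (A C : soLie n) : killing n A C = killing n C A :=
  Matrix.trace_mul_comm A.1 C.1

theorem alpha_adAct (A : SOPlus n) (u : Mink n) (C : soLie n) :
    alpha (vecAct A u) (adAct A C) = vecAct A (alpha u C) := by
  have h1' : (A⁻¹).1.1 * A.1.1 = 1 := congrArg (fun C => C.1.1) (inv_mul_cancel A)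
  change (A.1.1 * C.1 * (A⁻¹).1.1) *ᵥ (A.1.1 *ᵥ u) = A.1.1 *ᵥ (C.1 *ᵥ u)
  rw [mulVec_mulVec, Matrix.mul_assoc, h1', Matrix.mul_one, mulVec_mulVec]

/-- Up to the factor `2`, the maps `α_u` and `β_u` are adjoint to each other. -/
theorem killing_beta (u v : Mink n) (A : soLie n) :
    killing n (beta u v) A = 2 * mform n v (alpha u A) := by
  have e : ∀ a b : Mink n, (vecMulVec a (rowSharp b) * A.1).trace = mform n b (alpha a A) := by
    intro a b
    rw [vecMulVec_mul, trace_vecMulVec, dotProduct_comm, ← dotProduct_mulVec,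
      mform_comm, mform_eq_dotProduct, rowSharp, dotProduct_comm]
    rfl
  change ((vecMulVec u (rowSharp v) - vecMulVec v (rowSharp u)) * A.1).trace = _
  rw [Matrix.sub_mul, trace_sub, e, e, mform_comm u, mform_alpha]
  ring

theorem killing_beta_beta {u : Mink n} (hu : u ∈ hyperboloid n) {v : Mink n}
    (hv : v ∈ hypTangent u) (w : Mink n) :
    killing n (beta u v) (beta u w) = 2 * mform n v w := by
  rw [killing_beta, alpha_beta hu, mform_projVec hv]

/-- The subspace `𝔭_u = β_u(T_uℍ)` of the Lie algebra. -/
def hypTransvection (u : Mink n) : Submodule ℝ (soLie n) := (hypTangent u).map (beta u)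

theorem beta_mem {u v : Mink n} (hv : v ∈ hypTangent u) : beta u v ∈ hypTransvection u :=
  Submodule.mem_map_of_mem hv

theorem posDefOn_hypTransvection {u : Mink n} (hu : u ∈ hyperboloid n) :
    PosDefOn (killing n) (hypTransvection u) := by
  have hN := posDefOn_hypTangent hu
  refine ⟨killing_comm, ?_, ?_⟩
  · rintro _ ⟨v, hv, rfl⟩
    rw [killing_beta_beta hu hv]
    exact mul_nonneg zero_le_two (hN.nonneg v hv)
  · rintro _ ⟨v, hv, rfl⟩ h
    rw [killing_beta_beta hu hv, mul_eq_zero] at h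
    rw [hN.definite v hv (h.resolve_left two_ne_zero), map_zero]

theorem projAd_mem (u : Mink n) (A : soLie n) : projAd u A ∈ hypTransvection u :=
  beta_mem (alpha_mem u A)

theorem killing_projAd {u : Mink n} (hu : u ∈ hyperboloid n) {a : soLie n}
    (ha : a ∈ hypTransvection u) (A : soLie n) : killing n a (projAd u A) = killing n a A := by
  obtain ⟨v, hv, rfl⟩ := ha
  rw [projAd, LinearMap.comp_apply, killing_beta_beta hu hv, killing_beta]

/-- Elements of `𝔭_u` map `T_uℍ` to the normal line spanned by `u`. -/
theorem mform_alpha_of_projAd_eq {u a v : Mink n} {A : soLie n} (hA : projAd u A = A)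
    (ha : a ∈ hypTangent u) (hv : v ∈ hypTangent u) : mform n a (alpha v A) = 0 := by
  rw [← hA, projAd, LinearMap.comp_apply, alpha_beta_apply, mform_comm v u, mem_hypTangent.1 hv,
    zero_smul, sub_zero, map_smul, mform_comm a u, mem_hypTangent.1 ha, smul_zero]

/-- The action `(X, A) ↦ A X` as a bilinear map. -/
def alphaBilin (n : ℕ) : Mink n →ₗ[ℝ] soLie n →ₗ[ℝ] Mink n :=
  LinearMap.mk₂ ℝ (fun X A => alpha X A) (fun X Y A => mulVec_add A.1 X Y)
    (fun c X A => mulVec_smul A.1 c X) (fun X A C => map_add (alpha X) A C)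
    (fun c X A => map_smul (alpha X) c A)

theorem beta_swap (X Y : Mink n) : beta X Y = -beta Y X := by
  ext1
  exact (neg_sub _ _).symm

/-- The product `(X, Y) ↦ Y × X` as a bilinear map. -/
def betaBilin (n : ℕ) : Mink n →ₗ[ℝ] Mink n →ₗ[ℝ] soLie n :=
  LinearMap.mk₂ ℝ (fun X Y => beta X Y)
    (fun X X' Y => by rw [beta_swap, map_add, neg_add, ← beta_swap, ← beta_swap])
    (fun c X Y => by rw [beta_swap, map_smul, beta_swap Y X, smul_neg, neg_neg])
    (fun X Y Y' => map_add (beta X) Y Y') (fun c X Y => map_smul (beta X) c Y)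

theorem continuous_projVec {M : Type*} [TopologicalSpace M] {u : M → Mink n} (hu : Continuous u)
    (l : Mink n →ₗ[ℝ] ℝ) (v : Mink n) : Continuous fun x => l (projVec (u x) v) := by
  have h : ∀ l : Mink n →ₗ[ℝ] ℝ, Continuous fun x => l (u x) := fun l =>
    l.continuous_of_finiteDimensional.comp hu
  simp only [projVec_apply, map_add, map_smul, smul_eq_mul]
  exact continuous_const.add ((h _).mul (h l))

theorem continuous_projAd {M : Type*} [TopologicalSpace M] {u : M → Mink n} (hu : Continuous u)
    (l : soLie n →ₗ[ℝ] ℝ) (A : soLie n) : Continuous fun x => l (projAd (u x) A) := by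
  have h : ∀ l : Mink n →ₗ[ℝ] ℝ, Continuous fun x => l (u x) := fun l =>
    l.continuous_of_finiteDimensional.comp hu
  exact continuous_bilin h (fun l => continuous_bilin h (fun _ => continuous_const)
    (alphaBilin n) l (h := fun _ => A)) (betaBilin n) l

end Minkowski

/-! ### The dual minimum problems -/

section Dual

variable {M : Type*} [TopologicalSpace M] [ChartedSpace Plane M] [IsManifold (𝓡 2) ∞ M]
  {g : Metric M} {n : ℕ}

theorem pairing_starAt_starAt {V : Type*} [AddCommGroup V] [Module ℝ V]
    {B : LinearMap.BilinForm ℝ V} (o : SurfaceOrientation g) {x : M}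
    (A C : TangentSpace (𝓡 2) x →ₗ[ℝ] V) :
    pairing g B x (starAt o A) (starAt o C) = pairing g B x A C := by
  obtain ⟨v, hv⟩ := exists_unit g x
  rw [pairing_frame o hv, pairing_frame o hv]
  simp only [starAt_apply, o.rot_rot, map_neg, LinearMap.neg_apply, neg_neg]
  exact add_comm _ _

theorem pairing_killing_beta (o : SurfaceOrientation g) {x : M} (u : Mink n)
    (A : TangentSpace (𝓡 2) x →ₗ[ℝ] Mink n) (C : TangentSpace (𝓡 2) x →ₗ[ℝ] soLie n) :
    pairing g (killing n) x (beta u ∘ₗ A) C =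
      2 * pairing g (mform n) x A (alpha u ∘ₗ C) := by
  obtain ⟨v, hv⟩ := exists_unit g x
  rw [pairing_frame o hv, pairing_frame o hv]
  simp only [LinearMap.comp_apply, killing_beta]
  ring

theorem pairing_killing_beta_beta (o : SurfaceOrientation g) {x : M} {u : Mink n}
    (hu : u ∈ hyperboloid n) {A : TangentSpace (𝓡 2) x →ₗ[ℝ] Mink n}
    (hA : ∀ v, A v ∈ hypTangent u) :
    pairing g (killing n) x (beta u ∘ₗ A) (beta u ∘ₗ A) = 2 * pairing g (mform n) x A A := by
  obtain ⟨v, hv⟩ := exists_unit g x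
  rw [pairing_frame o hv, pairing_frame o hv]
  simp only [LinearMap.comp_apply, killing_beta_beta hu (hA _)]
  ring

variable [MeasurableSpace M]

theorem PairsToZero.of_ae_eq {V V' : Type*} [AddCommGroup V] [Module ℝ V] [AddCommGroup V']
    [Module ℝ V'] {B : LinearMap.BilinForm ℝ V} {B' : LinearMap.BilinForm ℝ V'} {D : Set M}
    {A C : OneForm M V} {A' C' : OneForm M V'} (h : PairsToZero g B D A C) (c : ℝ)
    (hc : ∀ᵐ x ∂riemVol g, pairing g B' x (A' x) (C' x) = c * pairing g B x (A x) (C x)) :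
    PairsToZero g B' D A' C' := by
  have hD : (fun x => pairing g B' x (A' x) (C' x)) =ᵐ[(riemVol g).restrict D]
      fun x => c * pairing g B x (A x) (C x) := ae_restrict_of_ae hc
  refine ⟨(h.1.const_mul c).congr hD.symm, ?_⟩
  rw [integral_congr_ae hD, integral_const_mul, h.2, mul_zero]

variable [BorelSpace M] [SecondCountableTopology M]

/-- The weak differential of a map into the hyperboloid is tangential. -/
theorem HasWeakDiffV.ae_mem_hypTangent (o : SurfaceOrientation g) {p q : ℝ} (hp : 2 < p)
    (hpq : p.HolderConjugate q) {u : M → Mink n} {du : OneForm M (Mink n)}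
    (hu : HasWeakDiffV (ENNReal.ofReal p) u du) (huc : Continuous u)
    (huh : ∀ x, u x ∈ hyperboloid n) : ∀ᵐ x ∂riemVol g, ∀ v, du x v ∈ hypTangent (u x) := by
  have hq1 := ENNReal.one_le_ofReal.2 hpq.symm.lt.le
  have hqp : ENNReal.ofReal q ≤ ENNReal.ofReal p := by
    refine ENNReal.ofReal_le_ofReal ?_
    have := hpq.mul_eq_add
    have := hpq.symm.lt
    nlinarith
  have hu' : HasWeakDiffV (ENNReal.ofReal q) u du := fun l c => (hu l c).mono_exponent hqp
  have h := (HasWeakDiffV.bilin hp hpq hu (fun l => l.continuous_of_finiteDimensional.comp huc) hu'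
    (mform n)) LinearMap.id
  have hc : HasWeakDiff (ENNReal.ofReal q) (fun _ : M => (-1 : ℝ)) (fun _ => 0) :=
    fun _ => WeakGrad.const _ _ _
  filter_upwards [h.ae_eq o hq1 hq1 hc isOpen_univ fun x _ => (huh x).1] with x hx v
  have e := congrArg (fun L => L v) (hx (mem_univ x))
  have e' : mform n (du x v) (u x) + mform n (u x) (du x v) = 0 := e
  rw [mform_comm] at e'
  rw [mem_hypTangent]
  linarith

variable {Γ : Type*} [Group Γ] [MulAction Γ M] {o : SurfaceOrientation g} {D : Set M}
  {ρ : Γ →* SOPlus n}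
  {p q : ℝ} {u : M → Mink n} {du : OneForm M (Mink n)}

/-- For `Z = *S_{p-1}(du)`, which is tangential, `S_{q-1}(Z) = *du` and
`|Z|_{sv^q}^q = |du|_{sv^p}^p`. -/
theorem Sform_star_Sform (hp : 2 < p) (hpq : p.HolderConjugate q)
    (hu : IsJpHarmonic g D ρ p u du) :
    ∀ᵐ x ∂riemVol g, (∀ v, star o (Sform g (mform n) p du) x v ∈ hypTangent (u x)) ∧
      Sform g (mform n) q (star o (Sform g (mform n) p du)) x = starAt o (du x) ∧
      svPow g (mform n) q x (star o (Sform g (mform n) p du) x) =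
        svPow g (mform n) p x (du x) := by
  filter_upwards [hu.isSection.isW1loc.hasWeakDiffV.ae_mem_hypTangent o hp hpq hu.continuous
    hu.mem_hyperboloid] with x hx
  have hN := posDefOn_hypTangent (hu.mem_hyperboloid x)
  have hS := Spow_mem o hN hx p
  refine ⟨fun v => (hypTangent (u x)).neg_mem (hS _), Spow_starAt_Spow hN hx hpq, ?_⟩
  exact (svPow_starAt hN hS hpq.symm.pos.ne').trans (svPow_Spow o hN hx hpq.symm)

theorem aestronglyMeasurable_pairing_du (o : SurfaceOrientation g)
    (hu : IsJpHarmonic g D ρ p u du) :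
    AEStronglyMeasurable (fun x => pairing g (mform n) x (du x) (du x)) (riemVol g) :=
  have h : FormMeasurable du := hu.isSection.isW1loc.hasWeakDiffV.formMeasurable
  h.aestronglyMeasurable_pairing o _ h

variable [T2Space M] [Countable Γ] [ProperlyDiscontinuousSMul Γ M]

/-- `*du` annihilates the differentials of compactly supported sections of the bundle with fibre
`ℝ^{n,1}`. -/
theorem IsJpHarmonic.pairsToZero (hΓ : IsDeckAction Γ g o)
    (hD : IsFundamentalDomain Γ D (riemVol g)) (hpq : p.HolderConjugate q)
    (hu : IsJpHarmonic g D ρ p u du) {η : M → Mink n} {dη : OneForm M (Mink n)}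
    (hη : HasWeakDiffV (ENNReal.ofReal q) η dη)
    (hηe : ∀ (γ : Γ) x, η (γ • x) = vecAct (ρ γ) (η x)) (hηs : CompactSupportMod Γ η) :
    PairsToZero g (mform n) D (fun x => starAt o (du x)) dη :=
  have : ENNReal.HolderConjugate (ENNReal.ofReal p) (ENNReal.ofReal q) := hpq.ennrealOfReal
  pairsToZero_starAt hΓ hD (fun γ => mform_vecAct (ρ γ)) (ENNReal.one_le_ofReal.2 hpq.lt.le)
    ENNReal.ofReal_ne_top (ENNReal.one_le_ofReal.2 hpq.symm.lt.le)
    hu.isSection.isW1loc.hasWeakDiffV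
    (fun l => l.continuous_of_finiteDimensional.comp hu.continuous) hu.isSection.equivariant hη hηe
    hηs

/-- The annihilation property of `*du × u` follows from that of `*du`: for a section `ψ = ψ_u` of
the Lie algebra bundle, `(*du × u; dψ) = 2 (*du; (dψ) u) = 2 (*du; d(ψ u))`, because `ψ` maps `T_uℍ`
to the normal line. -/
theorem IsJpHarmonic.pairsToZero_beta (hΓ : IsDeckAction Γ g o)
    (hD : IsFundamentalDomain Γ D (riemVol g)) (hp : 2 < p) (hpq : p.HolderConjugate q)
    (hu : IsJpHarmonic g D ρ p u du) {ψ : M → soLie n} {dψ : OneForm M (soLie n)}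
    (hψ : IsTangentTest (fun γ => adAct (ρ γ)) g (fun x => projAd (u x)) q ψ dψ) :
    PairsToZero g (killing n) D (fun x => beta (u x) ∘ₗ starAt o (du x)) dψ := by
  have huw : HasWeakDiffV (ENNReal.ofReal p) u du := hu.isSection.isW1loc.hasWeakDiffV
  have hξ := HasWeakDiffV.bilin hp hpq huw
    (fun l => l.continuous_of_finiteDimensional.comp hu.continuous)
    hψ.isSection.isW1loc.hasWeakDiffV (alphaBilin n)
  obtain ⟨K, hK, hψK⟩ := hψ.support
  refine (hu.pairsToZero hΓ hD hpq hξ (fun γ x => ?_)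
    ⟨K, hK, fun x hx => by
      beta_reduce
      rw [hψK x hx, map_zero]⟩).of_ae_eq 2 ?_
  · rw [hu.isSection.equivariant, hψ.isSection.equivariant]
    exact alpha_adAct (ρ γ) (u x) (ψ x)
  · filter_upwards [huw.ae_mem_hypTangent o hp hpq hu.continuous hu.mem_hyperboloid,
      hψ.tangent] with x hx hψx
    have e1 : pairing g (mform n) x (starAt o (du x)) ((alphaBilin n).flip (ψ x) ∘ₗ du x) = 0 := by
      obtain ⟨v, hv⟩ := exists_unit g x
      have e := fun a b => mform_alpha_of_projAd_eq hψx ((hypTangent (u x)).neg_mem (hx a)) (hx b)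
      rw [pairing_frame o hv]
      exact (congrArg₂ (· + ·) (e _ _) (e _ _)).trans (add_zero 0)
    rw [pairing_killing_beta o, pairing_add_right, e1, zero_add]
    rfl

end Dual

end DualHarmonic

end

theorem mainTheorem9 {n : ℕ} {M : Type*} [TopologicalSpace M] [T2Space M]
    [SecondCountableTopology M] [MeasurableSpace M] [BorelSpace M]
    [ChartedSpace DualHarmonic.Plane M] [IsManifold (𝓡 2) ∞ M]
    (g : DualHarmonic.Metric M) (o : DualHarmonic.SurfaceOrientation g)
    {Γ : Type*} [Group Γ] [Countable Γ] [MulAction Γ M] [ProperlyDiscontinuousSMul Γ M]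
    (hΓ : DualHarmonic.IsDeckAction Γ g o)
    (D : Set M) (hD : IsFundamentalDomain Γ D (DualHarmonic.riemVol g))
    (ρ : Γ →* DualHarmonic.SOPlus n) (p q : ℝ) (hp : 2 < p) (hpq : 1 / p + 1 / q = 1)
    (u : M → DualHarmonic.Mink n) (du : DualHarmonic.OneForm M (DualHarmonic.Mink n))
    (hu : DualHarmonic.IsJpHarmonic g D ρ p u du)
    (Z : DualHarmonic.OneForm M (DualHarmonic.Mink n))
    (hZ : Z = DualHarmonic.star o (DualHarmonic.Sform g (DualHarmonic.mform n) p du))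
    (V : DualHarmonic.OneForm M (DualHarmonic.soLie n))
    (hV : V = fun x => DualHarmonic.beta (u x) ∘ₗ Z x) :
    -- the version in the flat bundle with fibre `ℝ^{n,1}`
    (DualHarmonic.dualEnergy g (DualHarmonic.mform n) D (fun x => DualHarmonic.projVec (u x)) q
        Z 0 < ⊤ ∧
      (∀ (ξ : M → DualHarmonic.Mink n) (dξ : DualHarmonic.OneForm M (DualHarmonic.Mink n)),
        DualHarmonic.IsTangentW0 (fun γ => DualHarmonic.vecAct (ρ γ)) g (DualHarmonic.mform n) D
          (fun x => DualHarmonic.projVec (u x)) q ξ dξ →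
        DualHarmonic.dualEnergy g (DualHarmonic.mform n) D (fun x => DualHarmonic.projVec (u x)) q
            Z 0 ≤
          DualHarmonic.dualEnergy g (DualHarmonic.mform n) D (fun x => DualHarmonic.projVec (u x)) q
            Z dξ) ∧
      (∀ (η : M → DualHarmonic.Mink n) (dη : DualHarmonic.OneForm M (DualHarmonic.Mink n)),
        DualHarmonic.IsSection (fun γ => DualHarmonic.vecAct (ρ γ)) q η dη →
        DualHarmonic.CompactSupportMod Γ η →
        DualHarmonic.PairsToZero g (DualHarmonic.mform n) D
          (DualHarmonic.Sform g (DualHarmonic.mform n) q Z) dη)) ∧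
    -- the version in the flat bundle with fibre the Lie algebra `so(n,1)`
    (DualHarmonic.dualEnergy g (DualHarmonic.killing n) D (fun x => DualHarmonic.projAd (u x)) q
        V 0 < ⊤ ∧
      (∀ (ψ : M → DualHarmonic.soLie n) (dψ : DualHarmonic.OneForm M (DualHarmonic.soLie n)),
        DualHarmonic.IsTangentW0 (fun γ => DualHarmonic.adAct (ρ γ)) g (DualHarmonic.killing n) D
          (fun x => DualHarmonic.projAd (u x)) q ψ dψ →
        DualHarmonic.dualEnergy g (DualHarmonic.killing n) D (fun x => DualHarmonic.projAd (u x)) q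
            V 0 ≤
          DualHarmonic.dualEnergy g (DualHarmonic.killing n) D (fun x => DualHarmonic.projAd (u x)) q
            V dψ) ∧
      (∀ (ψ : M → DualHarmonic.soLie n) (dψ : DualHarmonic.OneForm M (DualHarmonic.soLie n)),
        DualHarmonic.IsTangentTest (fun γ => DualHarmonic.adAct (ρ γ)) g
          (fun x => DualHarmonic.projAd (u x)) q ψ dψ →
        DualHarmonic.PairsToZero g (DualHarmonic.killing n) D
          (DualHarmonic.Sform g (DualHarmonic.killing n) q V) dψ)) := by
  have hq' : p.HolderConjugate q :=
    Real.holderConjugate_iff.2 ⟨one_lt_two.trans hp, by simpa only [one_div] using hpq⟩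
  have huc := hu.continuous
  have huh := hu.mem_hyperboloid
  have hq0 := hq'.symm.pos.ne'
  subst hZ
  have hZ := DualHarmonic.Sform_star_Sform (o := o) hp hq' hu
  set Z := DualHarmonic.star o (DualHarmonic.Sform g (DualHarmonic.mform n) p du) with hZdef
  have hEZ : ∫⁻ x in D, ENNReal.ofReal (DualHarmonic.svPow g (DualHarmonic.mform n) q x (Z x))
      ∂DualHarmonic.riemVol g < ⊤ := by
    refine lt_of_eq_of_lt (lintegral_congr_ae ?_) hu.finite_energy
    refine ae_restrict_of_ae (hZ.mono fun x hx => ?_)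
    exact congrArg ENNReal.ofReal hx.2.2
  have hmeas := DualHarmonic.aestronglyMeasurable_pairing_du o hu
  -- `β_u` multiplies the form on the tangent space by `2`, so the statements about `V` follow from
  -- those about `Z` up to powers of `2`.
  have hV' : ∀ᵐ x ∂DualHarmonic.riemVol g,
      (∀ v, V x v ∈ DualHarmonic.hypTransvection (u x)) ∧
      DualHarmonic.Sform g (DualHarmonic.killing n) q V x =
        (2 : ℝ) ^ ((q - 2) / 2) • (DualHarmonic.beta (u x) ∘ₗ DualHarmonic.starAt o (du x)) ∧
      DualHarmonic.svPow g (DualHarmonic.killing n) q x (V x) =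
        2 ^ (q / 2) * DualHarmonic.svPow g (DualHarmonic.mform n) q x (Z x) := by
    filter_upwards [hZ] with x hx
    have hN := DualHarmonic.posDefOn_hypTangent (huh x)
    have hβ : ∀ v ∈ DualHarmonic.hypTangent (u x), ∀ w ∈ DualHarmonic.hypTangent (u x),
        DualHarmonic.killing n (DualHarmonic.beta (u x) v) (DualHarmonic.beta (u x) w) =
          2 * DualHarmonic.mform n v w := fun v hv w _ =>
      DualHarmonic.killing_beta_beta (huh x) hv w
    subst hV
    refine ⟨fun v => DualHarmonic.beta_mem (hx.1 v), ?_, ?_⟩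
    · have h := DualHarmonic.Spow_comp o hN hx.1 (DualHarmonic.beta (u x)) zero_le_two hβ q
      rw [← hx.2.1]
      exact h
    · exact DualHarmonic.svPow_comp o hN (DualHarmonic.posDefOn_hypTransvection (huh x)) hx.1
        (DualHarmonic.beta (u x)) zero_le_two (fun v hv => DualHarmonic.beta_mem hv) hβ hq0
  have hEV : DualHarmonic.dualEnergy g (DualHarmonic.killing n) D
      (fun x => DualHarmonic.projAd (u x)) q V 0 < ⊤ := by
    rw [DualHarmonic.dualEnergy_zero_eq]
    have e : ∫⁻ x in D, ENNReal.ofReal (DualHarmonic.svPow g (DualHarmonic.killing n) q x (V x))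
        ∂DualHarmonic.riemVol g = ∫⁻ x in D, ENNReal.ofReal (2 ^ (q / 2)) *
          ENNReal.ofReal (DualHarmonic.svPow g (DualHarmonic.mform n) q x (Z x))
          ∂DualHarmonic.riemVol g := by
      refine lintegral_congr_ae (ae_restrict_of_ae (hV'.mono fun x hx => ?_))
      beta_reduce
      rw [hx.2.2, ENNReal.ofReal_mul (by positivity)]
    rw [e, lintegral_const_mul' _ _ ENNReal.ofReal_ne_top]
    exact ENNReal.mul_lt_top ENNReal.ofReal_lt_top hEZ
  rw [← DualHarmonic.dualEnergy_zero_eq D (fun x => DualHarmonic.projVec (u x))] at hEZ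
  have hpairZ : ∀ (η : M → DualHarmonic.Mink n) (dη : DualHarmonic.OneForm M (DualHarmonic.Mink n)),
      DualHarmonic.IsSection (fun γ => DualHarmonic.vecAct (ρ γ)) q η dη →
      DualHarmonic.CompactSupportMod Γ η →
      DualHarmonic.PairsToZero g (DualHarmonic.mform n) D
        (DualHarmonic.Sform g (DualHarmonic.mform n) q Z) dη := fun η dη hη hηs =>
    (hu.pairsToZero hΓ hD hq' hη.isW1loc.hasWeakDiffV hη.equivariant hηs).of_ae_eq 1
      (hZ.mono fun x hx => by rw [hx.2.1, one_mul])
  have hpairV : ∀ (ψ : M → DualHarmonic.soLie n)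
      (dψ : DualHarmonic.OneForm M (DualHarmonic.soLie n)),
      DualHarmonic.IsTangentTest (fun γ => DualHarmonic.adAct (ρ γ)) g
        (fun x => DualHarmonic.projAd (u x)) q ψ dψ →
      DualHarmonic.PairsToZero g (DualHarmonic.killing n) D
        (DualHarmonic.Sform g (DualHarmonic.killing n) q V) dψ := fun ψ dψ hψ =>
    (hu.pairsToZero_beta hΓ hD hp hq' hψ).of_ae_eq ((2 : ℝ) ^ ((q - 2) / 2))
      (hV'.mono fun x hx => by rw [hx.2.1, DualHarmonic.pairing_smul_left])
  refine ⟨⟨hEZ, fun ξ dξ hξ => ?_, hpairZ⟩, hEV, fun ψ dψ hψ => ?_, hpairV⟩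
  · refine DualHarmonic.dualEnergy_zero_le o (fun x => DualHarmonic.posDefOn_hypTangent (huh x))
      (fun x => DualHarmonic.projVec_mem (huh x)) (fun x a ha => DualHarmonic.mform_projVec ha)
      (DualHarmonic.continuous_projVec huc) hq' (hZ.mono fun x hx => hx.1) ?_ hEZ
      (fun η dη hη => hpairZ η dη hη.isSection hη.support) hξ
    refine hmeas.congr (hZ.mono fun x hx => ?_)
    beta_reduce
    rw [hx.2.1, DualHarmonic.pairing_starAt_starAt]
  · refine DualHarmonic.dualEnergy_zero_le o
      (fun x => DualHarmonic.posDefOn_hypTransvection (huh x))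
      (fun x => DualHarmonic.projAd_mem (u x)) (fun x a ha => DualHarmonic.killing_projAd (huh x) ha)
      (DualHarmonic.continuous_projAd huc) hq' (hV'.mono fun x hx => hx.1) ?_ hEV hpairV hψ
    have hmeas' := hmeas.const_mul ((2 : ℝ) ^ ((q - 2) / 2) * (2 ^ ((q - 2) / 2) * 2))
    refine hmeas'.congr ?_
    filter_upwards [hZ, hV'] with x hx hx'
    have hA : ∀ v, DualHarmonic.starAt o (du x) v ∈ DualHarmonic.hypTangent (u x) := fun v => by
      rw [← hx.2.1]
      exact DualHarmonic.Spow_mem o (DualHarmonic.posDefOn_hypTangent (huh x)) hx.1 q v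
    rw [hx'.2.1, DualHarmonic.pairing_smul_left, DualHarmonic.pairing_smul_right,
      DualHarmonic.pairing_killing_beta_beta o (huh x) hA, DualHarmonic.pairing_starAt_starAt]
    ring
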